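/- **Setting.** All test functions are smooth with compact support on $\mathbb R^3$: $s_0,s_1\in C_c^\infty(\mathbb R^3,\mathbb R)$, $f,f_0,f_1\in C_c^\infty(\mathbb R^3,\mathbb R^3)$. Let $\sigma(x)=(4\pi|x|)^{-1}$, let $(P_{tr}f)_i=f_i+\sum_j(\partial_i\partial_j\sigma)\star f_j$ (distributional derivatives, i.e. $(\partial_i\partial_j\sigma)\star f_j=\sigma\star\partial_i\partial_jf_j$), and for pairs $s=(s_0,s_1)$, $\vec f=(f_0,f_1)$ put $$\eta(s,s')=\int (s_1s_0'-s_0s_1'),\qquad \eta_{tr}(\vec f,\vec g)=\int (f_1\cdot P_{tr}g_0-g_1\cdot P_{tr}f_0).$$ Let $\mathcal W$ and $\mathcal W_{tr}$ be the Weyl $C^*$-algebras of $\eta$ and $\eta_{tr}$, generated by unitaries with $W(s)W(s')=e^{\frac i2\eta(s,s')}W(s+s')$ and $W_{tr}(\vec f)W_{tr}(\vec g)=e^{\frac i2\eta_{tr}(\vec f,\vec g)}W_{tr}(\vec f+\vec g)$. Let $\omega_0$ be a regular state of $\mathcal W$ and $\omega_{tr}$ a state of $\mathcal W_{tr}$,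 with GNS representations $\pi_0$ on $\mathfrak h_0$ and $\pi_{tr}$ on $\mathfrak h_{tr}$; a state is regular if $t\mapsto\pi(W(ts))$ is strongly continuous for every $s$. Let $h_+=L^2(\mathbb R^3,\mathbb C^4)$, $h_-=L^2(\mathbb R^3,\mathbb C^{4,*})$, $h=h_+\oplus h_-$, $\kappa(w_+\oplus\bar w_-)=w_-\oplus\bar w_+$, and let $\mathcal F_a(h)$ be the fermionic Fock space with creation and annihilation operators $a^*,a$. On $\mathcal H=\mathcal F_a(h)\otimes\mathfrak h_0\otimes\mathfrak h_{tr}$ consider, with identity operators on the remaining factors understood, * the Dirac field $\psi(w)=2^{-1/2}\bigl(a^*(w\oplus0)+a(\kappa(w\oplus0))\bigr)$, $w\in h_+$; * the twisted Weyl operators $W^\lambda(s)=\Gamma_a(u_s)\otimes\pi_0(W(s))\otimes 1$, where $\Gamma_a(u_s)$ is the second quantization of $u_s(w_+\oplus w_-)=e^{-i\sigma\star s_0}w_+\oplus e^{i\sigma\star s_0}w_-$; * the operators $W_{tr}(\vec f)=1\otimes1\otimes\pi_{tr}(W_{tr}(\vec f))$. Let $\phi^\lambda(s_0)$, $A(f_0)$,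 $\dot A(f_1)$ be the Stone generators given by $W^\lambda(ts_0,0)=e^{it\phi^\lambda(s_0)}$, $W_{tr}(tf_0,0)=e^{itA(f_0)}$, $W_{tr}(0,tf_1)=e^{it\dot A(f_1)}$, and put $$E^\lambda(f)=\phi^\lambda(\operatorname{div}f)-\dot A(f),\qquad \operatorname{div}E^\lambda(s_0)=-E^\lambda(\nabla s_0),$$ on the natural domain of the difference. For bounded $B,C$, the relation $[T,B]=C$ means that $B$ maps the domain of $T$ into itself and $TBv-BTv=Cv$ for all $v$ in it. **(I)** Assume $\omega_{tr}$ is regular. Then for all $f,s_0$ as above and all $w\in h_+$: 1. $E^\lambda(f)$ is essentially self-adjoint, and $$[E^\lambda(f),\psi(w)]=[\phi^\lambda(\operatorname{div}f),\psi(w)]=-\psi\bigl((\sigma\star\operatorname{div}f)\,w\bigr).$$ This is the smeared equal-time Coulomb-gauge relation: for every $y$, the function $x\mapsto f(x)\cdot(\nabla\sigma)(x-y)$ is integrable and $-(\sigma\star\operatorname{div}f)(y)=\int f(x)\cdot(\nabla\sigma)(x-y)\,dx$, i.e. formally $[E^\lambda_h(x),\psi(y)]=(\partial_h\sigma)(x-y)\,\psi(y)$.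 2. $\operatorname{div}E^\lambda(s_0)=-\phi^\lambda(\Delta s_0)+\dot A(\nabla s_0)$, as an equality of operators with their domains. 3. $[\operatorname{div}E^\lambda(s_0),\psi(w)]=-[\phi^\lambda(\Delta s_0),\psi(w)]=-\psi(s_0w)$. 4. $\operatorname{div}E^\lambda(s_0)$ is essentially self-adjoint and generates local gauge transformations: with the exponential of its closure, $$e^{it\operatorname{div}E^\lambda(s_0)}\,\psi(w)\,e^{-it\operatorname{div}E^\lambda(s_0)}=\psi(e^{-its_0}w)\qquad(t\in\mathbb R).$$ 5. $\operatorname{div}E^\lambda$ commutes with $A$: $e^{it\operatorname{div}E^\lambda(s_0)}$ commutes with $e^{irA(f)}$ for all $t,r\in\mathbb R$, and $$[\operatorname{div}E^\lambda(s_0),A(f)]=[\dot A(\nabla s_0),A(f)]=-i\int\nabla s_0\cdot P_{tr}f=0$$ on all vectors on which both products of the two operators are defined. **(II)** Let $\omega_{tr}$ be the transverse Fock state, $\omega_{tr}(W_{tr}(\vec f))=e^{-\frac14\|P_{tr}(f_0+if_1)\|_{L^2}^2}$. Then $\omega_{tr}$ is regular, the Coulomb condition $A(\nabla s_0)=\dot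 A(\nabla s_0)=0$ holds for all $s_0$, and $\operatorname{div}E^\lambda(s_0)=-\phi^\lambda(\Delta s_0)$. -/

import Mathlib

noncomputable section

namespace CoulombGauge

open MeasureTheory Topology Filter
open scoped Distributions LineDeriv TensorProduct ComplexOrder

section Fermions

variable {H : Type} [NormedAddCommGroup H] [InnerProductSpace ℂ H]

/-- The algebraic (finite-particle) antisymmetric Fock space over `H`: the exterior algebra. -/
def PreFock (H : Type) [NormedAddCommGroup H] [InnerProductSpace ℂ H] : Type :=
  ExteriorAlgebra ℂ H

instance : Ring (PreFock H) := inferInstanceAs (Ring (ExteriorAlgebra ℂ H))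
instance : Algebra ℂ (PreFock H) := inferInstanceAs (Algebra ℂ (ExteriorAlgebra ℂ H))

/-- The one-particle vectors `f ∈ H` inside the algebraic Fock space. -/
def wι : H →ₗ[ℂ] PreFock H := ExteriorAlgebra.ι ℂ

/-- The algebraic annihilation operator:
`f₁ ∧ ⋯ ∧ fₙ ↦ ∑ₖ (-1)^(k-1) ⟪f, fₖ⟫ f₁ ∧ ⋯ ∧ f̂ₖ ∧ ⋯ ∧ fₙ`. -/
def ann (f : H) : PreFock H →ₗ[ℂ] PreFock H :=
  CliffordAlgebra.contractLeft (Q := (0 : QuadraticForm ℂ H)) (innerₛₗ ℂ f)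

theorem PreFock.induction {P : PreFock H → Prop} (h0 : ∀ r : ℂ, P (algebraMap ℂ _ r))
    (h1 : ∀ x y, P x → P y → P (x + y)) (h2 : ∀ (f : H) x, P x → P (wι f * x)) (x) : P x :=
  CliffordAlgebra.left_induction (Q := (0 : QuadraticForm ℂ H)) (P := P) h0 h1
    (fun x m hx => h2 m x hx) x

theorem ann_wι_mul (f g : H) (x : PreFock H) :
    ann f (wι g * x) = (inner ℂ f g : ℂ) • x - wι g * ann f x :=
  CliffordAlgebra.contractLeft_ι_mul (Q := (0 : QuadraticForm ℂ H)) (innerₛₗ ℂ f) g x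

theorem ann_algebraMap (f : H) (r : ℂ) : ann f (algebraMap ℂ (PreFock H) r) = 0 :=
  CliffordAlgebra.contractLeft_algebraMap (0 : QuadraticForm ℂ H) (innerₛₗ ℂ f) r

theorem ann_one (f : H) : ann f (1 : PreFock H) = 0 :=
  CliffordAlgebra.contractLeft_one (0 : QuadraticForm ℂ H) (innerₛₗ ℂ f)

theorem ann_ann (f : H) (x : PreFock H) : ann f (ann f x) = 0 :=
  CliffordAlgebra.contractLeft_contractLeft _ x

theorem ann_add (f g : H) (x : PreFock H) : ann (f + g) x = ann f x + ann g x := by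
  rw [ann, map_add, map_add]; rfl

theorem ann_smul (c : ℂ) (f : H) (x : PreFock H) : ann (c • f) x = (starRingEnd ℂ c) • ann f x := by
  rw [ann, map_smulₛₗ, map_smul]; rfl

theorem wι_mul_wι_mul (f : H) (x : PreFock H) : wι f * (wι f * x) = 0 := by
  have h : (wι f * wι f : PreFock H) = 0 := ExteriorAlgebra.ι_sq_zero f
  rw [← mul_assoc, h, zero_mul]

theorem wι_anticomm (f g : H) (x : PreFock H) : wι f * (wι g * x) = - (wι g * (wι f * x)) := by
  have h : (wι f * wι g + wι g * wι f : PreFock H) = 0 := ExteriorAlgebra.ι_add_mul_swap f g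
  rw [← mul_assoc, ← mul_assoc, ← neg_mul, eq_neg_of_add_eq_zero_left h]

/-- The vacuum component. -/
def vac : PreFock H →ₐ[ℂ] ℂ := ExteriorAlgebra.algebraMapInv

theorem vac_wι (f : H) : vac (wι f) = 0 :=
  ExteriorAlgebra.lift_ι_apply ℂ (0 : H →ₗ[ℂ] ℂ) (by simp) f

/-- Antilinear functionals `b` are sent to `b ∘ ann f`. -/
def pullAnn : H →ₗ[ℂ] (PreFock H →ₗ⋆[ℂ] ℂ) →ₗ[ℂ] (PreFock H →ₗ⋆[ℂ] ℂ) :=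
  LinearMap.mk₂ ℂ (fun f b => b.comp (ann f))
    (fun f g b => by ext x; simp [ann_add])
    (fun c f b => by ext x; simp [ann_smul])
    (fun f b b' => by ext x; simp)
    (fun c f b => by ext x; simp)

/-- The functional `x ↦ ⟪x, Ω⟫` for the vacuum `Ω = 1`. -/
def vacFunctional : PreFock H →ₗ⋆[ℂ] ℂ where
  toFun x := starRingEnd ℂ (vac x)
  map_add' x y := by simp
  map_smul' c x := by simp

/-- `fockForm y x = ⟪x, y⟫`, determined by `⟪x, Ω⟫ = conj (vac x)` and
`⟪x, f ∧ y⟫ = ⟪ann f x, y⟫`; it satisfies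
`⟪f₁ ∧ ⋯ ∧ fₘ, g₁ ∧ ⋯ ∧ gₙ⟫ = δ_{mn} det ⟪fᵢ, gⱼ⟫`. -/
def fockForm : PreFock H →ₗ[ℂ] (PreFock H →ₗ⋆[ℂ] ℂ) :=
  CliffordAlgebra.foldr (0 : QuadraticForm ℂ H) pullAnn
    (fun f b => by ext x; simp [pullAnn, ann_ann]) vacFunctional

instance : Inner ℂ (PreFock H) := ⟨fun x y => fockForm y x⟩

theorem inner_algebraMap_right (x : PreFock H) (r : ℂ) :
    (inner ℂ x (algebraMap ℂ (PreFock H) r) : ℂ) = r * starRingEnd ℂ (vac x) := by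
  change CliffordAlgebra.foldr (0 : QuadraticForm ℂ H) pullAnn _ _ _ x = _
  erw [CliffordAlgebra.foldr_algebraMap]
  simp [vacFunctional]

theorem inner_wι_mul_right (f : H) (x y : PreFock H) :
    (inner ℂ x (wι f * y) : ℂ) = inner ℂ (ann f x) y := by
  change CliffordAlgebra.foldr (0 : QuadraticForm ℂ H) pullAnn _ _ _ x = _
  erw [CliffordAlgebra.foldr_mul, CliffordAlgebra.foldr_ι]
  rfl

theorem fock_add_left (x y z : PreFock H) :
    (inner ℂ (x + y) z : ℂ) = inner ℂ x z + inner ℂ y z := map_add (fockForm z) x y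
theorem fock_add_right (x y z : PreFock H) :
    (inner ℂ x (y + z) : ℂ) = inner ℂ x y + inner ℂ x z := by
  change fockForm (y + z) x = _
  rw [map_add]; rfl
theorem fock_smul_left (x y : PreFock H) (r : ℂ) :
    (inner ℂ (r • x) y : ℂ) = starRingEnd ℂ r * inner ℂ x y := map_smulₛₗ (fockForm y) r x
theorem fock_smul_right (x y : PreFock H) (r : ℂ) :
    (inner ℂ x (r • y) : ℂ) = r * inner ℂ x y := by
  change fockForm (r • y) x = _
  rw [map_smul]; rfl
theorem fock_zero_left (y : PreFock H) : (inner ℂ (0 : PreFock H) y : ℂ) = 0 := map_zero (fockForm y)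
theorem fock_zero_right (x : PreFock H) : (inner ℂ x (0 : PreFock H) : ℂ) = 0 := by
  change fockForm 0 x = _
  rw [map_zero]; rfl
theorem fock_neg_left (x y : PreFock H) : (inner ℂ (-x) y : ℂ) = - inner ℂ x y := map_neg (fockForm y) x
theorem fock_sub_left (x y z : PreFock H) :
    (inner ℂ (x - y) z : ℂ) = inner ℂ x z - inner ℂ y z := map_sub (fockForm z) x y
theorem fock_sub_right (x y z : PreFock H) :
    (inner ℂ x (y - z) : ℂ) = inner ℂ x y - inner ℂ x z := by
  change fockForm (y - z) x = _
  rw [map_sub]; rfl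

theorem inner_wι_mul_left (f : H) (x y : PreFock H) :
    (inner ℂ (wι f * x) y : ℂ) = inner ℂ x (ann f y) := by
  induction y using PreFock.induction generalizing x with
  | h0 r => simp [inner_algebraMap_right, ann_algebraMap, fock_zero_right, vac_wι]
  | h1 y z hy hz => simp [fock_add_right, hy, hz]
  | h2 g y ih =>
    rw [inner_wι_mul_right, ann_wι_mul, ann_wι_mul, fock_sub_left, fock_sub_right, fock_smul_left,
      fock_smul_right, ih, inner_wι_mul_right, inner_conj_symm]

theorem inner_one_left (x : PreFock H) : (inner ℂ (1 : PreFock H) x : ℂ) = vac x := by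
  induction x using PreFock.induction with
  | h0 r => simp [inner_algebraMap_right]
  | h1 x y hx hy => simp [fock_add_right, hx, hy]
  | h2 f x ih => simp [inner_wι_mul_right, ann_one, fock_zero_left, vac_wι]

theorem fock_conj_symm (x y : PreFock H) :
    starRingEnd ℂ (inner ℂ y x : ℂ) = inner ℂ x y := by
  induction y using PreFock.induction generalizing x with
  | h0 r =>
    rw [inner_algebraMap_right, Algebra.algebraMap_eq_smul_one, fock_smul_left, inner_one_left]
    simp
  | h1 y z hy hz => simp [fock_add_right, fock_add_left, hy, hz]
  | h2 g y ih => rw [inner_wι_mul_left, inner_wι_mul_right, ih]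

/-- Polynomials in the vectors of a list. -/
def words : List H → Submodule ℂ (PreFock H)
  | [] => Submodule.span ℂ {1}
  | e :: l => words l ⊔ (words l).map (LinearMap.mulLeft ℂ (wι e))

theorem mem_words_cons {e : H} {l : List H} {x : PreFock H} :
    x ∈ words (e :: l) ↔ ∃ y ∈ words l, ∃ z ∈ words l, x = y + wι e * z := by
  simp only [words, Submodule.mem_sup, Submodule.mem_map, LinearMap.mulLeft_apply]
  constructor
  · rintro ⟨y, hy, _, ⟨z, hz, rfl⟩, rfl⟩; exact ⟨y, hy, z, hz, rfl⟩
  · rintro ⟨y, hy, z, hz, rfl⟩; exact ⟨y, hy, _, ⟨z, hz, rfl⟩, rfl⟩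

theorem algebraMap_mem_words (l : List H) (r : ℂ) : algebraMap ℂ (PreFock H) r ∈ words l := by
  induction l with
  | nil => 
    rw [Algebra.algebraMap_eq_smul_one]
    exact Submodule.smul_mem _ _ (Submodule.subset_span rfl)
  | cons e l ih => exact mem_words_cons.2 ⟨_, ih, 0, zero_mem _, by simp⟩

theorem ann_words {e : H} {l : List H} (h : ∀ g ∈ l, (inner ℂ e g : ℂ) = 0) {x : PreFock H}
    (hx : x ∈ words l) : ann e x = 0 := by
  induction l generalizing x with
  | nil =>
    obtain ⟨r, rfl⟩ := Submodule.mem_span_singleton.1 hx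
    simp [ann_one]
  | cons g l ih =>
    obtain ⟨y, hy, z, hz, rfl⟩ := mem_words_cons.1 hx
    have h' : ∀ g ∈ l, (inner ℂ e g : ℂ) = 0 := fun g hg => h g (List.mem_cons_of_mem _ hg)
    simp [ann_wι_mul, ih h' hy, ih h' hz, h g List.mem_cons_self]

theorem wι_mul_words {v : H} {l : List H} (hv : v ∈ Submodule.span ℂ {g | g ∈ l}) {x : PreFock H}
    (hx : x ∈ words l) : wι v * x ∈ words l := by
  induction l generalizing v x with
  | nil =>
    have : v = 0 := by simpa using hv
    subst this; simp
  | cons e l ih =>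
    have hs : {g | g ∈ e :: l} = insert e {g | g ∈ l} := by ext; simp
    rw [hs, Submodule.mem_span_insert] at hv
    obtain ⟨c, v', hv', rfl⟩ := hv
    obtain ⟨y, hy, z, hz, rfl⟩ := mem_words_cons.1 hx
    refine mem_words_cons.2 ⟨wι v' * y, ih hv' hy, c • y - wι v' * z,
      sub_mem (Submodule.smul_mem _ _ hy) (ih hv' hz), ?_⟩
    rw [map_add, map_smul, add_mul, mul_add, mul_add, smul_mul_assoc, smul_mul_assoc,
      wι_mul_wι_mul, wι_anticomm v' e z, mul_sub, mul_smul_comm]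
    simp only [smul_zero]
    abel

theorem words_mono {v : H} {l : List H} {x : PreFock H} (hx : x ∈ words l) : x ∈ words (v :: l) :=
  mem_words_cons.2 ⟨x, hx, 0, zero_mem _, by simp⟩

theorem re_inner_words {l : List H} (hl : l.Pairwise fun a b => (inner ℂ a b : ℂ) = 0)
    (h1 : ∀ a ∈ l, ‖a‖ = 1) {x : PreFock H} (hx : x ∈ words l) :
    0 ≤ (inner ℂ x x : ℂ).re := by
  induction l generalizing x with
  | nil =>
    obtain ⟨r, rfl⟩ := Submodule.mem_span_singleton.1 hx
    rw [← Algebra.algebraMap_eq_smul_one, inner_algebraMap_right]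
    simp [Complex.mul_conj, Complex.normSq_nonneg]
  | cons e l ih =>
    obtain ⟨y, hy, z, hz, rfl⟩ := mem_words_cons.1 hx
    rw [List.pairwise_cons] at hl
    have ay := ann_words hl.1 hy
    have az := ann_words hl.1 hz
    have he : (inner ℂ e e : ℂ) = 1 := by
      rw [inner_self_eq_norm_sq_to_K, h1 e List.mem_cons_self]; simp
    have h1' : ∀ a ∈ l, ‖a‖ = 1 := fun a ha => h1 a (List.mem_cons_of_mem _ ha)
    rw [fock_add_left, fock_add_right, fock_add_right, inner_wι_mul_right, inner_wι_mul_right,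
      inner_wι_mul_left, ann_wι_mul, ay, az, he]
    simp only [fock_zero_left, fock_zero_right, mul_zero, sub_zero, one_smul, add_zero, zero_add,
      Complex.add_re]
    exact add_nonneg (ih hl.2 h1' hy) (ih hl.2 h1' hz)

theorem exists_list_words (x : PreFock H) : ∃ l : List H,
    ∀ V : List H, (∀ a ∈ l, a ∈ Submodule.span ℂ {g | g ∈ V}) → x ∈ words V := by
  induction x using PreFock.induction with
  | h0 r => exact ⟨[], fun V _ => algebraMap_mem_words V r⟩
  | h1 x y hx hy =>
    obtain ⟨l, hl⟩ := hx
    obtain ⟨m, hm⟩ := hy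
    exact ⟨l ++ m, fun V hV => add_mem (hl V fun a ha => hV a (by simp [ha]))
      (hm V fun a ha => hV a (by simp [ha]))⟩
  | h2 f x hx =>
    obtain ⟨l, hl⟩ := hx
    exact ⟨f :: l, fun V hV => wι_mul_words (hV f (by simp)) (hl V fun a ha => hV a (by simp [ha]))⟩

theorem fock_re_inner_nonneg (x : PreFock H) : 0 ≤ (inner ℂ x x : ℂ).re := by
  obtain ⟨l, hl⟩ := exists_list_words x
  let W : Submodule ℂ H := Submodule.span ℂ {g | g ∈ l}
  have : FiniteDimensional ℂ W := FiniteDimensional.span_of_finite ℂ (List.finite_toSet l)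
  let b := stdOrthonormalBasis ℂ W
  let V : List H := List.ofFn fun i => (b i : H)
  have ho : Orthonormal ℂ fun i => (b i : H) := b.orthonormal.comp_linearIsometry W.subtypeₗᵢ
  refine re_inner_words (l := V) ?_ ?_ (hl V fun a ha => ?_)
  · rw [List.pairwise_ofFn]
    intro i j hij
    exact ho.2 hij.ne
  · intro a ha
    obtain ⟨i, rfl⟩ := (List.mem_ofFn' _ _).1 ha
    exact ho.1 i
  · have haW : a ∈ W := Submodule.subset_span ha
    have : (⟨a, haW⟩ : W) ∈ Submodule.span ℂ (Set.range b) := by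
      rw [← OrthonormalBasis.coe_toBasis, Module.Basis.span_eq]; trivial
    have h2 := Submodule.mem_map_of_mem (f := W.subtype) this
    rw [Submodule.map_span] at h2
    refine Submodule.span_mono ?_ h2
    rintro _ ⟨_, ⟨i, rfl⟩, rfl⟩
    exact (List.mem_ofFn' _ _).2 ⟨i, rfl⟩

/-- The inner product of the algebraic Fock space. -/
abbrev fockCore : PreInnerProductSpace.Core ℂ (PreFock H) where
  conj_inner_symm x y := fock_conj_symm x y
  re_inner_nonneg x := fock_re_inner_nonneg x
  add_left := fock_add_left
  smul_left := fock_smul_left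

instance : SeminormedAddCommGroup (PreFock H) :=
  InnerProductSpace.Core.toSeminormedAddCommGroup (c := fockCore)
instance : InnerProductSpace ℂ (PreFock H) := InnerProductSpace.ofCore fockCore

theorem norm_wι_mul_le (f : H) (x : PreFock H) : ‖wι f * x‖ ≤ ‖f‖ * ‖x‖ := by
  have key : ∀ y : PreFock H, ‖y‖ ^ 2 = (inner ℂ y y : ℂ).re := fun y => norm_sq_eq_re_inner (𝕜 := ℂ) y
  refine le_of_sq_le_sq ?_ (by positivity)
  have h : (inner ℂ (wι f * x) (wι f * x) : ℂ)
      = (inner ℂ f f : ℂ) * inner ℂ x x - inner ℂ (ann f x) (ann f x) := by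
    rw [inner_wι_mul_left, ann_wι_mul, fock_sub_right, fock_smul_right, inner_wι_mul_right]
  rw [mul_pow, key, h, Complex.sub_re, ← key, inner_self_eq_norm_sq_to_K,
    inner_self_eq_norm_sq_to_K]
  have : (((‖f‖ : ℂ) ^ 2 * (‖x‖ : ℂ) ^ 2)).re = ‖f‖ ^ 2 * ‖x‖ ^ 2 := by norm_cast
  have h3 := sq_nonneg ‖ann f x‖
  simp only [Complex.coe_algebraMap] at *
  linarith

/-- The antisymmetric (fermionic) Fock space over `H`. -/
abbrev Fock (H : Type) [NormedAddCommGroup H] [InnerProductSpace ℂ H] : Type :=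
  UniformSpace.Completion (PreFock H)

/-- The fermionic creation operator `a*(f)`, `f₁ ∧ ⋯ ∧ fₙ ↦ f ∧ f₁ ∧ ⋯ ∧ fₙ`. -/
def creation (f : H) : Fock H →L[ℂ] Fock H :=
  ((LinearMap.mulLeft ℂ (wι f)).mkContinuous ‖f‖ (norm_wι_mul_le f)).completion

/-- The fermionic annihilation operator `a(f) = a*(f)*`. -/
def annihilation (f : H) : Fock H →L[ℂ] Fock H := ContinuousLinearMap.adjoint (creation f)

/-- The algebraic second quantization `f₁ ∧ ⋯ ∧ fₙ ↦ u f₁ ∧ ⋯ ∧ u fₙ`. -/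
def preSecondQuant (u : H →ₗᵢ[ℂ] H) : PreFock H →ₐ[ℂ] PreFock H :=
  ExteriorAlgebra.map u.toLinearMap

theorem preSecondQuant_wι (u : H →ₗᵢ[ℂ] H) (f : H) : preSecondQuant u (wι f) = wι (u f) :=
  ExteriorAlgebra.map_apply_ι _ f

theorem ann_preSecondQuant (u : H →ₗᵢ[ℂ] H) (f : H) (x : PreFock H) :
    ann (u f) (preSecondQuant u x) = preSecondQuant u (ann f x) := by
  induction x using PreFock.induction with
  | h0 r => simp [ann_algebraMap]
  | h1 x y hx hy => simp [hx, hy]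
  | h2 g x ih => simp [preSecondQuant_wι, ann_wι_mul, ih]

theorem inner_preSecondQuant (u : H →ₗᵢ[ℂ] H) (x y : PreFock H) :
    (inner ℂ (preSecondQuant u x) (preSecondQuant u y) : ℂ) = inner ℂ x y := by
  induction y using PreFock.induction generalizing x with
  | h0 r =>
    rw [AlgHom.commutes, inner_algebraMap_right, inner_algebraMap_right]
    congr 2
    induction x using PreFock.induction with
    | h0 r => simp
    | h1 x y hx hy => simp [hx, hy]
    | h2 g x ih => simp [preSecondQuant_wι, vac_wι]
  | h1 y z hy hz => rw [map_add, fock_add_right, fock_add_right, hy, hz]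
  | h2 g y ih =>
    rw [map_mul, preSecondQuant_wι, inner_wι_mul_right, ann_preSecondQuant, ih, inner_wι_mul_right]

/-- The fermionic second quantization `Γ_a(u)` of an isometry `u`. -/
def secondQuant (u : H →ₗᵢ[ℂ] H) : Fock H →L[ℂ] Fock H :=
  ((preSecondQuant u).toLinearMap.mkContinuous 1 (fun x => by
    rw [one_mul]
    refine le_of_eq ?_
    rw [← sq_eq_sq₀ (norm_nonneg _) (norm_nonneg _), norm_sq_eq_re_inner (𝕜 := ℂ),
      norm_sq_eq_re_inner (𝕜 := ℂ)]
    exact congrArg Complex.re (inner_preSecondQuant u x x))).completion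

end Fermions

section WeylAlgebras

variable {S : Type} [AddCommGroup S]

/-- `ℓ²(S)`. -/
abbrev Ell2 (S : Type) : Type := lp (fun _ : S => ℂ) 2

/-- `(W(s) ξ)(x) = exp((i/2) η(s, x - s)) ξ(x - s)`. -/
def weylFun (η : S → S → ℝ) (s : S) (ξ : S → ℂ) (x : S) : ℂ :=
  Complex.exp (((η s (x - s) / 2 : ℝ) : ℂ) * Complex.I) * ξ (x - s)

theorem norm_weylFun (η : S → S → ℝ) (s : S) (ξ : S → ℂ) (x : S) :
    ‖weylFun η s ξ x‖ = ‖ξ (x - s)‖ := by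
  rw [weylFun, norm_mul, Complex.norm_exp_ofReal_mul_I, one_mul]

theorem memℓp_weylFun (η : S → S → ℝ) (s : S) (ξ : Ell2 S) : Memℓp (weylFun η s ξ) 2 := by
  have h := lp.memℓp ξ
  have h2 : 0 < (2 : ENNReal).toReal := by norm_num
  rw [memℓp_gen_iff h2] at h ⊢
  simp only [norm_weylFun]
  exact (Equiv.subRight s).summable_iff.2 h

/-- The Weyl unitary `W(s)` in the twisted regular representation on `ℓ²(S)`. -/
def weylOp (η : S → S → ℝ) (s : S) : Ell2 S →L[ℂ] Ell2 S :=
  LinearMap.mkContinuous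
    { toFun := fun ξ => ⟨weylFun η s ξ, memℓp_weylFun η s ξ⟩
      map_add' := fun ξ ζ => by
        ext x
        exact mul_add _ _ _
      map_smul' := fun c ξ => by
        ext x
        simp only [weylFun, lp.coeFn_smul, Pi.smul_apply, smul_eq_mul, RingHom.id_apply]
        ring } 1 (fun ξ => by
    have h2 : 0 < (2 : ENNReal).toReal := by norm_num
    rw [one_mul]
    refine le_of_eq ?_
    rw [lp.norm_eq_tsum_rpow h2, lp.norm_eq_tsum_rpow h2]
    congr 1
    refine Eq.trans ?_ ((Equiv.subRight s).tsum_eq fun x => ‖ξ x‖ ^ (2 : ENNReal).toReal)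
    exact tsum_congr fun x => by
      change ‖weylFun η s ξ x‖ ^ _ = _
      rw [norm_weylFun]; rfl)

/-- The norm-closed *-algebra generated by the Weyl unitaries. -/
def weylSubalgebra (η : S → S → ℝ) : StarSubalgebra ℂ (Ell2 S →L[ℂ] Ell2 S) :=
  (StarAlgebra.adjoin ℂ (Set.range (weylOp η))).topologicalClosure

/-- The Weyl C*-algebra of a (possibly degenerate) symplectic form `η` on `S`: the C*-algebra
generated by unitaries `W(s)` with `W(s) W(s') = exp((i/2) η(s, s')) W(s + s')`. It is realized in
the regular representation on `ℓ²(S)`, which is faithful on the universal such C*-algebra because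
the abelian group `S` is amenable. -/
def WeylAlgebra (η : S → S → ℝ) : Type := weylSubalgebra η

instance (η : S → S → ℝ) : NormedRing (WeylAlgebra η) :=
  inferInstanceAs (NormedRing (weylSubalgebra η))
instance (η : S → S → ℝ) : StarRing (WeylAlgebra η) :=
  inferInstanceAs (StarRing (weylSubalgebra η))
instance (η : S → S → ℝ) : CStarRing (WeylAlgebra η) :=
  inferInstanceAs (CStarRing (weylSubalgebra η))
instance (η : S → S → ℝ) : NormedAlgebra ℂ (WeylAlgebra η) :=
  inferInstanceAs (NormedAlgebra ℂ (weylSubalgebra η))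
instance (η : S → S → ℝ) : StarModule ℂ (WeylAlgebra η) :=
  inferInstanceAs (StarModule ℂ (weylSubalgebra η))
instance (η : S → S → ℝ) : CompleteSpace (WeylAlgebra η) :=
  IsClosed.completeSpace_coe
    (hs := StarSubalgebra.isClosed_topologicalClosure (StarAlgebra.adjoin ℂ (Set.range (weylOp η))))
instance (η : S → S → ℝ) : CStarAlgebra (WeylAlgebra η) where

instance (η : S → S → ℝ) : PartialOrder (WeylAlgebra η) := CStarAlgebra.spectralOrder _

instance (η : S → S → ℝ) : StarOrderedRing (WeylAlgebra η) := CStarAlgebra.spectralOrderedRing _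

/-- The generator `W(s)` of the Weyl algebra. -/
def weyl (η : S → S → ℝ) (s : S) : WeylAlgebra η :=
  ⟨weylOp η s, StarSubalgebra.le_topologicalClosure _
    (StarAlgebra.subset_adjoin ℂ _ (Set.mem_range_self s))⟩

/-- Positive linear functionals on the Weyl algebra. -/
abbrev WeylFunctional (η : S → S → ℝ) : Type := WeylAlgebra η →ₚ[ℂ] ℂ

/-- A state is a positive linear functional with `ω(1) = 1`. -/
def IsState {η : S → S → ℝ} (ω : WeylFunctional η) : Prop := ω 1 = 1

/-- A state `ω` of the Weyl algebra is regular if `t ↦ π_ω(W(t s))` is strongly continuous for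
every `s`, where `π_ω` is the GNS representation. -/
def IsRegular [Module ℝ S] {η : S → S → ℝ} (ω : WeylFunctional η) : Prop :=
  ∀ (s : S) (v : ω.GNS), Continuous fun t : ℝ => ω.gnsStarAlgHom (weyl η (t • s)) v

end WeylAlgebras

section UnboundedOperators

variable {K : Type} [NormedAddCommGroup K] [InnerProductSpace ℂ K]

/-- Strongly continuous one-parameter unitary groups. -/
structure IsUnitaryGroup (U : ℝ → K →L[ℂ] K) : Prop where
  zero : U 0 = 1
  add : ∀ t r, U (t + r) = U t * U r
  norm_map : ∀ t v, ‖U t v‖ = ‖v‖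
  continuous : ∀ v, Continuous fun t => U t v

/-- The Stone generator `T` of `U(t) = exp(i t T)`: its domain consists of all `v` for which
`t ↦ U(t) v` is differentiable at `0`, and `T v = -i (d/dt) U(t) v` at `t = 0`. -/
def stoneGenerator (U : ℝ → K →L[ℂ] K) : K →ₗ.[ℂ] K where
  domain :=
    { carrier := {v | DifferentiableAt ℝ (fun t => U t v) 0}
      zero_mem' := by simp
      add_mem' := fun {v w} hv hw => by
        simp only [Set.mem_ofPred_eq, map_add] at *
        exact hv.add hw
      smul_mem' := fun c v hv => by
        simp only [Set.mem_ofPred_eq, map_smul] at *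
        exact hv.const_smul c }
  toFun :=
    { toFun := fun v => -Complex.I • deriv (fun t => U t (v : K)) 0
      map_add' := fun v w => by
        have h : (fun t => U t ((v + w : _) : K)) = fun t => U t (v : K) + U t (w : K) := by
          ext t; simp
        rw [h, deriv_fun_add v.2 w.2, smul_add]
      map_smul' := fun c v => by
        have h : (fun t => U t ((c • v : _) : K)) = fun t => c • U t (v : K) := by
          ext t; simp
        rw [h, deriv_fun_const_smul c v.2, smul_comm]; rfl }

/-- `U(t) = exp(i t T̄)`, where the closure `T̄` of `T` is self-adjoint, being the generator of a
strongly continuous unitary group. -/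
def IsExp (T : K →ₗ.[ℂ] K) (U : ℝ → K →L[ℂ] K) : Prop :=
  IsUnitaryGroup U ∧ stoneGenerator U = T.closure

/-- `[T, B] = C` for bounded `B`, `C`, on the whole domain of `T`, which `B` maps into itself. -/
def HasCommutator (T : K →ₗ.[ℂ] K) (B C : K →L[ℂ] K) : Prop :=
  ∀ v : T.domain, ∃ h : B v ∈ T.domain, T ⟨B v, h⟩ - B (T v) = C v

/-- `[S, T] = c • 1` on all vectors on which `S T` and `T S` are both defined. -/
def HasScalarCommutator (S T : K →ₗ.[ℂ] K) (c : ℂ) : Prop :=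
  ∀ (v : K) (hS : v ∈ S.domain) (hT : v ∈ T.domain) (hST : T ⟨v, hT⟩ ∈ S.domain)
    (hTS : S ⟨v, hS⟩ ∈ T.domain), S ⟨T ⟨v, hT⟩, hST⟩ - T ⟨S ⟨v, hS⟩, hTS⟩ = c • v

end UnboundedOperators

section TestFunctions

/-- Euclidean three-space. -/
abbrev Space : Type := EuclideanSpace ℝ (Fin 3)

/-- Real test functions (smooth with compact support). -/
abbrev ScalarTest : Type := 𝓓((⊤ : TopologicalSpace.Opens Space), ℝ)

/-- Real vector-valued test functions (smooth with compact support). -/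
abbrev VectorTest : Type := 𝓓((⊤ : TopologicalSpace.Opens Space), Space)

/-- The unit coordinate vectors. -/
def unit (i : Fin 3) : Space := EuclideanSpace.single i 1

/-- The `i`-th component of a vector-valued test function. -/
def comp (f : VectorTest) (i : Fin 3) : ScalarTest :=
  TestFunction.postcompCLM (EuclideanSpace.proj i : Space →L[ℝ] ℝ) f

/-- The partial derivative `∂ᵢ s`. -/
def partialD (i : Fin 3) (s : ScalarTest) : ScalarTest := ∂_{unit i} s

/-- The divergence. -/
def divergence (f : VectorTest) : ScalarTest := ∑ i, partialD i (comp f i)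

/-- The gradient. -/
def grad (s : ScalarTest) : VectorTest :=
  ∑ i, TestFunction.postcompCLM (ContinuousLinearMap.toSpanSingleton ℝ (unit i)) (partialD i s)

/-- The Laplacian. -/
def lap (s : ScalarTest) : ScalarTest := ∑ i, partialD i (partialD i s)

/-- The Coulomb potential `σ(x) = 1 / (4π|x|)`. -/
def coulomb (x : Space) : ℝ := (4 * Real.pi * ‖x‖)⁻¹

/-- The convolution `(σ ⋆ s)(x) = ∫ σ(y) s(x - y) dy`. -/
def coulombConv (s : ScalarTest) : Space → ℝ :=
  MeasureTheory.convolution coulomb s (ContinuousLinearMap.mul ℝ ℝ) volume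

/-- The transverse projection `(P_tr f)ᵢ = fᵢ + ∑ⱼ (∂ᵢ∂ⱼσ) ⋆ fⱼ`, that is, convolution with the
transverse delta `δᵢⱼ δ + ∂ᵢ∂ⱼσ`. The derivatives of `σ` are distributional, so that
`(∂ᵢ∂ⱼσ) ⋆ fⱼ = σ ⋆ ∂ᵢ∂ⱼfⱼ`. -/
def transverse (f : VectorTest) (x : Space) : Space :=
  WithLp.toLp 2 fun i => f x i + ∑ j, coulombConv (partialD i (partialD j (comp f j))) x

/-- The symplectic form `η(s, s') = ∫ (s₁ s'₀ - s₀ s'₁)`. -/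
def scalarForm (s s' : ScalarTest × ScalarTest) : ℝ := ∫ x, (s.2 x * s'.1 x - s.1 x * s'.2 x)

/-- The transverse symplectic form `η_tr(f, g) = ∫ (f₁ · P_tr g₀ - g₁ · P_tr f₀)`. -/
def transverseForm (f g : VectorTest × VectorTest) : ℝ :=
  ∫ x, (inner ℝ (f.2 x) (transverse g.1 x) - inner ℝ (g.2 x) (transverse f.1 x))

/-- The squared `L²`-norm `‖P_tr(f₀ + i f₁)‖²`. -/
def transverseNormSq (f : VectorTest × VectorTest) : ℝ :=
  ∫ x, (‖transverse f.1 x‖ ^ 2 + ‖transverse f.2 x‖ ^ 2)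

theorem aestronglyMeasurable_coulombConv (s : ScalarTest) :
    AEStronglyMeasurable (coulombConv s) volume := by
  have hc : Measurable coulomb := by
    unfold coulomb; fun_prop
  have hs : Measurable s := s.continuous.measurable
  have h : StronglyMeasurable fun p : Space × Space => coulomb p.2 * s (p.1 - p.2) :=
    ((hc.comp measurable_snd).mul (hs.comp (measurable_fst.sub measurable_snd))).stronglyMeasurable
  exact h.integral_prod_right'.aestronglyMeasurable

end TestFunctions

section DiracField

/-- The spin space `ℂ⁴`; its dual `ℂ^{4,*}` is identified with `ℂ⁴` by means of the dual basis. -/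
abbrev Spin : Type := EuclideanSpace ℂ (Fin 4)

/-- The space `L²(ℝ³, ℂ⁴)`. -/
abbrev Spinor : Type := Lp Spin 2 (volume : Measure Space)

/-- The one-particle space `h = h₊ ⊕ h₋`, with `h₊ = L²(ℝ³, ℂ⁴)` and `h₋ = L²(ℝ³, ℂ^{4,*})`. -/
abbrev DiracSpace : Type := WithLp 2 (Spinor × Spinor)

theorem memLp_phase (θ : Space → ℝ) (hθ : AEStronglyMeasurable θ volume) (w : Spinor) :
    MemLp (fun x => Complex.exp ((θ x : ℂ) * Complex.I) • w x) 2 volume := by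
  have hm : AEStronglyMeasurable (fun x => Complex.exp ((θ x : ℂ) * Complex.I)) volume := by
    exact Complex.continuous_exp.comp_aestronglyMeasurable
      ((Complex.continuous_ofReal.comp_aestronglyMeasurable hθ).mul_const _)
  refine (Lp.memLp w).of_le (hm.smul (Lp.aestronglyMeasurable w)) (Eventually.of_forall fun x => ?_)
  rw [norm_smul, Complex.norm_exp_ofReal_mul_I, one_mul]

/-- Multiplication of spinors by the phase `exp(iθ(x))`. -/
def phaseMul (θ : Space → ℝ) (hθ : AEStronglyMeasurable θ volume) : Spinor →ₗᵢ[ℂ] Spinor where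
  toFun w := (memLp_phase θ hθ w).toLp
  map_add' v w := by
    rw [← MemLp.toLp_add]
    refine MemLp.toLp_congr _ _ ?_
    filter_upwards [Lp.coeFn_add v w] with x hx
    simp only [hx, Pi.add_apply]
    exact smul_add _ _ _
  map_smul' c w := by
    rw [RingHom.id_apply, ← MemLp.toLp_const_smul]
    refine MemLp.toLp_congr _ _ ?_
    filter_upwards [Lp.coeFn_smul c w] with x hx
    simp only [hx, Pi.smul_apply]
    exact smul_comm _ _ _
  norm_map' w := by
    change ‖(memLp_phase θ hθ w).toLp‖ = _
    rw [Lp.norm_toLp, Lp.norm_def]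
    congr 1
    refine eLpNorm_congr_norm_ae (Eventually.of_forall fun x => ?_)
    rw [norm_smul, Complex.norm_exp_ofReal_mul_I, one_mul]

/-- The twist `u_{σ,s}(w₊ ⊕ w₋) = exp(-i σ⋆s₀) w₊ ⊕ exp(i σ⋆s₀) w₋`. -/
def twist (s : ScalarTest × ScalarTest) : DiracSpace →ₗᵢ[ℂ] DiracSpace where
  toFun w := WithLp.toLp 2
    (phaseMul (fun x => -coulombConv s.1 x) (aestronglyMeasurable_coulombConv s.1).neg w.fst,
      phaseMul (coulombConv s.1) (aestronglyMeasurable_coulombConv s.1) w.snd)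
  map_add' v w := by
    simp only [WithLp.add_fst, WithLp.add_snd, map_add]; rfl
  map_smul' c w := by
    simp only [WithLp.smul_fst, WithLp.smul_snd, map_smul]; rfl
  norm_map' w := by
    refine (sq_eq_sq₀ (norm_nonneg _) (norm_nonneg _)).1 ?_
    rw [WithLp.prod_norm_sq_eq_of_L2, WithLp.prod_norm_sq_eq_of_L2]
    simp

/-- Componentwise complex conjugation of `ℂ⁴`. -/
def conjSpin : Spin →L[ℝ] Spin :=
  LinearMap.toContinuousLinearMap
    { toFun := fun v => WithLp.toLp 2 fun i => starRingEnd ℂ (v i)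
      map_add' := fun v w => by ext i; simp
      map_smul' := fun c v => by ext i; simp }

/-- Pointwise complex conjugation of spinors. -/
def conjSpinor (w : Spinor) : Spinor := conjSpin.compLp w

/-- The conjugation `κ(w₊ ⊕ conj w₋) = w₋ ⊕ conj w₊`. -/
def kappa (w : DiracSpace) : DiracSpace := WithLp.toLp 2 (conjSpinor w.snd, conjSpinor w.fst)

/-- The Dirac (electron) field on the fermionic Fock space, for `w ∈ h₊`:
`ψ(w) = 2^{-1/2} (a*(w ⊕ 0) + a(κ(w ⊕ 0)))`. -/
def diracFock (w : Spinor) : Fock DiracSpace →L[ℂ] Fock DiracSpace :=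
  (((Real.sqrt 2)⁻¹ : ℝ) : ℂ) •
    (creation (WithLp.toLp 2 (w, 0)) + annihilation (kappa (WithLp.toLp 2 (w, 0))))

end DiracField

section Model

/-- The Fock state `ω_tr(W_tr(f)) = exp(-‖P_tr(f₀ + i f₁)‖² / 4)`. -/
def IsTransverseFock (ωtr : WeylFunctional transverseForm) : Prop :=
  ∀ f : VectorTest × VectorTest,
    ωtr (weyl transverseForm f) = ((Real.exp (-(1 / 4) * transverseNormSq f) : ℝ) : ℂ)

variable (ω₀ : WeylFunctional scalarForm) (ωtr : WeylFunctional transverseForm)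

/-- The Hilbert space `F_a(h) ⊗ h₀ ⊗ h_tr`, with `h₀`, `h_tr` the GNS spaces of the two states. -/
def Total : Type :=
  UniformSpace.Completion (Fock DiracSpace ⊗[ℂ] (ω₀.GNS ⊗[ℂ] ωtr.GNS))

instance : NormedAddCommGroup (Total ω₀ ωtr) := inferInstanceAs
  (NormedAddCommGroup (UniformSpace.Completion (Fock DiracSpace ⊗[ℂ] (ω₀.GNS ⊗[ℂ] ωtr.GNS))))
instance : InnerProductSpace ℂ (Total ω₀ ωtr) := inferInstanceAs
  (InnerProductSpace ℂ (UniformSpace.Completion (Fock DiracSpace ⊗[ℂ] (ω₀.GNS ⊗[ℂ] ωtr.GNS))))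
instance : CompleteSpace (Total ω₀ ωtr) := inferInstanceAs
  (CompleteSpace (UniformSpace.Completion (Fock DiracSpace ⊗[ℂ] (ω₀.GNS ⊗[ℂ] ωtr.GNS))))

/-- The operator `A ⊗ B ⊗ C`. -/
def tensorOp (A : Fock DiracSpace →L[ℂ] Fock DiracSpace) (B : ω₀.GNS →L[ℂ] ω₀.GNS)
    (C : ωtr.GNS →L[ℂ] ωtr.GNS) : Total ω₀ ωtr →L[ℂ] Total ω₀ ωtr :=
  (TensorProduct.mapL A (TensorProduct.mapL B C)).completion

/-- The Dirac field `ψ(w) = ψ(w) ⊗ 1 ⊗ 1`. -/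
def dirac (w : Spinor) : Total ω₀ ωtr →L[ℂ] Total ω₀ ωtr := tensorOp ω₀ ωtr (diracFock w) 1 1

/-- The twisted Weyl unitaries `W^λ(s) = Γ_a(u_{σ,s}) ⊗ π₀(W(s)) ⊗ 1`. -/
def twistedWeyl (s : ScalarTest × ScalarTest) : Total ω₀ ωtr →L[ℂ] Total ω₀ ωtr :=
  tensorOp ω₀ ωtr (secondQuant (twist s)) (ω₀.gnsStarAlgHom (weyl scalarForm s)) 1

/-- The transverse Weyl unitaries `1 ⊗ 1 ⊗ π_tr(W_tr(f))`. -/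
def transverseWeyl (f : VectorTest × VectorTest) : Total ω₀ ωtr →L[ℂ] Total ω₀ ωtr :=
  tensorOp ω₀ ωtr 1 1 (ωtr.gnsStarAlgHom (weyl transverseForm f))

/-- The twisted field `φ^λ(s₀)`, defined by `W^λ(t s₀, 0) = exp(i t φ^λ(s₀))`. -/
def phiField (s₀ : ScalarTest) : Total ω₀ ωtr →ₗ.[ℂ] Total ω₀ ωtr :=
  stoneGenerator fun t => twistedWeyl ω₀ ωtr (t • (s₀, 0))

/-- The vector potential `A(f₀)`, defined by `W_tr(t f₀, 0) = exp(i t A(f₀))`. -/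
def vectorPotential (f₀ : VectorTest) : Total ω₀ ωtr →ₗ.[ℂ] Total ω₀ ωtr :=
  stoneGenerator fun t => transverseWeyl ω₀ ωtr (t • (f₀, 0))

/-- The conjugate field `Ȧ(f₁)`, defined by `W_tr(0, t f₁) = exp(i t Ȧ(f₁))`. -/
def vectorPotentialDot (f₁ : VectorTest) : Total ω₀ ωtr →ₗ.[ℂ] Total ω₀ ωtr :=
  stoneGenerator fun t => transverseWeyl ω₀ ωtr (t • (0, f₁))

/-- The electric field `E^λ(f) = φ^λ(div f) - Ȧ(f)`. -/
def electricField (f : VectorTest) : Total ω₀ ωtr →ₗ.[ℂ] Total ω₀ ωtr :=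
  phiField ω₀ ωtr (divergence f) - vectorPotentialDot ω₀ ωtr f

/-- The charge density `div E^λ(s₀) = -E^λ(∇s₀)`. -/
def chargeDensity (s₀ : ScalarTest) : Total ω₀ ωtr →ₗ.[ℂ] Total ω₀ ωtr :=
  -electricField ω₀ ωtr (grad s₀)

end Model

end CoulombGauge

end

noncomputable section

namespace CoulombGauge

open MeasureTheory Topology Filter
open scoped Distributions LineDeriv TensorProduct ComplexOrder

/-! ### Generators of strongly continuous unitary groups -/

section UnitaryGroups

variable {K : Type} [NormedAddCommGroup K] [InnerProductSpace ℂ K]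

/-! The twisted exponentials act on the Dirac field by phases. Second quantization intertwines
creation and annihilation operators, and `kappa` carries the phase e^{-iσ⋆s₀} on h₊ to its conjugate
on h₋; hence W^λ(s) ψ(w) = ψ(e^{-iσ⋆s₀} w) W^λ(s) (`secondQuant_diracFock`, `twistedWeyl_dirac`).
Since σ⋆s₀ is bounded, t ↦ e^{-itσ⋆s₀} w is differentiable in L² for every w
(`hasDerivAt_phaseMul`). As ψ is bounded and linear in w, differentiating at t = 0 yields the
commutator with φ^λ(s₀) on its whole domain (`hasCommutator_stoneGenerator`,
`hasCommutator_phiField`). The field Ȧ acts on another tensor factor and does not contribute.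

Locality comes from Poisson's equation σ⋆Δs = -s (`coulombConv_lap`). It turns the nonlocal phase
e^{itσ⋆Δs₀} into e^{-its₀}, it makes P_tr vanish on gradients (`transverse_grad`), and it makes
gradients orthogonal to transverse fields (`integral_grad_transverse`). It is proved by regularizing
1/|z| to (|z|²+ε²)^{-1/2}, whose negative Laplacian 3ε²(|z|²+ε²)^{-5/2} tends to 4πδ. The same
regularization identifies ∇σ as the kernel of -σ⋆div.

The operators E^λ(f) and div E^λ(s₀) are sums of generators of commuting unitary groups. Such a sum
is essentially self-adjoint, and its closure generates the product group
(`IsUnitaryGroup.isExp_add`): averaging over both groups maps into both domains, commutes with the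
product group and tends strongly to 1. For div E^λ(s₀) the product group is the explicit
`gaugeGroup`. It commutes with every W_tr because (0, ∇s₀) lies in the radical of η_tr, and
commuting groups have commuting generators (`IsUnitaryGroup.hasScalarCommutator_zero`).

In the transverse Fock state the gradient elements lie in the radical and have expectation 1, so
their GNS unitaries are the identity (`gns_weyl_eq_one`) and the generators A(∇s₀), Ȧ(∇s₀) vanish.
-/

theorem opMul_apply (A B : K →L[ℂ] K) (v : K) : (A * B) v = A (B v) := rfl

/-- Passing to the graph lets equality, inclusion and closure of unbounded operators be decided on
pairs of vectors, without carrying domain proofs. -/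
theorem mem_graph_stoneGenerator {U : ℝ → K →L[ℂ] K} {v w : K} :
    (v, w) ∈ (stoneGenerator U).graph ↔ HasDerivAt (fun t => U t v) (Complex.I • w) 0 := by
  have hI : ∀ x : K, Complex.I • (-Complex.I) • x = x := fun x => by
    rw [smul_smul, mul_neg, Complex.I_mul_I, neg_neg, one_smul]
  rw [LinearPMap.mem_graph_iff]
  constructor
  · rintro ⟨y, rfl, rfl⟩
    have hy : DifferentiableAt ℝ (fun t => U t (y : K)) 0 := y.2
    change HasDerivAt _ (Complex.I • -Complex.I • deriv (fun t => U t (y : K)) 0) 0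
    rw [hI]
    exact hy.hasDerivAt
  · intro h
    refine ⟨⟨v, h.differentiableAt⟩, rfl, ?_⟩
    change -Complex.I • deriv (fun t => U t v) 0 = w
    rw [h.deriv, smul_comm, hI]

theorem stoneGenerator_hasDerivAt {U : ℝ → K →L[ℂ] K} (v : (stoneGenerator U).domain) :
    HasDerivAt (fun t => U t (v : K)) (Complex.I • stoneGenerator U v) 0 :=
  mem_graph_stoneGenerator.1 ((stoneGenerator U).mem_graph v)

theorem graph_eq_of_mem {T : K →ₗ.[ℂ] K} {v w : K} (h : (v, w) ∈ T.graph) :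
    ∃ hv : v ∈ T.domain, T ⟨v, hv⟩ = w := by
  obtain ⟨y, rfl, hy⟩ := T.mem_graph_iff.1 h
  exact ⟨y.2, hy⟩

/-- The generator of the constant group `1` is the zero operator. -/
theorem stoneGenerator_one : stoneGenerator (fun _ => (1 : K →L[ℂ] K)) = 0 := by
  refine LinearPMap.eq_of_eq_graph ?_
  ext ⟨v, w⟩
  rw [mem_graph_stoneGenerator, LinearPMap.mem_graph_iff]
  constructor
  · intro h
    have := h.unique (hasDerivAt_const (0 : ℝ) v)
    exact ⟨⟨v, trivial⟩, rfl, by simpa [eq_comm] using this⟩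
  · rintro ⟨y, rfl, hy⟩
    have : w = 0 := by simpa using hy.symm
    subst this
    simpa using hasDerivAt_const (0 : ℝ) (y : K)

/-- Reversing time changes the sign of the generator. -/
theorem stoneGenerator_neg (U : ℝ → K →L[ℂ] K) :
    stoneGenerator (fun t => U (-t)) = -stoneGenerator U := by
  refine LinearPMap.eq_of_eq_graph ?_
  ext ⟨v, w⟩
  rw [mem_graph_stoneGenerator, LinearPMap.mem_graph_iff]
  have key : ∀ (V : ℝ → K →L[ℂ] K) (w : K), HasDerivAt (fun t => V t v) (Complex.I • w) 0 →
      HasDerivAt (fun t => V (-t) v) (Complex.I • -w) 0 := by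
    intro V w h
    have h' : HasDerivAt (fun t => V t v) (Complex.I • w) (-(0 : ℝ)) := by simpa using h
    have := h'.scomp (0 : ℝ) (hasDerivAt_neg (0 : ℝ))
    simpa [Function.comp_def] using this
  constructor
  · intro h
    have h2 := key _ w h
    simp only [neg_neg] at h2
    obtain ⟨hv, hw⟩ := graph_eq_of_mem (mem_graph_stoneGenerator.2 h2)
    exact ⟨⟨v, hv⟩, rfl, by rw [LinearPMap.neg_apply, hw, neg_neg]⟩
  · rintro ⟨y, rfl, hy⟩
    simp only at *
    rw [← hy]
    exact key U _ (stoneGenerator_hasDerivAt (U := U) y)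

namespace IsUnitaryGroup

variable {U V W : ℝ → K →L[ℂ] K}

theorem mul_comm' (hU : IsUnitaryGroup U) (t r : ℝ) : U t * U r = U r * U t := by
  rw [← hU.add, ← hU.add, add_comm]

theorem reverse (hU : IsUnitaryGroup U) : IsUnitaryGroup fun t => U (-t) where
  zero := by rw [neg_zero, hU.zero]
  add t r := by rw [neg_add, hU.add]
  norm_map t := hU.norm_map _
  continuous v := (hU.continuous v).comp continuous_neg

/-- Strong continuity suffices for a moving argument because each U(t) is isometric. -/
theorem continuous_apply (hU : IsUnitaryGroup U) {f : ℝ → K} (hf : Continuous f) :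
    Continuous fun t => U t (f t) := by
  refine continuous_iff_continuousAt.2 fun t₀ => ?_
  rw [ContinuousAt, tendsto_iff_norm_sub_tendsto_zero]
  have h1 : Tendsto (fun t => ‖f t - f t₀‖ + ‖U t (f t₀) - U t₀ (f t₀)‖) (𝓝 t₀) (𝓝 (0 + 0)) :=
    (tendsto_iff_norm_sub_tendsto_zero.1 hf.continuousAt).add
      (tendsto_iff_norm_sub_tendsto_zero.1 (hU.continuous (f t₀)).continuousAt)
  rw [add_zero] at h1
  refine squeeze_zero (fun _ => norm_nonneg _) (fun t => ?_) h1
  calc ‖U t (f t) - U t₀ (f t₀)‖ = ‖U t (f t - f t₀) + (U t (f t₀) - U t₀ (f t₀))‖ := by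
        rw [map_sub]; abel_nf
    _ ≤ _ := by
        refine (norm_add_le _ _).trans ?_
        rw [hU.norm_map]

theorem mul (hV : IsUnitaryGroup V) (hW : IsUnitaryGroup W) (h : ∀ t r, V t * W r = W r * V t) :
    IsUnitaryGroup fun t => V t * W t where
  zero := by rw [hV.zero, hW.zero, one_mul]
  add t r := by
    rw [hV.add, hW.add, mul_assoc, mul_assoc, ← mul_assoc (V r), h r t, mul_assoc]
  norm_map t v := by
    rw [opMul_apply, hV.norm_map, hW.norm_map]
  continuous v := hV.continuous_apply (hW.continuous v)

/-- A product rule for a group that is only strongly continuous: V is differentiated on the single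
vector f(0), while the difference quotients of f are merely transported by V(t), which tends
strongly to 1. -/
theorem hasDerivAt_apply (hV : IsUnitaryGroup V) {f : ℝ → K} {f' w : K} (hf : HasDerivAt f f' 0)
    (h : HasDerivAt (fun t => V t (f 0)) w 0) : HasDerivAt (fun t => V t (f t)) (w + f') 0 := by
  rw [hasDerivAt_iff_tendsto_slope_zero] at *
  have hg : Tendsto (fun t : ℝ => V t (t⁻¹ • (f (0 + t) - f 0))) (𝓝[≠] 0) (𝓝 f') := by
    rw [tendsto_iff_norm_sub_tendsto_zero] at hf ⊢
    have h2 : Tendsto (fun t => ‖V t f' - f'‖) (𝓝[≠] 0) (𝓝 0) := by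
      have := (hV.continuous f').tendsto 0
      rw [hV.zero, tendsto_iff_norm_sub_tendsto_zero] at this
      exact this.mono_left nhdsWithin_le_nhds
    have h3 := hf.add h2
    rw [add_zero] at h3
    refine squeeze_zero (fun _ => norm_nonneg _) (fun t => ?_) h3
    -- With q the difference quotient, V(t)q - f' = V(t)(q - f') + (V(t)f' - f'), and the first term
    -- has the norm of q - f'.
    rw [← hV.norm_map t (t⁻¹ • (f (0 + t) - f 0) - f'), map_sub (V t)]
    refine (le_of_eq ?_).trans (norm_add_le _ _)
    congr 1; abel
  refine (h.add hg).congr fun t => ?_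
  have hr : ∀ (r : ℝ) (x : K), V t (r • x) = r • V t x := fun r x => (V t).map_smul_of_tower r x
  simp only [zero_add, hr, map_sub, hV.zero, one_apply_eq_self]
  rw [← smul_add]; congr 1; abel

theorem stoneGenerator_add_le (hV : IsUnitaryGroup V) (W : ℝ → K →L[ℂ] K)
    (hW : W 0 = 1) :
    stoneGenerator V + stoneGenerator W ≤ stoneGenerator fun t => V t * W t := by
  rw [← LinearPMap.le_graph_iff]
  rintro ⟨v, w⟩ h
  obtain ⟨y, rfl, rfl⟩ := (LinearPMap.mem_graph_iff _).1 h
  rw [mem_graph_stoneGenerator, LinearPMap.add_apply, smul_add]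
  refine hV.hasDerivAt_apply (stoneGenerator_hasDerivAt (U := W) ⟨y, y.2.2⟩) ?_
  simp only [hW]
  exact stoneGenerator_hasDerivAt (U := V) ⟨y, y.2.1⟩

section Complete

variable [CompleteSpace K]

/-- The operator `v ↦ ∫₀ʳ U(t) v dt`. -/
def integral (hU : IsUnitaryGroup U) (r : ℝ) : K →L[ℂ] K :=
  LinearMap.mkContinuous
    { toFun := fun v => ∫ t in (0 : ℝ)..r, U t v
      map_add' := fun v w => by
        simp only [map_add]
        exact intervalIntegral.integral_add ((hU.continuous v).intervalIntegrable _ _)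
          ((hU.continuous w).intervalIntegrable _ _)
      map_smul' := fun c v => by
        simp only [map_smul, RingHom.id_apply]
        exact intervalIntegral.integral_smul c _ } |r| (fun v => by
    have := intervalIntegral.norm_integral_le_of_norm_le_const (a := 0) (b := r) (C := ‖v‖)
      (f := fun t => U t v) (fun t _ => (hU.norm_map t v).le)
    simpa [mul_comm] using this)

theorem integral_apply (hU : IsUnitaryGroup U) (r : ℝ) (v : K) :
    hU.integral r v = ∫ t in (0 : ℝ)..r, U t v := rfl

theorem norm_integral_le (hU : IsUnitaryGroup U) (r : ℝ) (v : K) :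
    ‖hU.integral r v‖ ≤ |r| * ‖v‖ :=
  LinearMap.mkContinuous_norm_le' _ _ |>.trans (by simp) |> fun h =>
    (hU.integral r).le_of_opNorm_le h v

theorem integral_commute (hU : IsUnitaryGroup U) {B : K →L[ℂ] K} (h : ∀ t, B * U t = U t * B)
    (r : ℝ) (v : K) : B (hU.integral r v) = hU.integral r (B v) := by
  rw [integral_apply, integral_apply,
    ← ContinuousLinearMap.intervalIntegral_comp_comm B ((hU.continuous v).intervalIntegrable _ _)]
  exact intervalIntegral.integral_congr fun t _ => DFunLike.congr_fun (h t) v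

theorem hasDerivAt_integral (hU : IsUnitaryGroup U) (v : K) (r : ℝ) :
    HasDerivAt (fun r => hU.integral r v) (U r v) r :=
  ((hU.continuous v).integral_hasStrictDerivAt 0 r).hasDerivAt

theorem tendsto_average (hU : IsUnitaryGroup U) (v : K) :
    Tendsto (fun r : ℝ => r⁻¹ • hU.integral r v) (𝓝[≠] 0) (𝓝 v) := by
  have h := hasDerivAt_iff_tendsto_slope_zero.1 (hU.hasDerivAt_integral v 0)
  simpa [hU.zero, integral_apply] using h

/-- U(t) applied to the integral over [0, r] is the integral over [0, t + r] minus that over [0, t],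
which is differentiable in t by the fundamental theorem of calculus. Hence averages over the group
land in the domain. -/
theorem integral_mem_domain (hU : IsUnitaryGroup U) (r : ℝ) (v : K) :
    hU.integral r v ∈ (stoneGenerator U).domain := by
  have h : (fun t => U t (hU.integral r v)) = fun t => hU.integral (t + r) v - hU.integral t v := by
    ext t
    rw [integral_apply, integral_apply, integral_apply, ← ContinuousLinearMap.intervalIntegral_comp_comm
      (U t) ((hU.continuous v).intervalIntegrable _ _), intervalIntegral.integral_interval_sub_left
      ((hU.continuous v).intervalIntegrable _ _) ((hU.continuous v).intervalIntegrable _ _)]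
    have := intervalIntegral.integral_comp_add_left (a := 0) (b := r) (fun s => U s v) t
    rw [add_zero] at this
    rw [← this]
    exact intervalIntegral.integral_congr fun s _ => by simp [hU.add]
  change DifferentiableAt ℝ _ 0
  rw [h]
  have h1 : DifferentiableAt ℝ (fun t => hU.integral (t + r) v) 0 :=
    ((hU.hasDerivAt_integral v (0 + r)).comp_add_const 0 r).differentiableAt
  exact h1.sub (hU.hasDerivAt_integral v 0).differentiableAt

/-- The differential equation in integrated form. For each t the condition is continuous and linear
in (v, w), so it survives limits and bounded operators commuting with U; `isClosed_graph` and
`commute_generator` rest on this. -/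
theorem mem_graph_iff_integral (hU : IsUnitaryGroup U) {v w : K} :
    (v, w) ∈ (stoneGenerator U).graph ↔ ∀ t, U t v = v + Complex.I • hU.integral t w := by
  rw [mem_graph_stoneGenerator]
  constructor
  · intro h t
    -- The derivative at 0 is carried to s by U(t) = U(s) U(t - s).
    have hd : ∀ s, HasDerivAt (fun t => U t v) (Complex.I • U s w) s := by
      intro s
      have h0 : HasDerivAt (fun t => U t v) (Complex.I • w) (s - s) := by rwa [sub_self]
      have h1 := h0.comp_sub_const s s
      have h2 := ((U s).restrictScalars ℝ).hasFDerivAt.comp_hasDerivAt s h1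
      have h3 : (fun t => U t v) = ((U s).restrictScalars ℝ : K → K) ∘ fun t => U (t - s) v := by
        ext t
        change U t v = (U s * U (t - s)) v
        rw [← hU.add]; congr 2; ring
      rw [h3]
      simpa using h2
    have hc : Continuous fun s => Complex.I • U s w := (hU.continuous w).const_smul _
    have := intervalIntegral.integral_eq_sub_of_hasDerivAt (a := 0) (b := t)
      (fun s _ => hd s) (hc.intervalIntegrable _ _)
    rw [intervalIntegral.integral_smul, hU.zero] at this
    rw [integral_apply, this]; simp
  · intro h
    rw [show (fun t => U t v) = fun t => v + Complex.I • hU.integral t w from funext h]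
    have := ((hU.hasDerivAt_integral w 0).const_smul Complex.I).const_add v
    simpa [hU.zero] using this

theorem isClosed_graph (hU : IsUnitaryGroup U) :
    IsClosed ((stoneGenerator U).graph : Set (K × K)) := by
  have : ((stoneGenerator U).graph : Set (K × K)) =
      ⋂ t, {p | U t p.1 = p.1 + Complex.I • hU.integral t p.2} := by
    ext ⟨v, w⟩
    simp only [SetLike.mem_coe, hU.mem_graph_iff_integral, Set.mem_iInter, Set.mem_ofPred_eq]
  rw [this]
  exact isClosed_iInter fun t => isClosed_eq (by fun_prop) (by fun_prop)

theorem commute_generator (hU : IsUnitaryGroup U) {B : K →L[ℂ] K} (h : ∀ t, B * U t = U t * B)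
    {v w : K} (hv : (v, w) ∈ (stoneGenerator U).graph) :
    (B v, B w) ∈ (stoneGenerator U).graph := by
  rw [hU.mem_graph_iff_integral] at *
  intro t
  have := DFunLike.congr_fun (h t) v
  simp only [opMul_apply] at this
  rw [← this, hv t, map_add, map_smul, hU.integral_commute h]

/-- The closure of an operator whose graph is dense in the graph of a generator. -/
theorem isExp_of_dense (hU : IsUnitaryGroup U) {T : K →ₗ.[ℂ] K} (hT : T ≤ stoneGenerator U)
    (h : ∀ p ∈ (stoneGenerator U).graph, p ∈ closure (T.graph : Set (K × K))) : IsExp T U := by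
  refine ⟨hU, ?_⟩
  have hc : T.graph.topologicalClosure = (stoneGenerator U).graph := by
    refine le_antisymm (Submodule.topologicalClosure_minimal _ (LinearPMap.le_graph_of_le hT)
      hU.isClosed_graph) fun p hp => h p hp
  have : T.IsClosable := ⟨_, hc⟩
  refine LinearPMap.eq_of_eq_graph ?_
  rw [← this.graph_closure_eq_closure_graph, hc]

/-- The sum of the generators of commuting unitary groups is essentially self-adjoint. -/
theorem isExp_add (hV : IsUnitaryGroup V) (hW : IsUnitaryGroup W)
    (h : ∀ t r, V t * W r = W r * V t) :
    IsExp (stoneGenerator V + stoneGenerator W) (fun t => V t * W t) := by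
  have hU := hV.mul hW h
  have hle := hV.stoneGenerator_add_le W hW.zero
  refine hU.isExp_of_dense hle ?_
  rintro ⟨v, w⟩ hp
  have hcW : ∀ r t, hW.integral r * (V t * W t) = V t * W t * hW.integral r := fun r t => by
    ext x
    simp only [opMul_apply]
    rw [hW.integral_commute (B := W t) (fun s => hW.mul_comm' t s),
      hW.integral_commute (B := V t) (fun s => h t s)]
  have hcV : ∀ r t, hV.integral r * (V t * W t) = V t * W t * hV.integral r := fun r t => by
    ext x
    simp only [opMul_apply]
    rw [hV.integral_commute (B := W t) (fun s => (h s t).symm),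
      hV.integral_commute (B := V t) (fun s => hV.mul_comm' t s)]
  -- The double average r⁻² ∫∫ V(t) W(t'). It commutes with the product group, so it preserves the
  -- graph of that generator, and it sends every vector into both domains.
  let J : ℝ → K →L[ℂ] K := fun r => (r⁻¹ : ℝ) • (hV.integral r * ((r⁻¹ : ℝ) • hW.integral r))
  have hJ : ∀ x, Tendsto (fun r => J r x) (𝓝[≠] 0) (𝓝 x) := by
    intro x
    have h1 := hV.tendsto_average x
    have h2 := hW.tendsto_average x
    rw [tendsto_iff_norm_sub_tendsto_zero] at h1 h2 ⊢
    have h3 := h2.add h1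
    rw [add_zero] at h3
    refine squeeze_zero' (Eventually.of_forall fun _ => norm_nonneg _) ?_ h3
    filter_upwards [self_mem_nhdsWithin] with r hr
    have hr : r ≠ 0 := hr
    -- The V-average is a contraction, so the error of the double average is at most the sum of the
    -- two single errors.
    have e : J r x - x = r⁻¹ • hV.integral r (r⁻¹ • hW.integral r x - x)
        + (r⁻¹ • hV.integral r x - x) := by
      simp only [J, smul_apply, opMul_apply, map_sub,
        smul_sub]
      abel
    rw [e]
    refine (norm_add_le _ _).trans (add_le_add_left ?_ _)
    rw [norm_smul, norm_inv, Real.norm_eq_abs]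
    have h4 := hV.norm_integral_le r (r⁻¹ • hW.integral r x - x)
    calc |r|⁻¹ * ‖hV.integral r (r⁻¹ • hW.integral r x - x)‖
        ≤ |r|⁻¹ * (|r| * ‖r⁻¹ • hW.integral r x - x‖) := by gcongr
      _ = _ := by rw [← mul_assoc, inv_mul_cancel₀ (abs_ne_zero.2 hr), one_mul]
  have hmem : ∀ r, (J r v, J r w) ∈ (stoneGenerator V + stoneGenerator W).graph := by
    intro r
    have hg : (J r v, J r w) ∈ (stoneGenerator fun t => V t * W t).graph := by
      refine hU.commute_generator (fun t => ?_) hp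
      ext x
      have e1 := DFunLike.congr_fun (hcW r t) x
      have e2 := DFunLike.congr_fun (hcV r t) (hW.integral r x)
      simp only [opMul_apply] at e1 e2
      have hs : ∀ (B : K →L[ℂ] K) (s : ℝ) (x : K), B (s • x) = s • B x :=
        fun B s x => B.map_smul_of_tower s x
      simp only [J, smul_apply, opMul_apply, hs, e1, e2]
    have hdV : J r v ∈ (stoneGenerator V).domain :=
      (stoneGenerator V).domain.smul_of_tower_mem _ (hV.integral_mem_domain r _)
    -- The two averages commute; exchanging them puts the W-average outermost.
    have hdW : J r v ∈ (stoneGenerator W).domain := by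
      have : J r v = r⁻¹ • hW.integral r (r⁻¹ • hV.integral r v) := by
        have hs : ∀ (B : K →L[ℂ] K) (s : ℝ) (x : K), B (s • x) = s • B x :=
          fun B s x => B.map_smul_of_tower s x
        simp only [J, smul_apply, opMul_apply, hs]
        rw [hW.integral_commute (B := hV.integral r) fun s => ?_]
        ext x
        exact (hV.integral_commute (fun t => (h t s).symm) r x).symm
      rw [this]
      exact (stoneGenerator W).domain.smul_of_tower_mem _ (hW.integral_mem_domain r _)
    -- On a vector lying in both domains the sum agrees with the generator of the product group,
    -- whose value at J r v is J r w.
    obtain ⟨hd, hw⟩ := graph_eq_of_mem hg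
    rw [LinearPMap.mem_graph_iff]
    refine ⟨⟨J r v, hdV, hdW⟩, rfl, ?_⟩
    rw [← hw]
    exact hle.2 rfl
  exact mem_closure_of_tendsto ((hJ v).prodMk_nhds (hJ w)) (Eventually.of_forall hmem)

/-- The generators of commuting unitary groups commute. -/
theorem hasScalarCommutator_zero (hW : IsUnitaryGroup W)
    (h : ∀ t r, V t * W r = W r * V t) {S : K →ₗ.[ℂ] K} (hS : S ≤ stoneGenerator V) :
    HasScalarCommutator S (stoneGenerator W) 0 := by
  intro v hvS hvT hST hTS
  have mS : ∀ y : S.domain, ((y : K), S y) ∈ (stoneGenerator V).graph := fun y =>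
    LinearPMap.le_graph_of_le hS (S.mem_graph y)
  have h1 := mem_graph_stoneGenerator.1 (mS ⟨v, hvS⟩)
  have h2 := mem_graph_stoneGenerator.1 (mS ⟨_, hST⟩)
  simp only at h1 h2
  -- The graph of the generator T of W is a V-invariant subspace, so it contains the difference
  -- quotients of t ↦ (V(t)v, V(t)Tv). Closedness puts their limit (iSv, iSTv) in the graph, that
  -- is, TSv = STv.
  have hmem : ∀ t : ℝ, (t⁻¹ • (V (0 + t) v - V 0 v),
      t⁻¹ • (V (0 + t) (stoneGenerator W ⟨v, hvT⟩) - V 0 (stoneGenerator W ⟨v, hvT⟩))) ∈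
        (stoneGenerator W).graph := by
    intro t
    have hc : ∀ t, (V t v, V t (stoneGenerator W ⟨v, hvT⟩)) ∈ (stoneGenerator W).graph := fun t =>
      hW.commute_generator (fun r => h t r) ((stoneGenerator W).mem_graph ⟨v, hvT⟩)
    exact (stoneGenerator W).graph.smul_of_tower_mem t⁻¹ (sub_mem (hc (0 + t)) (hc 0))
  have h3 := mem_closure_of_tendsto
    ((hasDerivAt_iff_tendsto_slope_zero.1 h1).prodMk_nhds (hasDerivAt_iff_tendsto_slope_zero.1 h2))
    (Eventually.of_forall hmem)
  rw [hW.isClosed_graph.closure_eq] at h3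
  obtain ⟨_, hw⟩ := graph_eq_of_mem ((stoneGenerator W).graph.smul_mem (-Complex.I) h3)
  have hI : ∀ x : K, -Complex.I • Complex.I • x = x := fun x => by
    rw [smul_smul, neg_mul, Complex.I_mul_I, neg_neg, one_smul]
  simp only [hI] at hw
  rw [← hw, zero_smul, sub_self]

end Complete

end IsUnitaryGroup

/-- If `V(t) B V(-t) = B(t)` with `B(t)` strongly differentiable at `0`, then `B` preserves the
domain of the generator. -/
theorem hasCommutator_stoneGenerator {V : ℝ → K →L[ℂ] K} {B : ℝ → K →L[ℂ] K} {C : K →L[ℂ] K}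
    (hV0 : V 0 = 1) (h : ∀ t, V t * B 0 = B t * V t) (hB : HasDerivAt B (Complex.I • C) 0) :
    HasCommutator (stoneGenerator V) (B 0) C := by
  intro v
  have h1 := stoneGenerator_hasDerivAt (U := V) v
  have hB' : HasDerivAt (fun t => (B t).restrictScalars ℝ)
      ((Complex.I • C).restrictScalars ℝ) 0 :=
    (ContinuousLinearMap.restrictScalarsL ℂ K K ℝ ℝ).hasFDerivAt.comp_hasDerivAt 0 hB
  have h2 : HasDerivAt (fun t => V t (B 0 v))
      (Complex.I • (C v + B 0 (stoneGenerator V v))) 0 := by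
    -- The derivative of V(t)B(0)v is taken on the right side of V(t)B(0) = B(t)V(t), where the
    -- product rule applies to v in the domain; this also proves that B(0)v is in the domain.
    have h3 := hB'.clm_apply h1
    have h4 : (fun t => V t (B 0 v)) = fun t => (B t).restrictScalars ℝ (V t v) := by
      ext t
      exact DFunLike.congr_fun (h t) (v : K)
    rw [h4, smul_add, ← map_smul]
    simpa [hV0] using h3
  obtain ⟨hd, hw⟩ := graph_eq_of_mem (mem_graph_stoneGenerator.2 h2)
  exact ⟨hd, by rw [hw, add_sub_cancel_right]⟩

end UnitaryGroups

/-! ### The Newton kernel: integrability, integration by parts, fundamental solution -/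

section Kernel

/-- In polar coordinates the Jacobian is y², which absorbs every power up to 2: n = 1 serves σ and n
= 2 serves ∇σ. -/
theorem locallyIntegrable_inv_norm_pow {n : ℕ} (hn : n ≤ 2) :
    LocallyIntegrable (fun z : Space => (‖z‖ ^ n)⁻¹) volume := by
  rw [locallyIntegrable_iff]
  intro k hk
  obtain ⟨r, hr⟩ := hk.isBounded.subset_ball (0 : Space)
  refine IntegrableOn.mono_set ?_ hr
  refine (integrableOn_fun_norm_addHaar (volume : Measure Space) (f := fun y : ℝ => (y ^ n)⁻¹)).2 ?_
  have hc : IntegrableOn (fun y : ℝ => y ^ (2 - n)) (Set.Ioo 0 r) volume :=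
    (Continuous.integrableOn_Icc (by fun_prop)).mono_set Set.Ioo_subset_Icc_self
  refine hc.congr_fun (fun y hy => ?_) measurableSet_Ioo
  have h0 : y ≠ 0 := hy.1.ne'
  have h2 : Module.finrank ℝ Space - 1 = 2 := by simp
  simp only [h2, smul_eq_mul]
  rw [pow_sub₀ y h0 hn]

theorem coulomb_eq (z : Space) : coulomb z = (4 * Real.pi)⁻¹ * (‖z‖ ^ 1)⁻¹ := by
  rw [coulomb, mul_inv, pow_one]

theorem locallyIntegrable_coulomb : LocallyIntegrable coulomb volume := by
  rw [show coulomb = fun z => (4 * Real.pi)⁻¹ * (‖z‖ ^ 1)⁻¹ from funext coulomb_eq]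
  have h : LocallyIntegrable (fun z : Space => (‖z‖ ^ 1)⁻¹) volume :=
    locallyIntegrable_inv_norm_pow (by norm_num)
  exact h.smul ((4 * Real.pi)⁻¹ : ℝ)

theorem coulomb_neg (z : Space) : coulomb (-z) = coulomb z := by
  rw [coulomb, coulomb, norm_neg]

/-- The powers `(‖z‖² + ε²)^a`. -/
def regPow (ε a : ℝ) (z : Space) : ℝ := (‖z‖ ^ 2 + ε ^ 2) ^ a

variable {ε : ℝ}

theorem regPow_base_pos (hε : 0 < ε) (z : Space) : 0 < ‖z‖ ^ 2 + ε ^ 2 := by positivity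

theorem hasFDerivAt_regPow (hε : 0 < ε) (a : ℝ) (z : Space) :
    HasFDerivAt (regPow ε a) ((2 * a * regPow ε (a - 1) z) • innerSL ℝ z) z := by
  have h := ((hasFDerivAt_id z).norm_sq.add_const (ε ^ 2)).rpow_const (p := a)
    (Or.inl (regPow_base_pos hε z).ne')
  refine h.congr_fderiv ?_
  ext v
  simp [regPow]
  ring

theorem contDiff_regPow (hε : 0 < ε) (a : ℝ) : ContDiff ℝ 1 (regPow ε a) :=
  ((contDiff_norm_sq ℝ).add contDiff_const).rpow_const_of_ne fun z => (regPow_base_pos hε z).ne'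

theorem fderiv_regPow (hε : 0 < ε) (a : ℝ) (z v : Space) :
    fderiv ℝ (regPow ε a) z v = 2 * a * regPow ε (a - 1) z * inner ℝ z v := by
  rw [(hasFDerivAt_regPow hε a z).fderiv]; simp

/-- Integration by parts against a compactly supported function. -/
theorem integral_mul_fderiv_of_compact {φ u : Space → ℝ} (hφ : ContDiff ℝ 1 φ) (hu : ContDiff ℝ 1 u)
    (hc : HasCompactSupport u) (v : Space) :
    ∫ z, φ z * fderiv ℝ u z v = -∫ z, fderiv ℝ φ z v * u z := by
  have hφ' : Continuous fun z => fderiv ℝ φ z v := (hφ.continuous_fderiv one_ne_zero).clm_apply continuous_const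
  have hu' : Continuous fun z => fderiv ℝ u z v := (hu.continuous_fderiv one_ne_zero).clm_apply continuous_const
  have hc' : HasCompactSupport fun z => fderiv ℝ u z v := hc.fderiv_apply ℝ v
  refine integral_mul_fderiv_eq_neg_fderiv_mul_of_integrable ?_ ?_ ?_
    (fun z _ => hφ.differentiable one_ne_zero z) (fun z _ => hu.differentiable one_ne_zero z)
  · exact (hφ'.mul hu.continuous).integrable_of_hasCompactSupport hc.mul_left
  · exact (hφ.continuous.mul hu').integrable_of_hasCompactSupport hc'.mul_left
  · exact (hφ.continuous.mul hu.continuous).integrable_of_hasCompactSupport hc.mul_left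

/-- For ε > 0 the power has no singularity, so integrating by parts leaves no contribution at the
origin. -/
theorem integral_regPow_mul_fderiv (hε : 0 < ε) (a : ℝ) {u : Space → ℝ} (hu : ContDiff ℝ 1 u)
    (hc : HasCompactSupport u) (v : Space) :
    ∫ z, regPow ε a z * fderiv ℝ u z v = -(2 * a) * ∫ z, inner ℝ z v * regPow ε (a - 1) z * u z := by
  rw [integral_mul_fderiv_of_compact (contDiff_regPow hε a) hu hc, neg_mul, ← integral_const_mul]
  congr 2
  ext z
  rw [fderiv_regPow hε]; ring

/-- For nonpositive exponents the singular kernel ε = 0 dominates all its regularizations, which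
supplies the dominating functions in the limits below. -/
theorem regPow_le {a : ℝ} (ha : a ≤ 0) {z : Space} (hz : z ≠ 0) :
    regPow ε a z ≤ (‖z‖ ^ 2) ^ a :=
  Real.rpow_le_rpow_of_nonpos (by positivity) (by nlinarith [sq_nonneg ε]) ha

theorem regPow_nonneg (a : ℝ) (z : Space) : 0 ≤ regPow ε a z := by
  unfold regPow; positivity

theorem sq_rpow_neg_half (z : Space) : (‖z‖ ^ 2) ^ (-(1 / 2) : ℝ) = (‖z‖ ^ 1)⁻¹ := by
  rw [Real.rpow_neg (by positivity), ← Real.sqrt_eq_rpow, Real.sqrt_sq (norm_nonneg _), pow_one]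

theorem sq_rpow_neg_three_half (z : Space) :
    (‖z‖ ^ 2) ^ (-(1 / 2) - 1 : ℝ) = (‖z‖ ^ 3)⁻¹ := by
  rw [show (-(1 / 2) - 1 : ℝ) = -(3 / 2) by norm_num, Real.rpow_neg (by positivity),
    ← Real.rpow_natCast, ← Real.rpow_mul (norm_nonneg _), ← Real.rpow_natCast]
  norm_num

theorem tendsto_regPow (a : ℝ) {z : Space} (hz : z ≠ 0) :
    Tendsto (fun ε => regPow ε a z) (𝓝[>] 0) (𝓝 ((‖z‖ ^ 2) ^ a)) := by
  have h : ContinuousAt (fun ε => regPow ε a z) 0 := by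
    unfold regPow
    refine ContinuousAt.rpow_const (by fun_prop) (Or.inl ?_)
    have : 0 < ‖z‖ := norm_pos_iff.2 hz
    positivity
  have h2 := h.tendsto
  simp only [regPow, ne_eq, OfNat.ofNat_ne_zero, not_false_eq_true, zero_pow, add_zero] at h2
  exact h2.mono_left nhdsWithin_le_nhds

theorem ae_ne_zero : ∀ᵐ z : Space, z ≠ 0 := by
  simp [ae_iff]

theorem tendsto_integral_regPow {u : Space → ℝ} (hu : Continuous u) (hc : HasCompactSupport u) :
    Tendsto (fun ε => ∫ z, regPow ε (-(1 / 2)) z * u z) (𝓝[>] 0) (𝓝 (∫ z, (‖z‖ ^ 1)⁻¹ * u z)) := by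
  refine tendsto_integral_filter_of_dominated_convergence (fun z => (‖z‖ ^ 1)⁻¹ * ‖u z‖) ?_ ?_ ?_ ?_
  · filter_upwards [self_mem_nhdsWithin] with ε hε
    exact ((contDiff_regPow hε _).continuous.mul hu).aestronglyMeasurable
  · refine Eventually.of_forall fun ε => ?_
    filter_upwards [ae_ne_zero] with z hz
    rw [norm_mul, Real.norm_of_nonneg (regPow_nonneg _ _), ← sq_rpow_neg_half]
    gcongr
    exact regPow_le (by norm_num) hz
  · exact (locallyIntegrable_inv_norm_pow (by norm_num)).integrable_smul_right_of_hasCompactSupport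
      hu.norm hc.norm
  · filter_upwards [ae_ne_zero] with z hz
    rw [← sq_rpow_neg_half]
    exact (tendsto_regPow _ hz).mul_const _

theorem abs_inner_mul_inv_le {z : Space} (v : Space) :
    |inner ℝ z v * (‖z‖ ^ 3)⁻¹| ≤ ‖v‖ * (‖z‖ ^ 2)⁻¹ := by
  rcases eq_or_ne z 0 with rfl | hz
  · simp
  have hz : 0 < ‖z‖ := norm_pos_iff.2 hz
  rw [abs_mul, abs_of_nonneg (a := (‖z‖ ^ 3)⁻¹) (by positivity)]
  calc |inner ℝ z v| * (‖z‖ ^ 3)⁻¹ ≤ ‖z‖ * ‖v‖ * (‖z‖ ^ 3)⁻¹ := by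
        gcongr; exact abs_real_inner_le_norm z v
    _ = _ := by field_simp

theorem integrable_inner_mul_inv {u : Space → ℝ} (hu : Continuous u) (hc : HasCompactSupport u)
    (v : Space) : Integrable (fun z => inner ℝ z v * (‖z‖ ^ 3)⁻¹ * u z) volume := by
  have hb : Integrable (fun z => (‖z‖ ^ 2)⁻¹ * (‖v‖ * ‖u z‖)) volume :=
    (locallyIntegrable_inv_norm_pow le_rfl).integrable_smul_right_of_hasCompactSupport
      (continuous_const.mul hu.norm) hc.norm.mul_left
  refine hb.mono' ?_ (Eventually.of_forall fun z => ?_)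
  · refine Measurable.aestronglyMeasurable ?_
    have := hu.measurable
    fun_prop
  · rw [norm_mul, Real.norm_eq_abs (inner ℝ z v * _)]
    calc _ ≤ ‖v‖ * (‖z‖ ^ 2)⁻¹ * ‖u z‖ := by gcongr; exact abs_inner_mul_inv_le v
      _ = _ := by ring

theorem tendsto_integral_regPow_inner {u : Space → ℝ} (hu : Continuous u)
    (hc : HasCompactSupport u) (v : Space) :
    Tendsto (fun ε => ∫ z, inner ℝ z v * regPow ε (-(1 / 2) - 1) z * u z) (𝓝[>] 0)
      (𝓝 (∫ z, inner ℝ z v * (‖z‖ ^ 3)⁻¹ * u z)) := by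
  refine tendsto_integral_filter_of_dominated_convergence
    (fun z => ‖inner ℝ z v * (‖z‖ ^ 3)⁻¹ * u z‖) ?_ ?_ ?_ ?_
  · filter_upwards [self_mem_nhdsWithin] with ε hε
    have := (contDiff_regPow hε (-(1 / 2) - 1)).continuous
    exact Continuous.aestronglyMeasurable (by fun_prop)
  · refine Eventually.of_forall fun ε => ?_
    filter_upwards [ae_ne_zero] with z hz
    rw [norm_mul, norm_mul, norm_mul, norm_mul, Real.norm_of_nonneg (regPow_nonneg _ _),
      ← sq_rpow_neg_three_half, Real.norm_of_nonneg (Real.rpow_nonneg (sq_nonneg ‖z‖) _)]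
    gcongr
    exact regPow_le (by norm_num) hz
  · exact (integrable_inner_mul_inv hu hc v).norm
  · filter_upwards [ae_ne_zero] with z hz
    rw [← sq_rpow_neg_three_half]
    exact ((tendsto_regPow _ hz).const_mul _).mul_const _

/-- Integration by parts across the singularity: it holds for each ε > 0, and both sides converge by
dominated convergence, the kernels |z|⁻¹ and |z|⁻² being locally integrable. -/
theorem integral_inv_norm_mul_fderiv {u : Space → ℝ} (hu : ContDiff ℝ 1 u)
    (hc : HasCompactSupport u) (v : Space) :
    ∫ z, (‖z‖ ^ 1)⁻¹ * fderiv ℝ u z v = ∫ z, inner ℝ z v * (‖z‖ ^ 3)⁻¹ * u z := by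
  have hu' : Continuous fun z => fderiv ℝ u z v :=
    (hu.continuous_fderiv one_ne_zero).clm_apply continuous_const
  refine tendsto_nhds_unique (tendsto_integral_regPow hu' (hc.fderiv_apply ℝ v)) ?_
  refine (tendsto_integral_regPow_inner hu.continuous hc v).congr' ?_
  filter_upwards [self_mem_nhdsWithin] with ε hε
  rw [integral_regPow_mul_fderiv hε _ hu hc]; norm_num

/-- The antiderivative y³(y² + 1)^{-3/2}/3 vanishes at 0 and tends to 1/3. The form `1 ^ 2` matches
`regPow` at ε = 1. -/
theorem integral_one_add_sq_rpow :
    ∫ y in Set.Ioi (0 : ℝ), y ^ 2 * (y ^ 2 + 1 ^ 2) ^ (-(5 / 2) : ℝ) = 1 / 3 := by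
  have hd : ∀ y ∈ Set.Ioi (0 : ℝ), HasDerivAt (fun y : ℝ => y ^ 3 * (y ^ 2 + 1 ^ 2) ^ (-(3 / 2) : ℝ) / 3)
      (y ^ 2 * (y ^ 2 + 1 ^ 2) ^ (-(5 / 2) : ℝ)) y := by
    intro y _
    have hp : 0 < y ^ 2 + 1 ^ 2 := by positivity
    have h1 : HasDerivAt (fun y : ℝ => (y ^ 2 + 1 ^ 2) ^ (-(3 / 2) : ℝ)) _ y :=
      (((hasDerivAt_pow 2 y).add_const (1 ^ 2 : ℝ)).rpow_const (p := -(3 / 2)) (Or.inl hp.ne'))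
    have h2 := ((hasDerivAt_pow 3 y).mul h1).div_const 3
    refine h2.congr_deriv ?_
    have e : (y ^ 2 + 1 ^ 2) ^ (-(3 / 2) : ℝ) = (y ^ 2 + 1 ^ 2) * (y ^ 2 + 1 ^ 2) ^ (-(5 / 2) : ℝ) := by
      rw [← Real.rpow_one_add' hp.le (by norm_num)]; norm_num
    rw [e, show (-(3 / 2) - 1 : ℝ) = -(5 / 2) by norm_num]
    push_cast
    ring
  have hc : Continuous fun y : ℝ => y ^ 3 * (y ^ 2 + 1 ^ 2) ^ (-(3 / 2) : ℝ) / 3 := by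
    have : Continuous fun y : ℝ => (y ^ 2 + 1 ^ 2) ^ (-(3 / 2) : ℝ) :=
      Continuous.rpow_const (by fun_prop) fun y => Or.inl (by positivity)
    fun_prop
  have hl : Tendsto (fun y : ℝ => y ^ 3 * (y ^ 2 + 1 ^ 2) ^ (-(3 / 2) : ℝ) / 3) atTop (𝓝 (1 / 3)) := by
    have h0 : Tendsto (fun y : ℝ => (1 + (y ^ 2)⁻¹) ^ (-(3 / 2) : ℝ)) atTop (𝓝 ((1 + 0) ^ (-(3 / 2) : ℝ))) :=
      ((tendsto_inv_atTop_zero.comp (tendsto_pow_atTop two_ne_zero)).const_add 1).rpow_const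
        (Or.inl (by norm_num))
    rw [add_zero, Real.one_rpow] at h0
    refine (h0.div_const 3).congr' ?_
    filter_upwards [eventually_gt_atTop 0] with y hy
    have e : (1 + (y ^ 2)⁻¹) = (y ^ 2 + 1 ^ 2) * (y ^ 2)⁻¹ := by field_simp
    rw [e, Real.mul_rpow (by positivity) (by positivity), Real.inv_rpow (by positivity),
      ← Real.rpow_neg (by positivity), ← Real.rpow_natCast, ← Real.rpow_mul hy.le,
      ← Real.rpow_natCast y 3]
    norm_num
    ring
  rw [integral_Ioi_of_hasDerivAt_of_nonneg hc.continuousWithinAt hd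
    (fun y _ => by positivity) hl]
  simp

theorem integral_regPow_one : ∫ z, regPow 1 (-(5 / 2)) z = 4 * Real.pi / 3 := by
  have h := integral_fun_norm_addHaar (volume : Measure Space)
    (fun y : ℝ => (y ^ 2 + 1 ^ 2) ^ (-(5 / 2) : ℝ))
  have hb : (volume : Measure Space).real (Metric.ball 0 1) = Real.pi * 4 / 3 := by
    rw [Measure.real, EuclideanSpace.volume_ball_fin_three]
    simp
    positivity
  have h2 : Module.finrank ℝ Space = 3 := by simp
  simp only [hb, h2, smul_eq_mul] at h
  rw [show 3 - 1 = 2 from rfl, integral_one_add_sq_rpow] at h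
  change ∫ z, regPow 1 (-(5 / 2)) z = _ at h
  rw [h]; simp; ring

/-- The substitution z = εw makes 3ε²(|z|²+ε²)^{-5/2} dz independent of ε and leaves u(εw), which
tends boundedly to u(0); the total mass is 3 · 4π/3. -/
theorem tendsto_integral_approx {u : Space → ℝ} (hu : Continuous u) (hc : HasCompactSupport u) :
    Tendsto (fun ε => 3 * ε ^ 2 * ∫ z, regPow ε (-(5 / 2)) z * u z) (𝓝[>] 0)
      (𝓝 (4 * Real.pi * u 0)) := by
  have hs : ∀ ε ∈ Set.Ioi (0 : ℝ), 3 * ∫ w, regPow 1 (-(5 / 2)) w * u (ε • w) =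
      3 * ε ^ 2 * ∫ z, regPow ε (-(5 / 2)) z * u z := by
    intro ε hε
    have hε : 0 < ε := hε
    have h := Measure.integral_comp_smul (volume : Measure Space)
      (fun z => regPow ε (-(5 / 2)) z * u z) ε
    have h2 : Module.finrank ℝ Space = 3 := by simp
    rw [h2, abs_of_pos (by positivity), smul_eq_mul, eq_inv_mul_iff_mul_eq₀ (by positivity)] at h
    rw [← h, ← integral_const_mul, ← integral_const_mul, ← integral_const_mul]
    congr 1
    ext w
    have e : regPow ε (-(5 / 2)) (ε • w) = (ε ^ 5)⁻¹ * regPow 1 (-(5 / 2)) w := by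
      rw [regPow, regPow, norm_smul, Real.norm_of_nonneg hε.le,
        show (ε * ‖w‖) ^ 2 + ε ^ 2 = ε ^ 2 * (‖w‖ ^ 2 + 1 ^ 2) by ring,
        Real.mul_rpow (by positivity) (by positivity)]
      congr 1
      rw [Real.rpow_neg (by positivity), ← Real.rpow_natCast, ← Real.rpow_natCast,
        ← Real.rpow_mul hε.le]
      norm_num
    rw [e]
    field_simp
  have hlim : Tendsto (fun ε : ℝ => ∫ w, regPow 1 (-(5 / 2)) w * u (ε • w)) (𝓝[>] 0)
      (𝓝 (∫ w, regPow 1 (-(5 / 2)) w * u 0)) := by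
    obtain ⟨C, hC⟩ := hc.exists_bound_of_continuous hu
    have hi : Integrable (regPow 1 (-(5 / 2))) volume := by
      -- The decay exponent 5 exceeds the dimension 3.
      have := integrable_rpow_neg_one_add_norm_sq (E := Space) (μ := volume) (r := 5)
        (by simp; norm_num)
      refine this.congr (Eventually.of_forall fun z => ?_)
      simp only [regPow]
      rw [add_comm, neg_div, one_pow]
    have hcont := (contDiff_regPow one_pos (-(5 / 2))).continuous
    refine tendsto_integral_filter_of_dominated_convergence
      (fun w => regPow 1 (-(5 / 2)) w * C) ?_ ?_ (hi.mul_const C) ?_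
    · exact Eventually.of_forall fun ε => Continuous.aestronglyMeasurable (by fun_prop)
    · refine Eventually.of_forall fun ε => Eventually.of_forall fun w => ?_
      rw [norm_mul, Real.norm_of_nonneg (regPow_nonneg _ _)]
      exact mul_le_mul_of_nonneg_left (hC _) (regPow_nonneg _ _)
    · refine Eventually.of_forall fun w => ?_
      have : Continuous fun ε : ℝ => regPow 1 (-(5 / 2)) w * u (ε • w) := by fun_prop
      have h := this.tendsto 0
      rw [zero_smul] at h
      exact h.mono_left nhdsWithin_le_nhds
  rw [integral_mul_const, integral_regPow_one] at hlim
  have h3 := hlim.const_mul 3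
  rw [show 3 * (4 * Real.pi / 3 * u 0) = 4 * Real.pi * u 0 by ring] at h3
  refine h3.congr' ?_
  filter_upwards [self_mem_nhdsWithin] with ε hε using hs ε hε

/-- `1/(4π‖z‖)` is the fundamental solution of `-Δ`. -/
theorem integral_coulomb_mul_laplacian {u : Space → ℝ} (hu : ContDiff ℝ 2 u)
    (hc : HasCompactSupport u) :
    ∫ z, coulomb z * ∑ i, fderiv ℝ (fun z => fderiv ℝ u z (unit i)) z (unit i) = -u 0 := by
  have hu1 : ContDiff ℝ 1 u := hu.of_le (by norm_num)
  have hd : ∀ i, ContDiff ℝ 1 fun z => fderiv ℝ u z (unit i) := fun i =>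
    (hu.fderiv_right (m := 1) (by norm_num)).clm_apply contDiff_const
  have hdc : ∀ i, HasCompactSupport fun z => fderiv ℝ u z (unit i) := fun i =>
    hc.fderiv_apply ℝ _
  have hdd : ∀ i, Continuous fun z => fderiv ℝ (fun z => fderiv ℝ u z (unit i)) z (unit i) :=
    fun i => ((hd i).continuous_fderiv one_ne_zero).clm_apply continuous_const
  have hddc : ∀ i, HasCompactSupport fun z => fderiv ℝ (fun z => fderiv ℝ u z (unit i)) z (unit i) :=
    fun i => (hdc i).fderiv_apply ℝ _
  have hreg : ∀ ε ∈ Set.Ioi (0 : ℝ), -(3 * ε ^ 2 * ∫ z, regPow ε (-(5 / 2)) z * u z) =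
      ∑ i, ∫ z, regPow ε (-(1 / 2)) z * fderiv ℝ (fun z => fderiv ℝ u z (unit i)) z (unit i) := by
    intro ε hε
    have hε : 0 < ε := hε
    have hcont : ∀ a, Continuous (regPow ε a) := fun a => (contDiff_regPow hε a).continuous
    have hinner : ∀ (v : Space) (a : ℝ), ContDiff ℝ 1 fun z => inner ℝ z v * regPow ε a z :=
      fun v a => (contDiff_id.inner ℝ contDiff_const).mul (contDiff_regPow hε a)
    have hint : ∀ i : Fin 3, Integrable (fun z => (regPow ε (-(3 / 2)) z
        - 3 * (z i) ^ 2 * regPow ε (-(5 / 2)) z) * u z) volume := fun i => by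
      have h1 := hcont (-(3 / 2))
      have h2 := hcont (-(5 / 2))
      have h3 := hu.continuous
      refine Continuous.integrable_of_hasCompactSupport (by fun_prop) hc.mul_left
    -- Two integrations by parts: the first produces zᵢ times the power -3/2, the second
    -- differentiates this product.
    have hterm : ∀ i : Fin 3, ∫ z, regPow ε (-(1 / 2)) z *
        fderiv ℝ (fun z => fderiv ℝ u z (unit i)) z (unit i) = -∫ z, (regPow ε (-(3 / 2)) z
        - 3 * (z i) ^ 2 * regPow ε (-(5 / 2)) z) * u z := by
      intro i
      rw [integral_regPow_mul_fderiv hε _ (hd i) (hdc i)]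
      rw [show (-(2 * (-(1 / 2)))) = (1 : ℝ) by norm_num, one_mul,
        integral_mul_fderiv_of_compact (hinner _ _) hu1 hc]
      congr 2
      ext z
      congr 1
      have h1 : HasFDerivAt (fun z : Space => inner ℝ z (unit i)) (innerSL ℝ (unit i)) z := by
        have := (innerSL ℝ (unit i)).hasFDerivAt (x := z)
        refine this.congr_of_eventuallyEq (Eventually.of_forall fun z => ?_)
        simp [real_inner_comm]
      have h2 := h1.mul (hasFDerivAt_regPow hε (-(1 / 2) - 1) z)
      refine (DFunLike.congr_fun h2.fderiv (unit i)).trans ?_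
      have e1 : (inner ℝ z (unit i) : ℝ) = z i := by simp [unit, EuclideanSpace.inner_single_right]
      have e2 : (inner ℝ (unit i) (unit i) : ℝ) = 1 := by
        simp [unit]
      simp only [_root_.add_apply, smul_apply, innerSL_apply_apply, smul_eq_mul, e1, e2]
      rw [show (-(1 / 2) - 1 - 1 : ℝ) = -(5 / 2) by norm_num,
        show (-(1 / 2) - 1 : ℝ) = -(3 / 2) by norm_num]
      ring
    simp only [hterm]
    rw [Finset.sum_neg_distrib, ← integral_finsetSum _ fun i _ => hint i, ← integral_const_mul]
    congr 2
    ext z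
    have hn : ‖z‖ ^ 2 = ∑ i, (z i) ^ 2 := EuclideanSpace.real_norm_sq_eq z
    have hp := regPow_base_pos hε z
    have e : regPow ε (-(3 / 2)) z = (‖z‖ ^ 2 + ε ^ 2) * regPow ε (-(5 / 2)) z := by
      rw [regPow, regPow, ← Real.rpow_one_add' hp.le (by norm_num)]; norm_num
    -- Written with the power -5/2, the sum over i has coefficient 3(|z|²+ε²) - 3|z|² = 3ε².
    rw [← Finset.sum_mul, e, hn]
    simp only [Fin.sum_univ_three]
    ring
  have hl1 := (tendsto_integral_approx hu.continuous hc).neg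
  have hl2 : Tendsto (fun ε => ∑ i, ∫ z, regPow ε (-(1 / 2)) z *
      fderiv ℝ (fun z => fderiv ℝ u z (unit i)) z (unit i)) (𝓝[>] 0) _ :=
    tendsto_finsetSum Finset.univ fun i _ => tendsto_integral_regPow (hdd i) (hddc i)
  -- Both sides of the regularized identity have limits as ε → 0: the approximate identity gives
  -- -4πu(0), and dominated convergence gives the singular integrals.
  have hE := tendsto_nhds_unique (hl1.congr' (by
    filter_upwards [self_mem_nhdsWithin] with ε hε using hreg ε hε)) hl2
  have hint : ∀ i : Fin 3, Integrable (fun z => (‖z‖ ^ 1)⁻¹ *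
      fderiv ℝ (fun z => fderiv ℝ u z (unit i)) z (unit i)) volume := fun i =>
    (locallyIntegrable_inv_norm_pow (by norm_num)).integrable_smul_right_of_hasCompactSupport
      (hdd i) (hddc i)
  rw [← integral_finsetSum _ fun i _ => hint i] at hE
  simp only [coulomb_eq, mul_assoc, ← Finset.mul_sum] at hE ⊢
  rw [integral_const_mul, ← hE]
  have := Real.pi_pos
  field_simp

end Kernel

/-! ### Differential calculus of test functions -/

section TestFunctionCalculus

theorem partialD_apply (i : Fin 3) (s : ScalarTest) (x : Space) :
    partialD i s x = fderiv ℝ s x (unit i) := by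
  change TestFunction.lineDerivCLM ℝ (unit i) s x = _
  rw [TestFunction.lineDerivCLM_eq_fderivCLM, TestFunction.fderivCLM_apply, if_pos (by simp)]

theorem comp_apply (f : VectorTest) (i : Fin 3) (x : Space) : comp f i x = f x i := rfl

theorem grad_apply (s : ScalarTest) (x : Space) (i : Fin 3) : grad s x i = partialD i s x := by
  unfold grad
  rw [FunLike.coe_sum, Finset.sum_apply, WithLp.ofLp_sum, Finset.sum_apply]
  rw [Finset.sum_eq_single i]
  · change (partialD i s x • unit i) i = _
    simp [unit]
  · intro j _ hj
    change (partialD j s x • unit j) i = _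
    simp [unit, hj.symm]
  · simp

theorem comp_grad (s : ScalarTest) (i : Fin 3) : comp (grad s) i = partialD i s := by
  ext x
  rw [comp_apply, grad_apply]

theorem divergence_grad (s : ScalarTest) : divergence (grad s) = lap s := by
  simp only [divergence, lap, comp_grad]

theorem contDiff_two (s : ScalarTest) : ContDiff ℝ 2 s :=
  s.contDiff.of_le (WithTop.coe_le_coe.2 (le_top : (2 : ℕ∞) ≤ ⊤))

theorem partialD_comm (i j : Fin 3) (s : ScalarTest) :
    partialD i (partialD j s) = partialD j (partialD i s) := by
  ext x
  have h2 := contDiff_two s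
  have hd : Differentiable ℝ (fderiv ℝ s) :=
    (h2.fderiv_right (m := 1) (by norm_num)).differentiable one_ne_zero
  have key : ∀ i j : Fin 3, partialD i (partialD j s) x = fderiv ℝ (fderiv ℝ s) x (unit i) (unit j) := by
    intro i j
    rw [partialD_apply, show (partialD j s : Space → ℝ) = fun y => fderiv ℝ s y (unit j) from
      funext fun y => partialD_apply j s y, fderiv_clm_apply (hd x) (differentiableAt_const _)]
    simp
  rw [key, key]
  exact (h2.contDiffAt.isSymmSndFDerivAt (by simp)).eq _ _

theorem partialD_add (i : Fin 3) (s s' : ScalarTest) :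
    partialD i (s + s') = partialD i s + partialD i s' := LineDeriv.lineDerivOp_add _ _ _

theorem partialD_smul (i : Fin 3) (t : ℝ) (s : ScalarTest) :
    partialD i (t • s) = t • partialD i s := LineDeriv.lineDerivOp_smul _ _ _

/-- The order of derivatives in which they occur in P_tr∇s, so that Poisson's equation can be
applied there. -/
theorem lap_partialD (i : Fin 3) (s : ScalarTest) :
    lap (partialD i s) = ∑ j, partialD i (partialD j (partialD j s)) := by
  refine Finset.sum_congr rfl fun j _ => ?_
  rw [partialD_comm j i s, partialD_comm j i]

theorem comp_add (f g : VectorTest) (i : Fin 3) : comp (f + g) i = comp f i + comp g i := rfl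

theorem comp_smul (t : ℝ) (f : VectorTest) (i : Fin 3) : comp (t • f) i = t • comp f i := rfl

theorem integrable_mul_test {g : Space → ℝ} (hg : Continuous g) (s : ScalarTest) :
    Integrable (fun x => g x * s x) volume :=
  (hg.mul s.continuous).integrable_of_hasCompactSupport s.hasCompactSupport.mul_left

/-- Integration by parts against a test function. -/
theorem integral_mul_partialD {φ : Space → ℝ} (hφ : ContDiff ℝ 1 φ) (s : ScalarTest) (i : Fin 3) :
    ∫ x, φ x * partialD i s x = -∫ x, fderiv ℝ φ x (unit i) * s x := by
  simp only [partialD_apply]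
  exact integral_mul_fderiv_of_compact hφ (s.contDiff.of_le (by exact_mod_cast le_top))
    s.hasCompactSupport _

end TestFunctionCalculus

/-! ### The Coulomb potential and Poisson's equation -/

section CoulombPotential

/-- Since σ is even, the base point can be moved into the test function, and statements at y reduce
to integrals against the kernel centred at the origin. -/
theorem coulombConv_eq (s : ScalarTest) (y : Space) :
    coulombConv s y = ∫ z, coulomb z * s (z + y) := by
  rw [coulombConv, convolution_def, ← integral_neg_eq_self]
  simp only [ContinuousLinearMap.mul_apply', coulomb_neg, sub_neg_eq_add, add_comm y]

theorem hasCompactSupport_shift {F : Type*} [Zero F] {u : Space → F} (hu : HasCompactSupport u)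
    (y : Space) : HasCompactSupport fun z => u (z + y) :=
  hu.comp_homeomorph (Homeomorph.addRight y)

theorem integrable_coulomb_mul {u : Space → ℝ} (hu : Continuous u) (hc : HasCompactSupport u) :
    Integrable (fun z => coulomb z * u z) volume :=
  locallyIntegrable_coulomb.integrable_smul_right_of_hasCompactSupport hu hc

theorem integrable_coulomb_mul_test (s : ScalarTest) (y : Space) :
    Integrable (fun z => coulomb z * s (z + y)) volume :=
  integrable_coulomb_mul (s.continuous.comp (continuous_add_const y))
    (hasCompactSupport_shift s.hasCompactSupport y)

theorem coulombConv_add (s s' : ScalarTest) (y : Space) :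
    coulombConv (s + s') y = coulombConv s y + coulombConv s' y := by
  simp only [coulombConv_eq]
  rw [← integral_add (integrable_coulomb_mul_test s y) (integrable_coulomb_mul_test s' y)]
  exact integral_congr_ae (Eventually.of_forall fun z => mul_add _ _ _)

theorem coulombConv_smul (t : ℝ) (s : ScalarTest) (y : Space) :
    coulombConv (t • s) y = t * coulombConv s y := by
  simp only [coulombConv_eq]
  rw [← integral_const_mul]
  exact integral_congr_ae (Eventually.of_forall fun z => mul_left_comm _ _ _)

theorem coulombConv_zero (y : Space) : coulombConv 0 y = 0 := by
  simpa using coulombConv_smul 0 0 y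

theorem coulombConv_sum {ι : Type*} (S : Finset ι) (f : ι → ScalarTest) (y : Space) :
    coulombConv (∑ j ∈ S, f j) y = ∑ j ∈ S, coulombConv (f j) y := by
  classical
  induction S using Finset.induction_on with
  | empty => simp [coulombConv_zero]
  | insert a S ha ih => rw [Finset.sum_insert ha, Finset.sum_insert ha, coulombConv_add, ih]

theorem hasFDerivAt_coulombConv (s : ScalarTest) (x : Space) :
    HasFDerivAt (coulombConv s) (convolution coulomb (fderiv ℝ s)
      ((ContinuousLinearMap.mul ℝ ℝ).precompR Space) volume x) x :=
  s.hasCompactSupport.hasFDerivAt_convolution_right _ locallyIntegrable_coulomb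
    (s.contDiff.of_le (by exact_mod_cast le_top)) x

theorem fderiv_coulombConv (s : ScalarTest) (x : Space) (i : Fin 3) :
    fderiv ℝ (coulombConv s) x (unit i) = coulombConv (partialD i s) x := by
  rw [(hasFDerivAt_coulombConv s x).fderiv]
  rw [convolution_precompR_apply _ locallyIntegrable_coulomb (s.hasCompactSupport.fderiv ℝ)
    ((s.contDiff (n := ⊤)).continuous_fderiv (by simp))]
  rw [coulombConv]
  congr 1

theorem contDiff_coulombConv (s : ScalarTest) : ContDiff ℝ 1 (coulombConv s) :=
  s.hasCompactSupport.contDiff_convolution_right _ locallyIntegrable_coulomb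
    (s.contDiff.of_le (by exact_mod_cast le_top))

theorem continuous_coulombConv (s : ScalarTest) : Continuous (coulombConv s) :=
  (contDiff_coulombConv s).continuous

/-- Inside the unit ball σ is integrable and s bounded; outside, σ is at most 1/(4π) and s
integrable. Boundedness makes multiplication by σ⋆s a bounded operator, so phase families are
differentiable on all of L². -/
theorem exists_bound_coulombConv (s : ScalarTest) : ∃ C, ∀ x, |coulombConv s x| ≤ C := by
  obtain ⟨M, hM⟩ := s.hasCompactSupport.exists_bound_of_continuous s.continuous
  have hM0 : 0 ≤ M := (norm_nonneg _).trans (hM 0)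
  have h1 : IntegrableOn (fun z => (‖z‖ ^ 1)⁻¹ * M) (Metric.closedBall (0 : Space) 1) volume :=
    ((locallyIntegrable_iff.1 (locallyIntegrable_inv_norm_pow (n := 1) (by norm_num))) _
      (isCompact_closedBall _ _)).mul_const M
  have hs : Integrable s volume :=
    s.continuous.integrable_of_hasCompactSupport s.hasCompactSupport
  rw [← integrable_indicator_iff measurableSet_closedBall] at h1
  refine ⟨(4 * Real.pi)⁻¹ * ((∫ z, (Metric.closedBall (0 : Space) 1).indicator
    (fun z => (‖z‖ ^ 1)⁻¹ * M) z) + ∫ z, ‖s z‖), fun x => ?_⟩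
  rw [coulombConv_eq, ← Real.norm_eq_abs]
  have hs' : Integrable (fun z => ‖s (z + x)‖) volume := (hs.comp_add_right x).norm
  have e : ∫ z, ‖s z‖ = ∫ z, ‖s (z + x)‖ := (integral_add_right_eq_self (fun z => ‖s z‖) x).symm
  rw [e, ← integral_add h1 hs', ← integral_const_mul]
  refine norm_integral_le_of_norm_le ((h1.add hs').const_mul _) (Eventually.of_forall fun z => ?_)
  rw [norm_mul, coulomb_eq, norm_mul, Real.norm_of_nonneg (r := (4 * Real.pi)⁻¹) (by positivity),
    Real.norm_of_nonneg (r := (‖z‖ ^ 1)⁻¹) (by positivity), mul_assoc]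
  refine mul_le_mul_of_nonneg_left ?_ (by positivity)
  by_cases hz : z ∈ Metric.closedBall (0 : Space) 1
  · rw [Set.indicator_of_mem hz]
    have : (‖z‖ ^ 1)⁻¹ * ‖s (z + x)‖ ≤ (‖z‖ ^ 1)⁻¹ * M := by gcongr; exact hM _
    linarith [norm_nonneg (s (z + x))]
  · rw [Set.indicator_of_notMem hz, zero_add]
    have h : 1 ≤ ‖z‖ := by
      simp only [Metric.mem_closedBall, dist_zero_right, not_le] at hz
      exact hz.le
    rw [pow_one]
    exact mul_le_of_le_one_left (norm_nonneg _) (inv_le_one_of_one_le₀ h)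

theorem fderiv_shift (s : ScalarTest) (y z : Space) (i : Fin 3) :
    fderiv ℝ (fun z => s (z + y)) z (unit i) = partialD i s (z + y) := by
  rw [fderiv_comp_add_right, partialD_apply]

/-- Poisson's equation `σ ⋆ Δs = -s`. -/
theorem coulombConv_lap (s : ScalarTest) (y : Space) : coulombConv (lap s) y = -s y := by
  have h := integral_coulomb_mul_laplacian (u := fun z => s (z + y))
    ((contDiff_two s).comp (contDiff_id.add contDiff_const))
    (hasCompactSupport_shift s.hasCompactSupport y)
  simp only [fderiv_shift, zero_add] at h
  rw [← h, coulombConv_eq]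
  simp only [lap, FunLike.coe_sum, Finset.sum_apply]

theorem gradient_coulomb {z : Space} (hz : z ≠ 0) :
    gradient coulomb z = -((4 * Real.pi)⁻¹ * (‖z‖ ^ 3)⁻¹) • z := by
  have hp : 0 < ‖z‖ ^ 2 := by have := norm_pos_iff.2 hz; positivity
  have h := ((hasFDerivAt_id z).norm_sq.rpow_const (p := -(1 / 2)) (Or.inl hp.ne')).const_mul
    (4 * Real.pi)⁻¹
  have e : coulomb = fun z => (4 * Real.pi)⁻¹ * (‖id z‖ ^ 2) ^ (-(1 / 2) : ℝ) := by
    ext w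
    rw [coulomb_eq, id, sq_rpow_neg_half]
  refine HasGradientAt.gradient ?_
  rw [hasGradientAt_iff_hasFDerivAt, e]
  refine h.congr_fderiv ?_
  ext v
  simp only [id, sq_rpow_neg_three_half]
  simp
  ring

theorem coulombConv_partialD (s : ScalarTest) (y : Space) (i : Fin 3) :
    coulombConv (partialD i s) y =
      ∫ z, (4 * Real.pi)⁻¹ * (inner ℝ z (unit i) * (‖z‖ ^ 3)⁻¹ * s (z + y)) := by
  have h := integral_inv_norm_mul_fderiv (u := fun z => s (z + y))
    ((s.contDiff.of_le (by exact_mod_cast le_top)).comp (contDiff_id.add contDiff_const))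
    (hasCompactSupport_shift s.hasCompactSupport y) (unit i)
  simp only [fderiv_shift] at h
  rw [integral_const_mul, ← h, coulombConv_eq, ← integral_const_mul]
  simp only [coulomb_eq, mul_assoc]

/-- The kernel of `-σ ⋆ div` is the gradient of `σ`. -/
theorem coulombConv_divergence (f : VectorTest) (y : Space) :
    Integrable (fun x => inner ℝ (f x) (gradient coulomb (x - y))) volume ∧
      -coulombConv (divergence f) y = ∫ x, inner ℝ (f x) (gradient coulomb (x - y)) := by
  have hi : ∀ i, Integrable (fun z => -((4 * Real.pi)⁻¹ *
      (inner ℝ z (unit i) * (‖z‖ ^ 3)⁻¹ * comp f i (z + y)))) volume := fun i =>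
    ((integrable_inner_mul_inv ((comp f i).continuous.comp (continuous_add_const y))
      (hasCompactSupport_shift (comp f i).hasCompactSupport y) (unit i)).const_mul _).neg
  have hae : (fun z => ∑ i, -((4 * Real.pi)⁻¹ * (inner ℝ z (unit i) * (‖z‖ ^ 3)⁻¹ *
      -- The formula for the gradient of σ is available only away from the origin, hence the
      -- equality almost everywhere.
      comp f i (z + y)))) =ᵐ[volume] fun z => inner ℝ (f (z + y)) (gradient coulomb z) := by
    filter_upwards [ae_ne_zero] with z hz
    rw [gradient_coulomb hz]
    simp [PiLp.inner_apply, Fin.sum_univ_three, comp_apply, unit]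
    ring
  have hI : Integrable (fun z => inner ℝ (f (z + y)) (gradient coulomb z)) volume :=
    (integrable_finsetSum _ fun i _ => hi i).congr hae
  constructor
  · have := hI.comp_sub_right y
    simpa using this
  · have e := integral_sub_right_eq_self
      (fun z => (inner ℝ (f (z + y)) (gradient coulomb z) : ℝ)) y (μ := volume)
    simp only [sub_add_cancel] at e
    rw [e, ← integral_congr_ae hae, integral_finsetSum _ fun i _ => hi i, divergence,
      coulombConv_sum, ← Finset.sum_neg_distrib]
    refine Finset.sum_congr rfl fun i _ => ?_
    rw [coulombConv_partialD, integral_neg]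

end CoulombPotential

/-! ### The transverse projection and gradients -/

section Transverse

theorem transverse_apply (f : VectorTest) (x : Space) (i : Fin 3) :
    transverse f x i = f x i + ∑ j, coulombConv (partialD i (partialD j (comp f j))) x := rfl

theorem transverse_add (f g : VectorTest) (x : Space) :
    transverse (f + g) x = transverse f x + transverse g x := by
  ext i
  simp only [PiLp.add_apply, transverse_apply, comp_add, partialD_add, coulombConv_add,
    Finset.sum_add_distrib]
  rw [show (f + g) x i = f x i + g x i from rfl]
  ring

theorem transverse_smul (t : ℝ) (f : VectorTest) (x : Space) :
    transverse (t • f) x = t • transverse f x := by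
  ext i
  simp only [PiLp.smul_apply, transverse_apply, comp_smul, partialD_smul, coulombConv_smul,
    smul_eq_mul, mul_add, Finset.mul_sum]
  rfl

theorem transverse_zero (x : Space) : transverse 0 x = 0 := by
  simpa using transverse_smul 0 0 x

theorem continuous_transverse (f : VectorTest) : Continuous (transverse f) := by
  refine (PiLp.continuous_toLp 2 _).comp (continuous_pi fun i => ?_)
  exact ((comp f i).continuous).add (continuous_finsetSum _ fun j _ => continuous_coulombConv _)

/-- P_tr g need not have compact support, but its product with the test field f does. -/
theorem integrable_inner_transverse (f g : VectorTest) :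
    Integrable (fun x => (inner ℝ (f x) (transverse g x) : ℝ)) volume := by
  refine (f.continuous.inner (continuous_transverse g)).integrable_of_hasCompactSupport ?_
  refine f.hasCompactSupport.mono fun x hx => ?_
  contrapose! hx
  simp_all

/-- The i-th component is ∂ᵢs + σ⋆Δ∂ᵢs, which is zero by Poisson's equation. -/
theorem transverse_grad (s : ScalarTest) (x : Space) : transverse (grad s) x = 0 := by
  ext i
  rw [transverse_apply, grad_apply]
  simp only [comp_grad]
  rw [← coulombConv_sum, ← lap_partialD, coulombConv_lap]
  simp

/-- Gradients are orthogonal to transverse fields. -/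
theorem integral_grad_transverse (s : ScalarTest) (f : VectorTest) :
    ∫ x, inner ℝ (grad s x) (transverse f x) = 0 := by
  have e : ∀ x, (inner ℝ (grad s x) (transverse f x) : ℝ) =
      ∑ i, (comp f i x * partialD i s x +
        ∑ j, coulombConv (partialD i (partialD j (comp f j))) x * partialD i s x) := by
    intro x
    rw [PiLp.inner_apply]
    refine Finset.sum_congr rfl fun i _ => ?_
    rw [transverse_apply, grad_apply, ← Finset.sum_mul, ← add_mul]
    rfl
  have h1 : ∀ i, Integrable (fun x => comp f i x * partialD i s x) volume := fun i =>
    integrable_mul_test (comp f i).continuous _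
  have h2 : ∀ i j, Integrable (fun x =>
      coulombConv (partialD i (partialD j (comp f j))) x * partialD i s x) volume := fun i j =>
    integrable_mul_test (continuous_coulombConv _) _
  have h3 : ∀ i j, Integrable (fun x =>
      coulombConv (partialD i (partialD i (partialD j (comp f j)))) x * s x) volume := fun i j =>
    integrable_mul_test (continuous_coulombConv _) _
  simp only [e]
  have h0 : ∀ i, ∫ x, (comp f i x * partialD i s x +
      ∑ j, coulombConv (partialD i (partialD j (comp f j))) x * partialD i s x) =
      (∫ x, comp f i x * partialD i s x) +
        ∑ j, ∫ x, coulombConv (partialD i (partialD j (comp f j))) x * partialD i s x := fun i => by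
    rw [integral_add (h1 i) (integrable_finsetSum _ fun j _ => h2 i j),
      integral_finsetSum _ fun j _ => h2 i j]
  rw [integral_finsetSum]
  swap
  · exact fun i _ => (h1 i).add (integrable_finsetSum _ fun j _ => h2 i j)
  simp only [h0]
  -- With the sum over j outermost, integration by parts leaves -∫ (∂ⱼfⱼ + σ⋆Δ∂ⱼfⱼ) s for each j,
  -- and Poisson's equation makes it vanish.
  rw [Finset.sum_add_distrib, Finset.sum_comm (f := fun i j => ∫ x, _ * _),
    ← Finset.sum_add_distrib]
  refine Finset.sum_eq_zero fun j _ => ?_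
  have h4 : ∀ i, ∫ x, coulombConv (partialD i (partialD j (comp f j))) x * partialD i s x =
      -∫ x, coulombConv (partialD i (partialD i (partialD j (comp f j)))) x * s x := fun i => by
    rw [integral_mul_partialD (contDiff_coulombConv _)]
    simp only [fderiv_coulombConv]
  have h5 : ∫ x, comp f j x * partialD j s x = -∫ x, partialD j (comp f j) x * s x := by
    rw [integral_mul_partialD ((comp f j).contDiff.of_le (by exact_mod_cast le_top))]
    simp only [partialD_apply]
  simp only [h4, h5]
  rw [Finset.sum_neg_distrib, ← integral_finsetSum _ fun i _ => h3 i j]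
  simp only [← Finset.sum_mul, ← coulombConv_sum]
  have h6 := coulombConv_lap (partialD j (comp f j))
  rw [lap] at h6
  simp only [h6, neg_mul, integral_neg]
  ring

end Transverse

/-! ### Strong continuity from a total set -/

section StrongContinuity

variable {X : Type*} [TopologicalSpace X] {E F : Type*} [SeminormedAddCommGroup E]
  [NormedSpace ℂ E] [NormedAddCommGroup F] [NormedSpace ℂ F]

/-- The vectors on which a family of operators is strongly continuous. -/
def strongContSubmodule (T : X → E →L[ℂ] F) : Submodule ℂ E where
  carrier := {v | Continuous fun x => T x v}
  zero_mem' := by simpa using continuous_const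
  add_mem' {v w} hv hw := by
    simp only [Set.mem_ofPred_eq, map_add] at *
    exact hv.add hw
  smul_mem' c v hv := by
    simp only [Set.mem_ofPred_eq, map_smul] at *
    exact hv.const_smul c

/-- The contraction bound is uniform in x, so approximating v gives a uniform limit of continuous
functions. -/
theorem isClosed_strongContSubmodule {T : X → E →L[ℂ] F} (h : ∀ x v, ‖T x v‖ ≤ ‖v‖) :
    IsClosed (strongContSubmodule T : Set E) := by
  refine isClosed_of_closure_subset fun v hv => ?_
  refine continuous_of_uniform_approx_of_continuous fun u hu => ?_
  obtain ⟨ε, hε, hu⟩ := Metric.mem_uniformity_dist.1 hu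
  obtain ⟨w, hw, hvw⟩ := Metric.mem_closure_iff.1 hv ε hε
  refine ⟨fun x => T x w, hw, fun x => hu ?_⟩
  rw [dist_eq_norm, ← map_sub]
  exact (h x _).trans_lt (by rwa [← dist_eq_norm])

theorem strongly_continuous_of_dense {T : X → E →L[ℂ] F} (h : ∀ x v, ‖T x v‖ ≤ ‖v‖) {s : Set E}
    (hs : Dense (Submodule.span ℂ s : Set E)) (hc : ∀ v ∈ s, Continuous fun x => T x v) (v : E) :
    Continuous fun x => T x v := by
  have h1 : Submodule.span ℂ s ≤ strongContSubmodule T := Submodule.span_le.2 hc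
  have h2 : closure (Submodule.span ℂ s : Set E) ⊆ strongContSubmodule T :=
    closure_minimal h1 (isClosed_strongContSubmodule h)
  exact h2 (hs v)

end StrongContinuity

/-! ### Weyl relations and the GNS representation -/

section WeylRelations

variable {S : Type} [AddCommGroup S] [Module ℝ S] {η : S → S → ℝ}

/-- Antisymmetric bilinear forms. -/
structure IsSymplectic (η : S → S → ℝ) : Prop where
  swap : ∀ s s', η s s' = -η s' s
  add_left : ∀ s₁ s₂ s', η (s₁ + s₂) s' = η s₁ s' + η s₂ s'
  smul_left : ∀ (t : ℝ) s s', η (t • s) s' = t * η s s'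

namespace IsSymplectic

theorem self (h : IsSymplectic η) (s : S) : η s s = 0 := by linarith [h.swap s s]

theorem add_right (h : IsSymplectic η) (s s₁ s₂ : S) : η s (s₁ + s₂) = η s s₁ + η s s₂ := by
  rw [h.swap, h.add_left, h.swap s s₁, h.swap s s₂]; ring

theorem smul_right (h : IsSymplectic η) (t : ℝ) (s s' : S) : η s (t • s') = t * η s s' := by
  rw [h.swap, h.smul_left, h.swap s s']; ring

theorem zero_left (h : IsSymplectic η) (s : S) : η 0 s = 0 := by
  simpa using h.smul_left 0 0 s

theorem neg_left (h : IsSymplectic η) (s s' : S) : η (-s) s' = -η s s' := by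
  simpa using h.smul_left (-1) s s'

theorem neg_right (h : IsSymplectic η) (s s' : S) : η s (-s') = -η s s' := by
  simpa using h.smul_right (-1) s s'

end IsSymplectic

/-- The phase `exp(i a / 2)`. -/
def weylPhase (a : ℝ) : ℂ := Complex.exp (((a / 2 : ℝ) : ℂ) * Complex.I)

theorem weylPhase_zero : weylPhase 0 = 1 := by simp [weylPhase]

theorem weylPhase_add (a b : ℝ) : weylPhase (a + b) = weylPhase a * weylPhase b := by
  rw [weylPhase, weylPhase, weylPhase, ← Complex.exp_add]
  congr 1
  push_cast
  ring

theorem continuous_weylPhase : Continuous weylPhase := by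
  unfold weylPhase
  fun_prop

theorem norm_weylOp (η : S → S → ℝ) (s : S) (ξ : Ell2 S) : ‖weylOp η s ξ‖ = ‖ξ‖ := by
  have h2 : 0 < (2 : ENNReal).toReal := by norm_num
  rw [lp.norm_eq_tsum_rpow h2, lp.norm_eq_tsum_rpow h2]
  congr 1
  refine Eq.trans ?_ ((Equiv.subRight s).tsum_eq fun x => ‖ξ x‖ ^ (2 : ENNReal).toReal)
  exact tsum_congr fun x => by
    change ‖weylFun η s ξ x‖ ^ _ = _
    rw [norm_weylFun]; rfl

theorem weylOp_mul (h : IsSymplectic η) (s s' : S) :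
    weylOp η s * weylOp η s' = weylPhase (η s s') • weylOp η (s + s') := by
  ext ξ x
  change weylPhase (η s (x - s)) * (weylPhase (η s' (x - s - s')) * ξ (x - s - s')) =
    weylPhase (η s s') * (weylPhase (η (s + s') (x - (s + s'))) * ξ (x - (s + s')))
  rw [← mul_assoc, ← mul_assoc, ← weylPhase_add, ← weylPhase_add, sub_sub]
  congr 2
  simp only [sub_eq_add_neg, h.add_right, h.add_left, h.neg_right, neg_add, h.self]
  rw [h.swap s' s]
  ring

theorem weylOp_zero (h : IsSymplectic η) : weylOp η 0 = 1 := by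
  ext ξ x
  change weylPhase (η 0 (x - 0)) * ξ (x - 0) = ξ x
  rw [h.zero_left, weylPhase_zero, one_mul, sub_zero]

theorem weylOp_mul_neg (h : IsSymplectic η) (s : S) : weylOp η s * weylOp η (-s) = 1 := by
  rw [weylOp_mul h, h.neg_right, h.self, neg_zero, weylPhase_zero, one_smul, add_neg_cancel,
    weylOp_zero h]

/-- W(s) is an isometry with right inverse W(-s); such an inverse must be the adjoint. -/
theorem star_weylOp (h : IsSymplectic η) (s : S) : star (weylOp η s) = weylOp η (-s) := by
  have h1 : star (weylOp η s) * weylOp η s = 1 :=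
    (ContinuousLinearMap.norm_map_iff_adjoint_comp_self _).1 (norm_weylOp η s)
  calc star (weylOp η s) = star (weylOp η s) * (weylOp η s * weylOp η (-s)) := by
        rw [weylOp_mul_neg h, mul_one]
    _ = weylOp η (-s) := by rw [← mul_assoc, h1, one_mul]

theorem weyl_mul (h : IsSymplectic η) (s s' : S) :
    weyl η s * weyl η s' = weylPhase (η s s') • weyl η (s + s') :=
  Subtype.ext (weylOp_mul h s s')

theorem weyl_zero (h : IsSymplectic η) : weyl η 0 = 1 := Subtype.ext (weylOp_zero h)

theorem star_weyl (h : IsSymplectic η) (s : S) : star (weyl η s) = weyl η (-s) :=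
  Subtype.ext (star_weylOp h s)

/-- By the Weyl relations the linear span of the unitaries is already closed under products and
adjoints. -/
theorem adjoin_weylOp_le_span (h : IsSymplectic η) {a : Ell2 S →L[ℂ] Ell2 S}
    (ha : a ∈ StarAlgebra.adjoin ℂ (Set.range (weylOp η))) :
    a ∈ Submodule.span ℂ (Set.range (weylOp η)) := by
  induction ha using StarAlgebra.adjoin_induction with
  | mem x hx => exact Submodule.subset_span hx
  | algebraMap r =>
    rw [Algebra.algebraMap_eq_smul_one, ← weylOp_zero h]
    exact Submodule.smul_mem _ _ (Submodule.subset_span ⟨0, rfl⟩)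
  | add x y _ _ hx hy => exact add_mem hx hy
  | mul x y _ _ hx hy =>
    have := Submodule.mul_mem_mul hx hy
    rw [Submodule.span_mul_span] at this
    refine Submodule.span_le.2 ?_ this
    rintro _ ⟨_, ⟨s, rfl⟩, _, ⟨s', rfl⟩, rfl⟩
    simp only [weylOp_mul h]
    exact Submodule.smul_mem _ _ (Submodule.subset_span ⟨_, rfl⟩)
  | star x hxa hx =>
    clear hxa
    induction hx using Submodule.span_induction with
    | mem x hx =>
      obtain ⟨s, rfl⟩ := hx
      rw [star_weylOp h]
      exact Submodule.subset_span ⟨_, rfl⟩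
    | zero => rw [star_zero]; exact zero_mem _
    | add x y _ _ hx hy => rw [star_add]; exact add_mem hx hy
    | smul c x _ hx => rw [star_smul]; exact Submodule.smul_mem _ _ hx

/-- The linear span of the Weyl unitaries is dense in the Weyl algebra. -/
theorem dense_span_weyl (h : IsSymplectic η) :
    Dense (Submodule.span ℂ (Set.range (weyl η)) : Set (WeylAlgebra η)) := by
  let val : WeylAlgebra η →ₗ[ℂ] (Ell2 S →L[ℂ] Ell2 S) := (weylSubalgebra η).subtype.toLinearMap
  have himg : (val '' (Submodule.span ℂ (Set.range (weyl η)))) =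
      (Submodule.span ℂ (Set.range (weylOp η)) : Set (Ell2 S →L[ℂ] Ell2 S)) := by
    rw [← Submodule.map_coe, Submodule.map_span, ← Set.range_comp]
    rfl
  intro a
  refine (closure_subtype (X := Ell2 S →L[ℂ] Ell2 S) (p := (· ∈ weylSubalgebra η)) (x := a)
    (s := (Submodule.span ℂ (Set.range (weyl η)) : Set (WeylAlgebra η)))).2 ?_
  change val a ∈ closure (val '' _)
  rw [himg]
  exact closure_mono (fun x hx => adjoin_weylOp_le_span h hx) a.2

variable (ω : WeylFunctional η)

/-- The vector `π(W(s)) Ω` of the GNS space. -/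
def weylVec (s : S) : ω.GNS := ((ω.toPreGNS (weyl η s) : ω.PreGNS) : ω.GNS)

theorem gns_coe (a b : WeylAlgebra η) :
    ω.gnsStarAlgHom a ((ω.toPreGNS b : ω.PreGNS) : ω.GNS) = (ω.toPreGNS (a * b) : ω.PreGNS) :=
  ω.gnsNonUnitalStarAlgHom_apply_coe

theorem gns_weylVec (h : IsSymplectic η) (s s' : S) :
    ω.gnsStarAlgHom (weyl η s) (weylVec ω s') = weylPhase (η s s') • weylVec ω (s + s') := by
  rw [weylVec, gns_coe, weyl_mul h, map_smul, UniformSpace.Completion.coe_smul]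
  rfl

theorem gns_weyl_mul (h : IsSymplectic η) (s s' : S) :
    ω.gnsStarAlgHom (weyl η s) * ω.gnsStarAlgHom (weyl η s') =
      weylPhase (η s s') • ω.gnsStarAlgHom (weyl η (s + s')) := by
  rw [← map_mul, weyl_mul h, map_smul]

theorem gns_weyl_zero (h : IsSymplectic η) : ω.gnsStarAlgHom (weyl η 0) = 1 := by
  rw [weyl_zero h, map_one]

theorem norm_gns_weyl (h : IsSymplectic η) (s : S) (v : ω.GNS) :
    ‖ω.gnsStarAlgHom (weyl η s) v‖ = ‖v‖ := by
  refine (ContinuousLinearMap.norm_map_iff_adjoint_comp_self _).2 ?_ v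
  change star (ω.gnsStarAlgHom (weyl η s)) * ω.gnsStarAlgHom (weyl η s) = 1
  rw [← map_star, star_weyl h, gns_weyl_mul ω h, h.neg_left, h.self, neg_zero, weylPhase_zero,
    one_smul, neg_add_cancel, gns_weyl_zero ω h]

theorem gns_weyl_smul_add (h : IsSymplectic η) (s : S) (t r : ℝ) :
    ω.gnsStarAlgHom (weyl η ((t + r) • s)) =
      ω.gnsStarAlgHom (weyl η (t • s)) * ω.gnsStarAlgHom (weyl η (r • s)) := by
  rw [gns_weyl_mul ω h, h.smul_left, h.smul_right, h.self, mul_zero, mul_zero, weylPhase_zero,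
    one_smul, add_smul]

/-- The map a ↦ π(a)Ω is continuous with dense range, so it carries the dense span of the Weyl
unitaries to a dense subspace. -/
theorem dense_span_weylVec (h : IsSymplectic η) :
    Dense (Submodule.span ℂ (Set.range (weylVec ω)) : Set ω.GNS) := by
  let L : WeylAlgebra η →ₗ[ℂ] ω.GNS :=
    { toFun := fun a => ω.gnsStarAlgHom a ((ω.toPreGNS 1 : ω.PreGNS) : ω.GNS)
      map_add' := fun a b => by rw [map_add]; rfl
      map_smul' := fun c a => by rw [map_smul]; rfl }
  have hL : Continuous L := by
    have h1 : Continuous ω.gnsStarAlgHom := map_continuous _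
    exact h1.clm_apply continuous_const
  have hLe : ∀ a, L a = ((ω.toPreGNS a : ω.PreGNS) : ω.GNS) := fun a => by
    change ω.gnsStarAlgHom a _ = _
    rw [gns_coe, mul_one]
  have hr : DenseRange L := by
    have : (L : WeylAlgebra η → ω.GNS) = (fun x : ω.PreGNS => (x : ω.GNS)) ∘ ω.toPreGNS :=
      funext hLe
    rw [DenseRange, this, Set.range_comp, ω.toPreGNS.surjective.range_eq, Set.image_univ]
    exact UniformSpace.Completion.denseRange_coe
  have hd := hr.dense_image hL (dense_span_weyl h)
  rw [← Submodule.map_coe, Submodule.map_span, ← Set.range_comp] at hd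
  rwa [show (L ∘ weyl η) = weylVec ω from funext fun s => hLe _] at hd

theorem inner_weylVec (h : IsSymplectic η) (s s' : S) :
    (inner ℂ (weylVec ω s) (weylVec ω s') : ℂ) = weylPhase (-η s s') * ω (weyl η (s' - s)) := by
  rw [weylVec, weylVec, UniformSpace.Completion.inner_coe]
  change ω (star (weyl η s) * weyl η s') = _
  rw [star_weyl h, weyl_mul h, h.neg_left, map_smul, smul_eq_mul, neg_add_eq_sub]

/-- Distances between the total vectors are determined by the state and η; regularity and triviality
of GNS unitaries are both read off from this. -/
theorem norm_sub_weylVec (h : IsSymplectic η) (hω : IsState ω) (s s' : S) :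
    ‖weylVec ω s - weylVec ω s'‖ ^ 2 = 2 - 2 * (weylPhase (-η s s') * ω (weyl η (s' - s))).re := by
  have h1 : ∀ s, ‖weylVec ω s‖ ^ 2 = 1 := fun s => by
    have := inner_self_eq_norm_sq_to_K (𝕜 := ℂ) (weylVec ω s)
    rw [inner_weylVec ω h, h.self, neg_zero, weylPhase_zero, sub_self, weyl_zero h, hω] at this
    norm_num at this
    exact_mod_cast this.symm
  rw [norm_sub_sq (𝕜 := ℂ), h1, h1, inner_weylVec ω h]
  simp only [RCLike.re_to_complex]
  ring

/-- For s in the radical, W(s) moves W(g)Ω to W(s + g)Ω without a phase, and the squared distance of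
the two is 2 - 2 Re ω(W(-s)) = 0. These vectors are total. -/
theorem gns_weyl_eq_one (h : IsSymplectic η) (hω : IsState ω) {s : S} (hs : ∀ g, η s g = 0)
    (h1 : ω (weyl η s) = 1) : ω.gnsStarAlgHom (weyl η s) = 1 := by
  refine ContinuousLinearMap.ext_on (dense_span_weylVec ω h) ?_
  rintro _ ⟨g, rfl⟩
  rw [gns_weylVec ω h, hs, weylPhase_zero, one_smul, one_apply_eq_self, ← sub_eq_zero,
    ← norm_eq_zero, ← sq_eq_zero_iff, norm_sub_weylVec ω h hω, h.swap, h.add_right, h.swap g s, hs,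
    h.self, sub_add_cancel_right]
  have h2 : ω (weyl η (-s)) = 1 := by
    rw [← star_weyl h, map_star, h1, star_one]
  rw [h2]
  simp [weylPhase_zero]

end WeylRelations

/-! ### The two symplectic forms and the transverse Fock state -/

section Forms

theorem isSymplectic_scalarForm : IsSymplectic scalarForm where
  swap s s' := by
    rw [scalarForm, scalarForm, ← integral_neg]
    exact integral_congr_ae (Eventually.of_forall fun x => by ring)
  add_left s₁ s₂ s' := by
    have hi : ∀ s s' : ScalarTest × ScalarTest,
        Integrable (fun x => s.2 x * s'.1 x - s.1 x * s'.2 x) volume := fun s s' =>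
      (integrable_mul_test s.2.continuous _).sub (integrable_mul_test s.1.continuous _)
    rw [scalarForm, scalarForm, scalarForm, ← integral_add (hi _ _) (hi _ _)]
    refine integral_congr_ae (Eventually.of_forall fun x => ?_)
    change (s₁.2 x + s₂.2 x) * s'.1 x - (s₁.1 x + s₂.1 x) * s'.2 x = _
    simp only
    ring
  smul_left t s s' := by
    rw [scalarForm, scalarForm, ← integral_const_mul]
    refine integral_congr_ae (Eventually.of_forall fun x => ?_)
    change (t * s.2 x) * s'.1 x - (t * s.1 x) * s'.2 x = _
    ring

theorem isSymplectic_transverseForm : IsSymplectic transverseForm where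
  swap s s' := by
    rw [transverseForm, transverseForm, ← integral_neg]
    exact integral_congr_ae (Eventually.of_forall fun x => by ring)
  add_left s₁ s₂ s' := by
    have hi : ∀ s s' : VectorTest × VectorTest, Integrable (fun x =>
        (inner ℝ (s.2 x) (transverse s'.1 x) - inner ℝ (s'.2 x) (transverse s.1 x) : ℝ)) volume :=
      fun s s' => (integrable_inner_transverse _ _).sub (integrable_inner_transverse _ _)
    rw [transverseForm, transverseForm, transverseForm, ← integral_add (hi _ _) (hi _ _)]
    refine integral_congr_ae (Eventually.of_forall fun x => ?_)
    change inner ℝ (s₁.2 x + s₂.2 x) (transverse s'.1 x) -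
      inner ℝ (s'.2 x) (transverse (s₁.1 + s₂.1) x) = (_ : ℝ)
    rw [transverse_add, inner_add_left, inner_add_right]
    ring
  smul_left t s s' := by
    rw [transverseForm, transverseForm, ← integral_const_mul]
    refine integral_congr_ae (Eventually.of_forall fun x => ?_)
    change inner ℝ (t • s.2 x) (transverse s'.1 x) -
      inner ℝ (s'.2 x) (transverse (t • s.1) x) = (_ : ℝ)
    rw [transverse_smul, real_inner_smul_left, real_inner_smul_right]
    ring

theorem transverseForm_grad_left (s : ScalarTest) (g : VectorTest × VectorTest) :
    transverseForm (grad s, 0) g = 0 := by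
  rw [transverseForm]
  refine (integral_congr_ae (Eventually.of_forall fun x => ?_)).trans (integral_zero Space ℝ)
  change inner ℝ (0 : Space) (transverse g.1 x) - inner ℝ (g.2 x) (transverse (grad s) x) = (0 : ℝ)
  rw [transverse_grad]; simp

/-- Here ∇s is not projected, so the orthogonality of gradients to P_tr g₀ is needed; in the other
slot P_tr∇s = 0 is enough. -/
theorem transverseForm_grad_right (s : ScalarTest) (g : VectorTest × VectorTest) :
    transverseForm (0, grad s) g = 0 := by
  rw [transverseForm, ← integral_grad_transverse s g.1]
  refine integral_congr_ae (Eventually.of_forall fun x => ?_)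
  change _ - inner ℝ (g.2 x) (transverse 0 x) = (_ : ℝ)
  rw [transverse_zero]; simp

theorem transverseNormSq_smul (t : ℝ) (f : VectorTest × VectorTest) :
    transverseNormSq (t • f) = t ^ 2 * transverseNormSq f := by
  rw [transverseNormSq, transverseNormSq, ← integral_const_mul]
  refine integral_congr_ae (Eventually.of_forall fun x => ?_)
  change ‖transverse (t • f.1) x‖ ^ 2 + ‖transverse (t • f.2) x‖ ^ 2 = _
  rw [transverse_smul, transverse_smul, norm_smul, norm_smul, mul_pow, mul_pow, Real.norm_eq_abs,
    sq_abs]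
  ring

theorem transverseNormSq_eq_zero {f : VectorTest × VectorTest} (h1 : ∀ x, transverse f.1 x = 0)
    (h2 : ∀ x, transverse f.2 x = 0) : transverseNormSq f = 0 := by
  simp [transverseNormSq, h1, h2]

variable {ωtr : WeylFunctional transverseForm}

/-- On the total vectors W(g)Ω the group acts by a continuous phase and a shift of the label, and
the Gaussian expectation makes the distance between shifted vectors an explicit continuous function
of t. -/
theorem IsTransverseFock.isRegular (hF : IsTransverseFock ωtr) (hω : IsState ωtr) :
    IsRegular ωtr := by
  have hη := isSymplectic_transverseForm
  intro s
  refine strongly_continuous_of_dense (fun t v => (norm_gns_weyl ωtr hη _ v).le)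
    (dense_span_weylVec ωtr hη) ?_
  rintro _ ⟨g, rfl⟩
  simp only [gns_weylVec ωtr hη, hη.smul_left]
  refine (continuous_weylPhase.comp (continuous_mul_const _)).smul ?_
  refine continuous_iff_continuousAt.2 fun t₀ => ?_
  rw [ContinuousAt, tendsto_iff_norm_sub_tendsto_zero]
  have hsq : ∀ t : ℝ, ‖weylVec ωtr (t • s + g) - weylVec ωtr (t₀ • s + g)‖ ^ 2 =
      2 - 2 * (weylPhase (-((t - t₀) * transverseForm s g)) *
        ((Real.exp (-(1 / 4) * ((t₀ - t) ^ 2 * transverseNormSq s)) : ℝ) : ℂ)).re := by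
    intro t
    rw [norm_sub_weylVec ωtr hη hω, add_sub_add_right_eq_sub, ← sub_smul, hF,
      transverseNormSq_smul]
    congr 5
    rw [hη.add_left, hη.add_right, hη.add_right, hη.smul_left, hη.smul_left, hη.smul_right,
      hη.smul_right, hη.self, hη.self, hη.swap g s]
    ring
  have hlim : Tendsto (fun t : ℝ => ‖weylVec ωtr (t • s + g) - weylVec ωtr (t₀ • s + g)‖ ^ 2)
      (𝓝 t₀) (𝓝 0) := by
    simp only [hsq]
    have hc : Continuous fun t : ℝ => 2 - 2 * (weylPhase (-((t - t₀) * transverseForm s g)) *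
        ((Real.exp (-(1 / 4) * ((t₀ - t) ^ 2 * transverseNormSq s)) : ℝ) : ℂ)).re := by
      have h1 : Continuous fun t : ℝ => weylPhase (-((t - t₀) * transverseForm s g)) :=
        continuous_weylPhase.comp (by fun_prop)
      fun_prop
    have := hc.tendsto t₀
    simpa [weylPhase_zero] using this
  have := hlim.sqrt
  simpa [Real.sqrt_sq (norm_nonneg _)] using this

theorem IsTransverseFock.gns_eq_one (hF : IsTransverseFock ωtr) (hω : IsState ωtr)
    {f : VectorTest × VectorTest} (h1 : ∀ x, transverse f.1 x = 0) (h2 : ∀ x, transverse f.2 x = 0)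
    (h : ∀ g, transverseForm f g = 0) : ωtr.gnsStarAlgHom (weyl transverseForm f) = 1 := by
  refine gns_weyl_eq_one ωtr isSymplectic_transverseForm hω h ?_
  rw [hF, transverseNormSq_eq_zero h1 h2]
  simp

end Forms

/-! ### Creation, annihilation and second quantization on the completed Fock space -/

section FockOperators

variable {H : Type} [NormedAddCommGroup H] [InnerProductSpace ℂ H]

theorem fock_ext {F : Type*} [TopologicalSpace F] [T2Space F] {f g : Fock H → F}
    (hf : Continuous f) (hg : Continuous g) (h : ∀ x : PreFock H, f x = g x) (v : Fock H) :
    f v = g v := by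
  induction v using UniformSpace.Completion.induction_on with
  | hp => exact isClosed_eq hf hg
  | ih x => exact h x

theorem creation_coe (f : H) (x : PreFock H) :
    creation f (x : Fock H) = ((wι f * x : PreFock H) : Fock H) :=
  ContinuousLinearMap.completion_apply_coe _ _

theorem secondQuant_coe (u : H →ₗᵢ[ℂ] H) (x : PreFock H) :
    secondQuant u (x : Fock H) = ((preSecondQuant u x : PreFock H) : Fock H) :=
  ContinuousLinearMap.completion_apply_coe _ _

/-- On finite-particle vectors the Hilbert space adjoint of creation is the algebraic contraction,
so the exterior algebra identities carry over. -/
theorem annihilation_coe (f : H) (x : PreFock H) :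
    annihilation f (x : Fock H) = ((ann f x : PreFock H) : Fock H) := by
  refine ext_inner_left ℂ fun v => ?_
  refine fock_ext (f := fun v => (inner ℂ v (annihilation f (x : Fock H)) : ℂ))
    (g := fun v => (inner ℂ v ((ann f x : PreFock H) : Fock H) : ℂ)) (by fun_prop) (by fun_prop)
    (fun y => ?_) v
  change (inner ℂ (y : Fock H) (annihilation f (x : Fock H)) : ℂ) = _
  rw [annihilation, ContinuousLinearMap.adjoint_inner_right, creation_coe,
    UniformSpace.Completion.inner_coe, UniformSpace.Completion.inner_coe, inner_wι_mul_left]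

theorem norm_preSecondQuant (u : H →ₗᵢ[ℂ] H) (x : PreFock H) : ‖preSecondQuant u x‖ = ‖x‖ := by
  rw [← sq_eq_sq₀ (norm_nonneg _) (norm_nonneg _), norm_sq_eq_re_inner (𝕜 := ℂ),
    norm_sq_eq_re_inner (𝕜 := ℂ)]
  exact congrArg Complex.re (inner_preSecondQuant u x x)

theorem norm_secondQuant (u : H →ₗᵢ[ℂ] H) (v : Fock H) : ‖secondQuant u v‖ = ‖v‖ := by
  refine fock_ext (f := fun v => ‖secondQuant u v‖) (g := fun v => ‖v‖) (by fun_prop)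
    (by fun_prop) (fun x => ?_) v
  change ‖secondQuant u (x : Fock H)‖ = ‖(x : Fock H)‖
  rw [secondQuant_coe, UniformSpace.Completion.norm_coe, UniformSpace.Completion.norm_coe,
    norm_preSecondQuant]

theorem secondQuant_id : secondQuant (LinearIsometry.id : H →ₗᵢ[ℂ] H) = 1 := by
  ext v
  refine fock_ext (by fun_prop) (by fun_prop) (fun x => ?_) v
  rw [secondQuant_coe, one_apply_eq_self]
  congr 1
  induction x using PreFock.induction with
  | h0 r => simp
  | h1 x y hx hy => simp [hx, hy]
  | h2 f x hx => simp [preSecondQuant_wι, hx]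

theorem secondQuant_comp (u v : H →ₗᵢ[ℂ] H) :
    secondQuant (u.comp v) = secondQuant u * secondQuant v := by
  ext w
  refine fock_ext (by fun_prop) (by fun_prop) (fun x => ?_) w
  change _ = secondQuant u (secondQuant v (x : Fock H))
  rw [secondQuant_coe, secondQuant_coe, secondQuant_coe]
  congr 1
  induction x using PreFock.induction with
  | h0 r => simp
  | h1 x y hx hy => simp [hx, hy]
  | h2 f x hx => simp [preSecondQuant_wι, hx]

theorem secondQuant_creation (u : H →ₗᵢ[ℂ] H) (f : H) :
    secondQuant u * creation f = creation (u f) * secondQuant u := by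
  ext w
  refine fock_ext (by fun_prop) (by fun_prop) (fun x => ?_) w
  change secondQuant u (creation f (x : Fock H)) = creation (u f) (secondQuant u (x : Fock H))
  rw [creation_coe, secondQuant_coe, secondQuant_coe, creation_coe, map_mul, preSecondQuant_wι]

theorem secondQuant_annihilation (u : H →ₗᵢ[ℂ] H) (f : H) :
    secondQuant u * annihilation f = annihilation (u f) * secondQuant u := by
  ext w
  refine fock_ext (by fun_prop) (by fun_prop) (fun x => ?_) w
  change secondQuant u (annihilation f (x : Fock H)) =
    annihilation (u f) (secondQuant u (x : Fock H))
  rw [annihilation_coe, secondQuant_coe, secondQuant_coe, annihilation_coe, ann_preSecondQuant]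

theorem creation_add (f g : H) : creation (f + g) = creation f + creation g := by
  ext w
  refine fock_ext (by fun_prop) (by fun_prop) (fun x => ?_) w
  change _ = creation f (x : Fock H) + creation g (x : Fock H)
  rw [creation_coe, creation_coe, creation_coe, ← UniformSpace.Completion.coe_add, map_add, add_mul]

theorem creation_smul (c : ℂ) (f : H) : creation (c • f) = c • creation f := by
  refine ContinuousLinearMap.ext fun w => ?_
  refine fock_ext (creation (c • f)).continuous (g := fun v => c • creation f v)
    ((creation f).continuous.const_smul c) (fun x => ?_) w
  rw [creation_coe, creation_coe, ← UniformSpace.Completion.coe_smul, map_smul, smul_mul_assoc]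

theorem annihilation_add (f g : H) : annihilation (f + g) = annihilation f + annihilation g := by
  rw [annihilation, creation_add, map_add]; rfl

theorem annihilation_smul (c : ℂ) (f : H) :
    annihilation (c • f) = (starRingEnd ℂ c) • annihilation f := by
  rw [annihilation, creation_smul, map_smulₛₗ]; rfl

theorem norm_creation_le (f : H) : ‖creation f‖ ≤ ‖f‖ := by
  refine ContinuousLinearMap.opNorm_le_bound _ (norm_nonneg _) fun v => ?_
  induction v using UniformSpace.Completion.induction_on with
  | hp => exact isClosed_le (by fun_prop) (by fun_prop)
  | ih x =>
    rw [creation_coe, UniformSpace.Completion.norm_coe, UniformSpace.Completion.norm_coe]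
    exact norm_wι_mul_le f x

theorem norm_annihilation_le (f : H) : ‖annihilation f‖ ≤ ‖f‖ := by
  rw [annihilation, LinearIsometryEquiv.norm_map]
  exact norm_creation_le f

/-- Second quantization preserves strong continuity. -/
theorem continuous_secondQuant {u : ℝ → H →ₗᵢ[ℂ] H} (hu : ∀ f, Continuous fun t => u t f)
    (v : Fock H) : Continuous fun t => secondQuant (u t) v := by
  -- Wedging as a bounded bilinear map: the induction on particle number needs continuity of f ∧ x
  -- when both f and x vary with t.
  let B : H →L[ℂ] PreFock H →L[ℂ] PreFock H :=
    ((LinearMap.mul ℂ (PreFock H)).comp wι).mkContinuous₂ 1 fun f x => by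
      rw [one_mul]; exact norm_wι_mul_le f x
  have hpre : ∀ x : PreFock H, Continuous fun t => preSecondQuant (u t) x := by
    intro x
    induction x using PreFock.induction with
    | h0 r => simpa using continuous_const
    | h1 x y hx hy =>
      simp only [map_add]
      exact hx.add hy
    | h2 f x hx =>
      simp only [map_mul, preSecondQuant_wι]
      exact (B.continuous.comp (hu f)).clm_apply hx
  have hd : Dense (Submodule.span ℂ (Set.range fun x : PreFock H => (x : Fock H)) : Set (Fock H)) :=
    UniformSpace.Completion.denseRange_coe.mono Submodule.subset_span
  refine strongly_continuous_of_dense (fun t v => (norm_secondQuant (u t) v).le) hd ?_ v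
  rintro _ ⟨x, rfl⟩
  simp only [secondQuant_coe]
  exact (UniformSpace.Completion.continuous_coe _).comp (hpre x)

end FockOperators

/-! ### Multiplication by phases on L² -/

section Phases

theorem coeFn_phaseMul (θ : Space → ℝ) (hθ : AEStronglyMeasurable θ volume) (w : Spinor) :
    phaseMul θ hθ w =ᵐ[volume] fun x => Complex.exp ((θ x : ℂ) * Complex.I) • w x :=
  (memLp_phase θ hθ w).coeFn_toLp

theorem phaseMul_congr {θ θ' : Space → ℝ} (h : θ = θ') (hθ : AEStronglyMeasurable θ volume)
    (hθ' : AEStronglyMeasurable θ' volume) : phaseMul θ hθ = phaseMul θ' hθ' := by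
  subst h; rfl

theorem phaseMul_zero (h : AEStronglyMeasurable (fun _ : Space => (0 : ℝ)) volume) :
    phaseMul (fun _ => 0) h = LinearIsometry.id := by
  ext1 w
  refine Lp.ext ?_
  filter_upwards [coeFn_phaseMul _ h w] with x hx
  rw [hx]; simp

theorem phaseMul_add {θ θ' : Space → ℝ} (hθ : AEStronglyMeasurable θ volume)
    (hθ' : AEStronglyMeasurable θ' volume)
    (h : AEStronglyMeasurable (fun x => θ x + θ' x) volume) :
    phaseMul (fun x => θ x + θ' x) h = (phaseMul θ hθ).comp (phaseMul θ' hθ') := by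
  ext1 w
  refine Lp.ext ?_
  change _ =ᵐ[volume] phaseMul θ hθ (phaseMul θ' hθ' w)
  filter_upwards [coeFn_phaseMul _ h w, coeFn_phaseMul _ hθ (phaseMul θ' hθ' w),
    coeFn_phaseMul _ hθ' w] with x h1 h2 h3
  rw [h1, h2, h3, smul_smul, ← Complex.exp_add]
  congr 2
  push_cast
  ring

theorem norm_exp_sub_le (a b : ℝ) :
    ‖Complex.exp ((a : ℂ) * Complex.I) - Complex.exp ((b : ℂ) * Complex.I)‖ ≤ |a - b| := by
  have e : Complex.exp ((a : ℂ) * Complex.I) - Complex.exp ((b : ℂ) * Complex.I) =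
      Complex.exp ((b : ℂ) * Complex.I) * (Complex.exp (Complex.I * ((a - b : ℝ) : ℂ)) - 1) := by
    rw [mul_sub, mul_one, ← Complex.exp_add]
    congr 2
    push_cast
    ring
  rw [e, norm_mul, Complex.norm_exp_ofReal_mul_I, one_mul]
  exact Real.norm_exp_I_mul_ofReal_sub_one_le

theorem memLp_bounded_mul {θ : Space → ℝ} {C : ℝ} (hθ : AEStronglyMeasurable θ volume)
    (hC : ∀ x, |θ x| ≤ C) (w : Spinor) : MemLp (fun x => (θ x : ℂ) • w x) 2 volume := by
  have hm : AEStronglyMeasurable (fun x => (θ x : ℂ)) volume :=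
    Complex.continuous_ofReal.comp_aestronglyMeasurable hθ
  refine ((Lp.memLp w).const_smul (C : ℂ)).of_le (hm.smul (Lp.aestronglyMeasurable w))
    (Eventually.of_forall fun x => ?_)
  have hC0 : 0 ≤ C := (abs_nonneg _).trans (hC x)
  rw [norm_smul, Pi.smul_apply, norm_smul, Complex.norm_real, Complex.norm_real,
    Real.norm_eq_abs, Real.norm_of_nonneg hC0]
  gcongr
  exact hC x

/-- The bound |e^{ia} - e^{ib}| ≤ |a - b| makes the family Lipschitz in t with constant C‖w‖. -/
theorem continuous_phaseMul {θ : Space → ℝ} {C : ℝ} (hC : ∀ x, |θ x| ≤ C)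
    (h : ∀ t : ℝ, AEStronglyMeasurable (fun x => t * θ x) volume) (w : Spinor) :
    Continuous fun t : ℝ => phaseMul (fun x => t * θ x) (h t) w := by
  have hC0 : 0 ≤ C := (abs_nonneg _).trans (hC 0)
  refine (LipschitzWith.of_dist_le_mul (K := (C * ‖w‖).toNNReal) fun t r => ?_).continuous
  rw [dist_eq_norm, Real.coe_toNNReal _ (by positivity), Real.dist_eq]
  have : C * ‖w‖ * |t - r| = (|t - r| * C) * ‖w‖ := by ring
  rw [this]
  refine Lp.norm_le_mul_norm_of_ae_le_mul ?_
  filter_upwards [Lp.coeFn_sub (phaseMul _ (h t) w) (phaseMul _ (h r) w),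
    coeFn_phaseMul _ (h t) w, coeFn_phaseMul _ (h r) w] with x h1 h2 h3
  rw [h1, Pi.sub_apply, h2, h3, ← sub_smul, norm_smul]
  gcongr
  refine (norm_exp_sub_le _ _).trans ?_
  rw [← sub_mul, abs_mul]
  gcongr
  exact hC x

/-- The pointwise Taylor remainder of e^{itθ} is at most (tC)², uniformly in x, so the L² remainder
is O(t²) for every w and no domain restriction appears. -/
theorem hasDerivAt_phaseMul {θ : Space → ℝ} {C : ℝ} (hC : ∀ x, |θ x| ≤ C)
    (h : ∀ t : ℝ, AEStronglyMeasurable (fun x => t * θ x) volume) (w : Spinor)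
    (hw : MemLp (fun x => (θ x : ℂ) • w x) 2 volume) :
    HasDerivAt (fun t : ℝ => phaseMul (fun x => t * θ x) (h t) w) (Complex.I • hw.toLp) 0 := by
  have hC0 : 0 ≤ C := (abs_nonneg _).trans (hC 0)
  have hz : phaseMul (fun x => 0 * θ x) (h 0) w = w := by
    rw [phaseMul_congr (θ' := fun _ => 0) (by ext; simp) _ aestronglyMeasurable_const,
      phaseMul_zero]
    rfl
  rw [hasDerivAt_iff_isLittleO_nhds_zero]
  refine Asymptotics.IsBigO.trans_isLittleO (g := fun t : ℝ => t ^ 2) ?_ ?_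
  · refine Asymptotics.IsBigO.of_bound (C ^ 2 * ‖w‖) ?_
    -- The quadratic bound on the exponential remainder is used for exponents of modulus at most 1.
    have hsmall : ∀ᶠ t : ℝ in 𝓝 0, |t| * C ≤ 1 := by
      have hc : Continuous fun t : ℝ => |t| * C := by fun_prop
      have := hc.tendsto 0
      simp only [abs_zero, zero_mul] at this
      exact (this.eventually_lt_const one_pos).mono fun t ht => ht.le
    filter_upwards [hsmall] with t ht
    simp only [zero_add]
    rw [hz, Real.norm_of_nonneg (sq_nonneg t)]
    have : C ^ 2 * ‖w‖ * t ^ 2 = (|t| * C) ^ 2 * ‖w‖ := by rw [mul_pow, sq_abs]; ring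
    rw [this]
    refine Lp.norm_le_mul_norm_of_ae_le_mul ?_
    filter_upwards [Lp.coeFn_sub (phaseMul _ (h t) w - w) (t • Complex.I • hw.toLp),
      Lp.coeFn_sub (phaseMul _ (h t) w) w, coeFn_phaseMul _ (h t) w,
      Lp.coeFn_smul t (Complex.I • hw.toLp), Lp.coeFn_smul Complex.I hw.toLp, hw.coeFn_toLp]
      with x h1 h2 h3 h4 h5 h6
    rw [h1, Pi.sub_apply, h2, Pi.sub_apply, h3, h4, Pi.smul_apply, h5, Pi.smul_apply, h6]
    have hb : ‖((t * θ x : ℝ) : ℂ) * Complex.I‖ ≤ |t| * C := by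
      rw [norm_mul, Complex.norm_I, mul_one, Complex.norm_real, Real.norm_eq_abs, abs_mul]
      gcongr
      exact hC x
    have e : Complex.exp (((t * θ x : ℝ) : ℂ) * Complex.I) • w x - w x -
        t • Complex.I • (θ x : ℂ) • w x = (Complex.exp (((t * θ x : ℝ) : ℂ) * Complex.I) - 1 -
          ((t * θ x : ℝ) : ℂ) * Complex.I) • w x := by
      rw [sub_smul, sub_smul, one_smul, smul_smul, ← Complex.coe_smul, smul_smul]
      congr 2
      push_cast
      ring
    rw [e, norm_smul]
    gcongr
    refine (Complex.norm_exp_sub_one_sub_id_le (hb.trans ht)).trans ?_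
    gcongr
  · simpa using Asymptotics.isLittleO_pow_id (𝕜 := ℝ) (n := 2) one_lt_two

end Phases

/-! ### Covariance, linearity and boundedness of the Dirac field -/

section TwistedDirac

theorem toLp_prod_ext {v w : DiracSpace} (h1 : v.fst = w.fst) (h2 : v.snd = w.snd) : v = w := by
  apply WithLp.ofLp_injective
  exact Prod.ext h1 h2

theorem twist_zero : twist 0 = LinearIsometry.id := by
  have h : ∀ x, coulombConv (0 : ScalarTest × ScalarTest).1 x = 0 := coulombConv_zero
  ext1 w
  refine toLp_prod_ext ?_ ?_
  · change phaseMul _ _ w.fst = w.fst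
    rw [phaseMul_congr (θ' := fun _ => 0) (by ext x; rw [h]; simp) _ aestronglyMeasurable_const,
      phaseMul_zero]
    rfl
  · change phaseMul _ _ w.snd = w.snd
    rw [phaseMul_congr (θ' := fun _ => 0) (by ext x; rw [h]) _ aestronglyMeasurable_const,
      phaseMul_zero]
    rfl

theorem twist_add (s s' : ScalarTest × ScalarTest) : twist (s + s') = (twist s).comp (twist s') := by
  have h : ∀ x, coulombConv (s + s').1 x = coulombConv s.1 x + coulombConv s'.1 x :=
    coulombConv_add _ _
  have hm := aestronglyMeasurable_coulombConv
  ext1 w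
  refine toLp_prod_ext ?_ ?_
  · change phaseMul _ _ w.fst = phaseMul _ _ (phaseMul _ _ w.fst)
    rw [phaseMul_congr (θ' := fun x => -coulombConv s.1 x + -coulombConv s'.1 x)
      (by ext x; rw [h]; ring) _ ((hm _).neg.add (hm _).neg),
      phaseMul_add (θ := fun x => -coulombConv s.1 x) (θ' := fun x => -coulombConv s'.1 x)
        (hm _).neg (hm _).neg]
    rfl
  · change phaseMul _ _ w.snd = phaseMul _ _ (phaseMul _ _ w.snd)
    rw [phaseMul_congr (θ' := fun x => coulombConv s.1 x + coulombConv s'.1 x)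
      (by ext x; rw [h]) _ ((hm _).add (hm _)),
      phaseMul_add (hm _) (hm _)]
    rfl

theorem continuous_twist (s : ScalarTest × ScalarTest) (w : DiracSpace) :
    Continuous fun t : ℝ => twist (t • s) w := by
  obtain ⟨C, hC⟩ := exists_bound_coulombConv s.1
  have hm := aestronglyMeasurable_coulombConv s.1
  have h : ∀ (t : ℝ) x, coulombConv (t • s).1 x = t * coulombConv s.1 x := fun t =>
    coulombConv_smul t _
  have h1 := continuous_phaseMul (θ := fun x => -coulombConv s.1 x) (C := C)
    (fun x => by rw [abs_neg]; exact hC x) (fun t => hm.neg.const_mul t) w.fst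
  have h2 := continuous_phaseMul (θ := fun x => coulombConv s.1 x) (C := C) hC
    (fun t => hm.const_mul t) w.snd
  refine ((WithLp.prod_continuous_toLp 2 Spinor Spinor).comp (h1.prodMk h2)).congr fun t => ?_
  refine toLp_prod_ext ?_ ?_
  · change phaseMul _ _ w.fst = phaseMul _ _ w.fst
    rw [phaseMul_congr (θ' := fun x => -coulombConv (t • s).1 x) (by ext x; rw [h]; ring)]
  · change phaseMul _ _ w.snd = phaseMul _ _ w.snd
    rw [phaseMul_congr (θ' := fun x => coulombConv (t • s).1 x) (by ext x; rw [h])]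

theorem conjSpin_apply (v : Spin) (i : Fin 4) : conjSpin v i = starRingEnd ℂ (v i) := rfl

theorem conjSpin_smul (c : ℂ) (v : Spin) : conjSpin (c • v) = (starRingEnd ℂ c) • conjSpin v := by
  ext i
  simp [conjSpin_apply]

theorem norm_conjSpin (v : Spin) : ‖conjSpin v‖ = ‖v‖ := by
  rw [EuclideanSpace.norm_eq, EuclideanSpace.norm_eq]
  simp [conjSpin_apply]

theorem coeFn_conjSpinor (w : Spinor) : conjSpinor w =ᵐ[volume] fun x => conjSpin (w x) :=
  conjSpin.coeFn_compLp w

theorem conjSpinor_add (v w : Spinor) : conjSpinor (v + w) = conjSpinor v + conjSpinor w := by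
  refine Lp.ext ?_
  filter_upwards [coeFn_conjSpinor (v + w), coeFn_conjSpinor v, coeFn_conjSpinor w,
    Lp.coeFn_add v w, Lp.coeFn_add (conjSpinor v) (conjSpinor w)] with x h1 h2 h3 h4 h5
  rw [h1, h4, h5, Pi.add_apply, Pi.add_apply, h2, h3, map_add]

theorem conjSpinor_smul (c : ℂ) (w : Spinor) :
    conjSpinor (c • w) = (starRingEnd ℂ c) • conjSpinor w := by
  refine Lp.ext ?_
  filter_upwards [coeFn_conjSpinor (c • w), coeFn_conjSpinor w, Lp.coeFn_smul c w,
    Lp.coeFn_smul (starRingEnd ℂ c) (conjSpinor w)] with x h1 h2 h3 h4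
  rw [h1, h3, h4, Pi.smul_apply, Pi.smul_apply, h2, conjSpin_smul]

theorem conjSpinor_zero : conjSpinor 0 = 0 := by
  simpa using conjSpinor_smul 0 0

theorem norm_conjSpinor (w : Spinor) : ‖conjSpinor w‖ = ‖w‖ := by
  refine le_antisymm (Lp.norm_le_norm_of_ae_le ?_) (Lp.norm_le_norm_of_ae_le ?_) <;>
  · filter_upwards [coeFn_conjSpinor w] with x hx
    rw [hx, norm_conjSpin]

/-- Conjugation inverts the phase. This is why `twist` has opposite signs on h₊ and h₋: it then
commutes with `kappa`. -/
theorem phaseMul_conjSpinor (θ : Space → ℝ) (hθ : AEStronglyMeasurable θ volume) (w : Spinor) :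
    phaseMul θ hθ (conjSpinor w) = conjSpinor (phaseMul (fun x => -θ x) hθ.neg w) := by
  refine Lp.ext ?_
  filter_upwards [coeFn_phaseMul θ hθ (conjSpinor w), coeFn_conjSpinor w,
    coeFn_conjSpinor (phaseMul (fun x => -θ x) hθ.neg w), coeFn_phaseMul _ hθ.neg w]
    with x h1 h2 h3 h4
  rw [h1, h2, h3]
  refine Eq.trans ?_ (congrArg conjSpin h4.symm)
  rw [conjSpin_smul, ← Complex.exp_conj]
  simp

/-- The Dirac field is covariant under the twists. -/
theorem secondQuant_diracFock (s : ScalarTest × ScalarTest) (w : Spinor) :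
    secondQuant (twist s) * diracFock w =
      diracFock (phaseMul (fun x => -coulombConv s.1 x) (aestronglyMeasurable_coulombConv s.1).neg w)
        * secondQuant (twist s) := by
  have e1 : twist s (WithLp.toLp 2 (w, 0)) = WithLp.toLp 2
      (phaseMul (fun x => -coulombConv s.1 x) (aestronglyMeasurable_coulombConv s.1).neg w, 0) := by
    refine toLp_prod_ext rfl ?_
    exact map_zero (phaseMul _ _)
  -- The argument of the annihilation operator is changed by the same phase of w as the argument of
  -- the creation operator, so ψ is covariant as a whole.
  have e2 : twist s (kappa (WithLp.toLp 2 (w, 0))) = kappa (WithLp.toLp 2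
      (phaseMul (fun x => -coulombConv s.1 x) (aestronglyMeasurable_coulombConv s.1).neg w, 0)) := by
    refine toLp_prod_ext ?_ ?_
    · change phaseMul _ _ (conjSpinor 0) = conjSpinor 0
      rw [conjSpinor_zero, map_zero]
    · exact phaseMul_conjSpinor _ _ w
  refine ContinuousLinearMap.ext fun v => ?_
  have h1 := DFunLike.congr_fun (secondQuant_creation (twist s) (WithLp.toLp 2 (w, 0))) v
  have h2 := DFunLike.congr_fun
    (secondQuant_annihilation (twist s) (kappa (WithLp.toLp 2 (w, 0)))) v
  rw [e1] at h1
  rw [e2] at h2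
  change secondQuant (twist s) ((((Real.sqrt 2)⁻¹ : ℝ) : ℂ) • (creation (WithLp.toLp 2 (w, 0)) v +
    annihilation (kappa (WithLp.toLp 2 (w, 0))) v)) = _
  rw [map_smul, map_add]
  exact congrArg _ (congrArg₂ _ h1 h2)

theorem norm_toLp_fst (w : Spinor) : ‖(WithLp.toLp 2 (w, 0) : DiracSpace)‖ = ‖w‖ := by
  simp

theorem norm_toLp_snd (w : Spinor) : ‖(WithLp.toLp 2 (0, w) : DiracSpace)‖ = ‖w‖ := by
  simp

theorem kappa_fst (w : Spinor) :
    kappa (WithLp.toLp 2 (w, 0)) = WithLp.toLp 2 (0, conjSpinor w) := by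
  refine toLp_prod_ext ?_ rfl
  exact conjSpinor_zero

theorem diracFock_apply (w : Spinor) (x : Fock DiracSpace) :
    diracFock w x = (((Real.sqrt 2)⁻¹ : ℝ) : ℂ) • (creation (WithLp.toLp 2 (w, 0)) x +
      annihilation (WithLp.toLp 2 (0, conjSpinor w)) x) := by
  rw [← kappa_fst]; rfl

theorem diracFock_add (v w : Spinor) : diracFock (v + w) = diracFock v + diracFock w := by
  have e1 : (WithLp.toLp 2 (v + w, 0) : DiracSpace) =
      WithLp.toLp 2 (v, 0) + WithLp.toLp 2 (w, 0) := by
    rw [← WithLp.toLp_add]; simp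
  have e2 : (WithLp.toLp 2 (0, conjSpinor (v + w)) : DiracSpace) =
      WithLp.toLp 2 (0, conjSpinor v) + WithLp.toLp 2 (0, conjSpinor w) := by
    rw [← WithLp.toLp_add, conjSpinor_add]; simp
  refine ContinuousLinearMap.ext fun x => ?_
  change diracFock (v + w) x = diracFock v x + diracFock w x
  rw [diracFock_apply, diracFock_apply, diracFock_apply, e1, e2, creation_add, annihilation_add,
    ← smul_add]
  exact congrArg _ (add_add_add_comm _ _ _ _)

/-- The annihilation part is linear in w because the antilinear annihilation operator is composed
with the antilinear conjugation. -/
theorem diracFock_smul (c : ℂ) (w : Spinor) : diracFock (c • w) = c • diracFock w := by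
  have e1 : (WithLp.toLp 2 (c • w, 0) : DiracSpace) = c • WithLp.toLp 2 (w, 0) := by
    rw [← WithLp.toLp_smul]; simp
  have e2 : (WithLp.toLp 2 (0, conjSpinor (c • w)) : DiracSpace) =
      (starRingEnd ℂ c) • WithLp.toLp 2 (0, conjSpinor w) := by
    rw [← WithLp.toLp_smul, conjSpinor_smul]; simp
  refine ContinuousLinearMap.ext fun x => ?_
  change diracFock (c • w) x = c • diracFock w x
  rw [diracFock_apply, diracFock_apply, e1, e2, creation_smul, annihilation_smul,
    Complex.conj_conj, smul_comm c, smul_add c]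
  rfl

/-- The constant is not optimized; any bound proportional to ‖w‖ gives the continuity needed to
differentiate ψ(w(t)). -/
theorem norm_diracFock_le (w : Spinor) : ‖diracFock w‖ ≤ (Real.sqrt 2)⁻¹ * 2 * ‖w‖ := by
  refine ContinuousLinearMap.opNorm_le_bound _ (by positivity) fun x => ?_
  have h1 := (creation (WithLp.toLp 2 (w, 0) : DiracSpace)).le_of_opNorm_le
    (norm_creation_le _) x
  have h2 := (annihilation (WithLp.toLp 2 (0, conjSpinor w) : DiracSpace)).le_of_opNorm_le
    (norm_annihilation_le _) x
  rw [norm_toLp_fst] at h1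
  rw [norm_toLp_snd, norm_conjSpinor] at h2
  rw [diracFock_apply, norm_smul, Complex.norm_real, Real.norm_of_nonneg (by positivity),
    mul_assoc, mul_assoc]
  refine mul_le_mul_of_nonneg_left ((norm_add_le _ _).trans ?_) (by positivity)
  linarith

end TwistedDirac

/-! ### Commutators of unbounded with bounded operators -/

section Commutators

variable {K : Type} [NormedAddCommGroup K] [InnerProductSpace ℂ K]

theorem HasCommutator.neg {T : K →ₗ.[ℂ] K} {B C : K →L[ℂ] K} (h : HasCommutator T B C) :
    HasCommutator (-T) B (-C) := by
  intro v
  obtain ⟨hd, hv⟩ := h v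
  refine ⟨hd, ?_⟩
  change -T ⟨B v, hd⟩ - B (-T v) = -C v
  rw [← hv, map_neg]
  abel

/-- The domain of the difference is the intersection of the domains, and the bounded operator
preserves each of them. -/
theorem HasCommutator.sub {S T : K →ₗ.[ℂ] K} {B C : K →L[ℂ] K} (hS : HasCommutator S B C)
    (hT : HasCommutator T B 0) : HasCommutator (S - T) B C := by
  intro v
  obtain ⟨hd, hv⟩ := hS ⟨v, v.2.1⟩
  obtain ⟨hd', hv'⟩ := hT ⟨v, v.2.2⟩
  refine ⟨⟨hd, hd'⟩, ?_⟩
  rw [LinearPMap.sub_apply, LinearPMap.sub_apply, map_sub, ← hv]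
  have h0 : T ⟨B v, hd'⟩ = B (T ⟨v, v.2.2⟩) := sub_eq_zero.1 hv'
  rw [h0]
  abel

theorem hasCommutator_zero {V : ℝ → K →L[ℂ] K} {B : K →L[ℂ] K} (hV0 : V 0 = 1)
    (h : ∀ t, V t * B = B * V t) : HasCommutator (stoneGenerator V) B 0 :=
  hasCommutator_stoneGenerator (B := fun _ => B) hV0 h (by simpa using hasDerivAt_const (0 : ℝ) B)

end Commutators

/-! ### Operators on a completed triple tensor product -/

section TripleOperators

open UniformSpace (Completion)

variable {E F G : Type} [NormedAddCommGroup E] [InnerProductSpace ℂ E] [NormedAddCommGroup F]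
  [InnerProductSpace ℂ F] [NormedAddCommGroup G] [InnerProductSpace ℂ G]

/-- The operator `A ⊗ B ⊗ C` on the completed tensor product. -/
def tripleOp (A : E →L[ℂ] E) (B : F →L[ℂ] F) (C : G →L[ℂ] G) :
    Completion (E ⊗[ℂ] (F ⊗[ℂ] G)) →L[ℂ] Completion (E ⊗[ℂ] (F ⊗[ℂ] G)) :=
  (TensorProduct.mapL A (TensorProduct.mapL B C)).completion

theorem completion_ext {D : Type} [NormedAddCommGroup D] [InnerProductSpace ℂ D]
    {B C : Completion D →L[ℂ] Completion D} (h : ∀ x : D, B x = C x) : B = C :=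
  DFunLike.coe_injective
    (Completion.denseRange_coe.equalizer B.continuous C.continuous (funext h))

theorem tripleOp_coe (A : E →L[ℂ] E) (B : F →L[ℂ] F) (C : G →L[ℂ] G) (x : E ⊗[ℂ] (F ⊗[ℂ] G)) :
    tripleOp A B C (x : Completion (E ⊗[ℂ] (F ⊗[ℂ] G))) =
      (TensorProduct.mapL A (TensorProduct.mapL B C) x : E ⊗[ℂ] (F ⊗[ℂ] G)) :=
  ContinuousLinearMap.completion_apply_coe _ _

theorem tripleOp_mul (A A' : E →L[ℂ] E) (B B' : F →L[ℂ] F) (C C' : G →L[ℂ] G) :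
    tripleOp A B C * tripleOp A' B' C' = tripleOp (A * A') (B * B') (C * C') := by
  refine completion_ext fun x => ?_
  change tripleOp A B C (tripleOp A' B' C' x) = _
  rw [tripleOp_coe, tripleOp_coe, tripleOp_coe, TensorProduct.mapL_mul, TensorProduct.mapL_mul]
  rfl

theorem tripleOp_one : tripleOp (1 : E →L[ℂ] E) (1 : F →L[ℂ] F) (1 : G →L[ℂ] G) = 1 := by
  refine completion_ext fun x => ?_
  rw [tripleOp_coe, one_apply_eq_self]
  congr 1
  have h : TensorProduct.mapL (ContinuousLinearMap.id ℂ E) (TensorProduct.mapL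
    (ContinuousLinearMap.id ℂ F) (ContinuousLinearMap.id ℂ G)) x = x := by
    rw [TensorProduct.mapL_id_id, TensorProduct.mapL_id_id]
    rfl
  exact h

theorem tripleOp_add_left (A A' : E →L[ℂ] E) (B : F →L[ℂ] F) (C : G →L[ℂ] G) :
    tripleOp (A + A') B C = tripleOp A B C + tripleOp A' B C := by
  refine completion_ext fun x => ?_
  rw [_root_.add_apply, tripleOp_coe, tripleOp_coe, tripleOp_coe, TensorProduct.mapL_add_left,
    _root_.add_apply, Completion.coe_add]

theorem tripleOp_smul_left (c : ℂ) (A : E →L[ℂ] E) (B : F →L[ℂ] F) (C : G →L[ℂ] G) :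
    tripleOp (c • A) B C = c • tripleOp A B C := by
  refine completion_ext fun x => ?_
  rw [_root_.smul_apply, tripleOp_coe, tripleOp_coe, TensorProduct.mapL_smul_left,
    _root_.smul_apply, Completion.coe_smul]

theorem one_opMul_one : (1 : E →L[ℂ] E) * 1 = 1 := rfl

theorem norm_one_apply (x : E) : ‖(1 : E →L[ℂ] E) x‖ = ‖x‖ := rfl

theorem norm_tripleOp_le (A : E →L[ℂ] E) :
    ‖tripleOp A (1 : F →L[ℂ] F) (1 : G →L[ℂ] G)‖ ≤ ‖A‖ := by
  refine ContinuousLinearMap.opNorm_le_bound _ (norm_nonneg _) fun v => ?_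
  refine Completion.denseRange_coe.induction_on
    (p := fun v => ‖tripleOp A (1 : F →L[ℂ] F) (1 : G →L[ℂ] G) v‖ ≤ ‖A‖ * ‖v‖) v
    (isClosed_le (by fun_prop) (by fun_prop)) fun x => ?_
  rw [tripleOp_coe, Completion.norm_coe, Completion.norm_coe]
  refine ContinuousLinearMap.le_of_opNorm_le _ ((TensorProduct.norm_mapL_le _ _).trans ?_) x
  have h1 : ‖TensorProduct.mapL (1 : F →L[ℂ] F) (1 : G →L[ℂ] G)‖ ≤ 1 := by
    refine (TensorProduct.norm_mapL_le _ _).trans ?_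
    exact mul_le_one₀ ContinuousLinearMap.norm_id_le (norm_nonneg _)
      ContinuousLinearMap.norm_id_le
  exact mul_le_of_le_one_right (norm_nonneg _) h1

theorem norm_tripleOp {A : E →L[ℂ] E} {B : F →L[ℂ] F} {C : G →L[ℂ] G} (hA : ∀ x, ‖A x‖ = ‖x‖)
    (hB : ∀ x, ‖B x‖ = ‖x‖) (hC : ∀ x, ‖C x‖ = ‖x‖) (v : Completion (E ⊗[ℂ] (F ⊗[ℂ] G))) :
    ‖tripleOp A B C v‖ = ‖v‖ := by
  refine Completion.denseRange_coe.induction_on (p := fun v => ‖tripleOp A B C v‖ = ‖v‖) v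
    (isClosed_eq (by fun_prop) (by fun_prop)) fun x => ?_
  rw [tripleOp_coe, Completion.norm_coe, Completion.norm_coe]
  let A' : E →ₗᵢ[ℂ] E := ⟨A.toLinearMap, hA⟩
  let B' : F →ₗᵢ[ℂ] F := ⟨B.toLinearMap, hB⟩
  let C' : G →ₗᵢ[ℂ] G := ⟨C.toLinearMap, hC⟩
  have h := TensorProduct.norm_map A' (TensorProduct.mapIsometry B' C') x
  rw [← h, TensorProduct.mapL_apply, TensorProduct.toLinearMap_mapL]
  rw [TensorProduct.toLinearMap_mapIsometry]

/-- Continuity is checked on elementary tensors, using joint continuity of ⊗, and extends to the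
completion because the operators are isometric. -/
theorem continuous_tripleOp {A : ℝ → E →L[ℂ] E}
    {B : ℝ → F →L[ℂ] F} {C : ℝ → G →L[ℂ] G} (hA : ∀ t x, ‖A t x‖ = ‖x‖)
    (hB : ∀ t x, ‖B t x‖ = ‖x‖) (hC : ∀ t x, ‖C t x‖ = ‖x‖) (cA : ∀ x, Continuous fun t => A t x)
    (cB : ∀ x, Continuous fun t => B t x) (cC : ∀ x, Continuous fun t => C t x)
    (v : Completion (E ⊗[ℂ] (F ⊗[ℂ] G))) : Continuous fun t => tripleOp (A t) (B t) (C t) v := by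
  have hd : Dense (Submodule.span ℂ (Set.range ((↑) : E ⊗[ℂ] (F ⊗[ℂ] G) →
      Completion (E ⊗[ℂ] (F ⊗[ℂ] G)))) :
      Set (Completion (E ⊗[ℂ] (F ⊗[ℂ] G)))) :=
    Completion.denseRange_coe.mono Submodule.subset_span
  refine strongly_continuous_of_dense
    (fun t v => (norm_tripleOp (hA t) (hB t) (hC t) v).le) hd ?_ v
  rintro _ ⟨x, rfl⟩
  simp only [tripleOp_coe]
  refine (Completion.continuous_coe _).comp ?_
  induction x using TensorProduct.induction_on with
  | zero => simpa using continuous_const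
  | add x y hx hy =>
    simp only [map_add]
    exact hx.add hy
  | tmul a y =>
    simp only [TensorProduct.mapL_tmul]
    refine (TensorProduct.continuous_tmul (𝕜 := ℂ)).comp ((cA a).prodMk ?_)
    induction y using TensorProduct.induction_on with
    | zero => simpa using continuous_const
    | add x y hx hy =>
      simp only [map_add]
      exact hx.add hy
    | tmul b c =>
      simp only [TensorProduct.mapL_tmul]
      exact (TensorProduct.continuous_tmul (𝕜 := ℂ)).comp ((cB b).prodMk (cC c))

end TripleOperators

/-! ### The interacting fields: groups, commutators and gauge transformations -/

section TensorOperators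

variable {ω₀ : WeylFunctional scalarForm} {ωtr : WeylFunctional transverseForm}

theorem tensorOp_mul (A A' : Fock DiracSpace →L[ℂ] Fock DiracSpace) (B B' : ω₀.GNS →L[ℂ] ω₀.GNS)
    (C C' : ωtr.GNS →L[ℂ] ωtr.GNS) : tensorOp ω₀ ωtr A B C * tensorOp ω₀ ωtr A' B' C' =
      tensorOp ω₀ ωtr (A * A') (B * B') (C * C') :=
  tripleOp_mul A A' B B' C C'

theorem tensorOp_mul_of_right_one (A A' : Fock DiracSpace →L[ℂ] Fock DiracSpace)
    (B B' : ω₀.GNS →L[ℂ] ω₀.GNS) :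
    tensorOp ω₀ ωtr A B 1 * tensorOp ω₀ ωtr A' B' 1 = tensorOp ω₀ ωtr (A * A') (B * B') 1 := by
  rw [tensorOp_mul, one_opMul_one]

theorem tensorOp_mul_of_left_one (C C' : ωtr.GNS →L[ℂ] ωtr.GNS) :
    tensorOp ω₀ ωtr 1 1 C * tensorOp ω₀ ωtr 1 1 C' = tensorOp ω₀ ωtr 1 1 (C * C') :=
  (tensorOp_mul _ _ _ _ _ _).trans
    (congrArg₂ (fun A B => tensorOp ω₀ ωtr A B (C * C')) one_opMul_one one_opMul_one)

theorem tensorOp_one : tensorOp ω₀ ωtr 1 1 1 = 1 :=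
  tripleOp_one

theorem tensorOp_add_left (A A' : Fock DiracSpace →L[ℂ] Fock DiracSpace)
    (B : ω₀.GNS →L[ℂ] ω₀.GNS) (C : ωtr.GNS →L[ℂ] ωtr.GNS) :
    tensorOp ω₀ ωtr (A + A') B C = tensorOp ω₀ ωtr A B C + tensorOp ω₀ ωtr A' B C :=
  tripleOp_add_left A A' B C

theorem tensorOp_smul_left (c : ℂ) (A : Fock DiracSpace →L[ℂ] Fock DiracSpace)
    (B : ω₀.GNS →L[ℂ] ω₀.GNS) (C : ωtr.GNS →L[ℂ] ωtr.GNS) :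
    tensorOp ω₀ ωtr (c • A) B C = c • tensorOp ω₀ ωtr A B C :=
  tripleOp_smul_left c A B C

theorem norm_tensorOp_le (A : Fock DiracSpace →L[ℂ] Fock DiracSpace) :
    ‖tensorOp ω₀ ωtr A 1 1‖ ≤ ‖A‖ :=
  norm_tripleOp_le A

theorem norm_tensorOp {A : Fock DiracSpace →L[ℂ] Fock DiracSpace} {B : ω₀.GNS →L[ℂ] ω₀.GNS}
    {C : ωtr.GNS →L[ℂ] ωtr.GNS} (hA : ∀ x, ‖A x‖ = ‖x‖) (hB : ∀ x, ‖B x‖ = ‖x‖)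
    (hC : ∀ x, ‖C x‖ = ‖x‖) (v : Total ω₀ ωtr) : ‖tensorOp ω₀ ωtr A B C v‖ = ‖v‖ :=
  norm_tripleOp hA hB hC v

theorem continuous_tensorOp {A : ℝ → Fock DiracSpace →L[ℂ] Fock DiracSpace}
    {B : ℝ → ω₀.GNS →L[ℂ] ω₀.GNS} {C : ℝ → ωtr.GNS →L[ℂ] ωtr.GNS} (hA : ∀ t x, ‖A t x‖ = ‖x‖)
    (hB : ∀ t x, ‖B t x‖ = ‖x‖) (hC : ∀ t x, ‖C t x‖ = ‖x‖) (cA : ∀ x, Continuous fun t => A t x)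
    (cB : ∀ x, Continuous fun t => B t x) (cC : ∀ x, Continuous fun t => C t x)
    (v : Total ω₀ ωtr) : Continuous fun t => tensorOp ω₀ ωtr (A t) (B t) (C t) v :=
  continuous_tripleOp hA hB hC cA cB cC v

theorem isUnitaryGroup_twistedWeyl (hreg₀ : IsRegular ω₀) (s : ScalarTest × ScalarTest) :
    IsUnitaryGroup fun t : ℝ => twistedWeyl ω₀ ωtr (t • s) where
  zero := by
    rw [twistedWeyl, zero_smul, twist_zero, secondQuant_id,
      gns_weyl_zero _ isSymplectic_scalarForm, tensorOp_one]
  add t r :=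
    (congrArg₂ (fun A B => tensorOp ω₀ ωtr A B 1)
      ((congrArg secondQuant ((congrArg twist (add_smul t r s)).trans (twist_add _ _))).trans
        (secondQuant_comp _ _))
      (gns_weyl_smul_add ω₀ isSymplectic_scalarForm s t r)).trans
      (tensorOp_mul_of_right_one _ _ _ _).symm
  norm_map t := norm_tensorOp (norm_secondQuant _)
    (norm_gns_weyl _ isSymplectic_scalarForm _) norm_one_apply
  continuous := continuous_tensorOp (C := fun _ => 1) (fun _ => norm_secondQuant _)
    (fun _ => norm_gns_weyl _ isSymplectic_scalarForm _) (fun _ => norm_one_apply)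
    (continuous_secondQuant (continuous_twist s)) (hreg₀ s) fun _ => continuous_const

theorem isUnitaryGroup_transverseWeyl (hregtr : IsRegular ωtr) (f : VectorTest × VectorTest) :
    IsUnitaryGroup fun t : ℝ => transverseWeyl ω₀ ωtr (t • f) where
  zero := by
    rw [transverseWeyl, zero_smul, gns_weyl_zero _ isSymplectic_transverseForm, tensorOp_one]
  add t r :=
    (congrArg (fun C => tensorOp ω₀ ωtr 1 1 C)
      (gns_weyl_smul_add ωtr isSymplectic_transverseForm f t r)).trans
      (tensorOp_mul_of_left_one _ _).symm
  norm_map t := norm_tensorOp norm_one_apply norm_one_apply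
    (norm_gns_weyl _ isSymplectic_transverseForm _)
  continuous := continuous_tensorOp (A := fun _ => 1) (B := fun _ => 1) (fun _ => norm_one_apply)
    (fun _ => norm_one_apply) (fun _ => norm_gns_weyl _ isSymplectic_transverseForm _)
    (fun _ => continuous_const) (fun _ => continuous_const) (hregtr f)

theorem twistedWeyl_comm_transverseWeyl (s : ScalarTest × ScalarTest)
    (f : VectorTest × VectorTest) : twistedWeyl ω₀ ωtr s * transverseWeyl ω₀ ωtr f =
      transverseWeyl ω₀ ωtr f * twistedWeyl ω₀ ωtr s := by
  simp only [twistedWeyl, transverseWeyl, tensorOp_mul, one_mul, mul_one]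

theorem transverseWeyl_comm_dirac (f : VectorTest × VectorTest) (w : Spinor) :
    transverseWeyl ω₀ ωtr f * dirac ω₀ ωtr w = dirac ω₀ ωtr w * transverseWeyl ω₀ ωtr f := by
  simp only [transverseWeyl, dirac, tensorOp_mul, one_mul, mul_one]

theorem transverseWeyl_comm {f g : VectorTest × VectorTest} (h : transverseForm f g = 0) :
    transverseWeyl ω₀ ωtr f * transverseWeyl ω₀ ωtr g =
      transverseWeyl ω₀ ωtr g * transverseWeyl ω₀ ωtr f := by
  have hη := isSymplectic_transverseForm
  simp only [transverseWeyl, tensorOp_mul, gns_weyl_mul _ hη, hη.swap g f, h, neg_zero,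
    add_comm g f]

theorem twistedWeyl_dirac (s : ScalarTest × ScalarTest) (w : Spinor) :
    twistedWeyl ω₀ ωtr s * dirac ω₀ ωtr w =
      dirac ω₀ ωtr (phaseMul (fun x => -coulombConv s.1 x)
        (aestronglyMeasurable_coulombConv s.1).neg w) * twistedWeyl ω₀ ωtr s := by
  simp only [twistedWeyl, dirac, tensorOp_mul, one_mul, mul_one, secondQuant_diracFock]

/-- The Dirac field as a bounded linear map. -/
def diracL (ω₀ : WeylFunctional scalarForm) (ωtr : WeylFunctional transverseForm) :
    Spinor →L[ℂ] (Total ω₀ ωtr →L[ℂ] Total ω₀ ωtr) :=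
  LinearMap.mkContinuous
    { toFun := dirac ω₀ ωtr
      map_add' := fun v w => by
        simp only [dirac, diracFock_add, tensorOp_add_left]
      map_smul' := fun c w => by
        simp only [dirac, diracFock_smul, tensorOp_smul_left, RingHom.id_apply] }
    ((Real.sqrt 2)⁻¹ * 2) fun w => (norm_tensorOp_le _).trans (norm_diracFock_le w)

theorem diracL_apply (w : Spinor) : diracL ω₀ ωtr w = dirac ω₀ ωtr w := rfl

/-- Conjugation by W^λ(ts₀, 0) replaces w by e^{-itσ⋆s₀}w. This curve has derivative -i(σ⋆s₀)w at 0,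
and the bounded map `diracL` carries it to a norm derivative of operators. -/
theorem hasCommutator_phiField (hreg₀ : IsRegular ω₀) (s₀ : ScalarTest) (w : Spinor)
    (h : MemLp (fun x => (coulombConv s₀ x : ℂ) • w x) 2 volume) :
    HasCommutator (phiField ω₀ ωtr s₀) (dirac ω₀ ωtr w) (-dirac ω₀ ωtr h.toLp) := by
  obtain ⟨C, hC⟩ := exists_bound_coulombConv s₀
  have hm : ∀ t : ℝ, AEStronglyMeasurable (fun x => t * -coulombConv s₀ x) volume := fun t =>
    (aestronglyMeasurable_coulombConv s₀).neg.const_mul t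
  have hC' : ∀ x, |-coulombConv s₀ x| ≤ C := fun x => by rw [abs_neg]; exact hC x
  have hw : MemLp (fun x => ((-coulombConv s₀ x : ℝ) : ℂ) • w x) 2 volume :=
    memLp_bounded_mul (aestronglyMeasurable_coulombConv s₀).neg hC' w
  have hd := (diracL ω₀ ωtr).hasFDerivAt.restrictScalars ℝ |>.comp_hasDerivAt 0
    (hasDerivAt_phaseMul hC' hm w hw)
  have he : hw.toLp = -h.toLp := by
    rw [← MemLp.toLp_neg]
    refine MemLp.toLp_congr _ _ (Eventually.of_forall fun x => ?_)
    simp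
  have h0 : phaseMul (fun x => 0 * -coulombConv s₀ x) (hm 0) w = w := by
    rw [phaseMul_congr (θ' := fun _ => 0) (by ext; simp) _ aestronglyMeasurable_const,
      phaseMul_zero]
    rfl
  have key := hasCommutator_stoneGenerator (V := fun t : ℝ => twistedWeyl ω₀ ωtr (t • (s₀, 0)))
    (B := fun t => dirac ω₀ ωtr (phaseMul (fun x => t * -coulombConv s₀ x) (hm t) w))
    (C := -dirac ω₀ ωtr h.toLp) (isUnitaryGroup_twistedWeyl hreg₀ _).zero ?_ ?_
  · rw [h0] at key
    exact key
  · intro t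
    rw [h0, twistedWeyl_dirac]
    congr 2
    refine DFunLike.congr_fun (phaseMul_congr ?_ _ _) w
    ext x
    have : coulombConv (t • (s₀, (0 : ScalarTest))).1 x = t * coulombConv s₀ x :=
      coulombConv_smul t s₀ x
    rw [this]; ring
  · refine hd.congr_deriv ?_
    change diracL ω₀ ωtr (Complex.I • hw.toLp) = Complex.I • -diracL ω₀ ωtr h.toLp
    rw [map_smul, he, map_neg]

theorem vectorPotentialDot_comm_dirac (hregtr : IsRegular ωtr) (f : VectorTest) (w : Spinor) :
    HasCommutator (vectorPotentialDot ω₀ ωtr f) (dirac ω₀ ωtr w) 0 :=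
  hasCommutator_zero (isUnitaryGroup_transverseWeyl hregtr _).zero fun _ =>
    transverseWeyl_comm_dirac _ w

theorem hasCommutator_electricField (hreg₀ : IsRegular ω₀) (hregtr : IsRegular ωtr)
    (f : VectorTest) (w : Spinor)
    (h : MemLp (fun x => (coulombConv (divergence f) x : ℂ) • w x) 2 volume) :
    HasCommutator (electricField ω₀ ωtr f) (dirac ω₀ ωtr w) (-dirac ω₀ ωtr h.toLp) :=
  (hasCommutator_phiField hreg₀ _ w h).sub (vectorPotentialDot_comm_dirac hregtr f w)

theorem memLp_coulombConv_smul (s : ScalarTest) (w : Spinor) :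
    MemLp (fun x => (coulombConv s x : ℂ) • w x) 2 volume := by
  obtain ⟨C, hC⟩ := exists_bound_coulombConv s
  exact memLp_bounded_mul (aestronglyMeasurable_coulombConv s) hC w

/-- Both sides have the intersection of the two field domains as domain, so the sign can be
distributed without changing it. -/
theorem chargeDensity_eq (s₀ : ScalarTest) : chargeDensity ω₀ ωtr s₀ =
    -phiField ω₀ ωtr (lap s₀) + vectorPotentialDot ω₀ ωtr (grad s₀) := by
  rw [chargeDensity, electricField, divergence_grad]
  rw [neg_sub, sub_eq_add_neg, add_comm]

/-- Poisson's equation at the level of spinors: the nonlocal multiplier σ⋆Δs₀ is the local one -s₀.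
-/
theorem exists_memLp_and_toLp (s₀ : ScalarTest) (w : Spinor) :
    ∃ h : MemLp (fun x => (s₀ x : ℂ) • w x) 2 volume,
      h.toLp = -(memLp_coulombConv_smul (lap s₀) w).toLp := by
  have e : (fun x => (s₀ x : ℂ) • w x) = -fun x => (coulombConv (lap s₀) x : ℂ) • w x := by
    ext1 x
    simp [coulombConv_lap]
  have h : MemLp (fun x => (s₀ x : ℂ) • w x) 2 volume := by
    rw [e]
    exact (memLp_coulombConv_smul (lap s₀) w).neg
  refine ⟨h, ?_⟩
  rw [← MemLp.toLp_neg]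
  exact MemLp.toLp_congr _ _ (Eventually.of_forall fun x => congrFun e x)

theorem hasCommutator_chargeDensity (hreg₀ : IsRegular ω₀) (hregtr : IsRegular ωtr)
    (s₀ : ScalarTest) (w : Spinor) :
    ∃ h : MemLp (fun x => (s₀ x : ℂ) • w x) 2 volume,
      HasCommutator (chargeDensity ω₀ ωtr s₀) (dirac ω₀ ωtr w) (-dirac ω₀ ωtr h.toLp) ∧
      HasCommutator (-phiField ω₀ ωtr (lap s₀)) (dirac ω₀ ωtr w) (-dirac ω₀ ωtr h.toLp) := by
  obtain ⟨h, he⟩ := exists_memLp_and_toLp s₀ w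
  have e : -dirac ω₀ ωtr h.toLp =
      - -dirac ω₀ ωtr (memLp_coulombConv_smul (lap s₀) w).toLp := by
    rw [he, ← diracL_apply, map_neg, diracL_apply]
  have h1 := hasCommutator_phiField (ωtr := ωtr) hreg₀ (lap s₀) w (memLp_coulombConv_smul _ w)
  refine ⟨h, ?_, ?_⟩
  · rw [e, chargeDensity, electricField, divergence_grad]
    exact (h1.sub (vectorPotentialDot_comm_dirac hregtr _ w)).neg
  · rw [e]
    exact h1.neg

/-- The minus sign in front of Ȧ(f) is obtained by reversing time in the transverse group, which
acts on a different tensor factor from the twisted one. -/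
theorem isExp_electricField (hreg₀ : IsRegular ω₀) (hregtr : IsRegular ωtr) (f : VectorTest) :
    ∃ U, IsExp (electricField ω₀ ωtr f) U := by
  have h := (isUnitaryGroup_twistedWeyl (ωtr := ωtr) hreg₀ (divergence f, 0)).isExp_add
    (isUnitaryGroup_transverseWeyl (ω₀ := ω₀) hregtr (0, f)).reverse
    fun t _ => twistedWeyl_comm_transverseWeyl _ _
  rw [stoneGenerator_neg fun t : ℝ => transverseWeyl ω₀ ωtr (t • (0, f)), ← sub_eq_add_neg] at h
  exact ⟨_, h⟩

variable (ω₀ ωtr) in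
/-- The unitary group generated by the charge density. -/
def gaugeGroup (s₀ : ScalarTest) (t : ℝ) : Total ω₀ ωtr →L[ℂ] Total ω₀ ωtr :=
  twistedWeyl ω₀ ωtr (-t • (lap s₀, 0)) * transverseWeyl ω₀ ωtr (t • (0, grad s₀))

theorem isExp_chargeDensity (hreg₀ : IsRegular ω₀) (hregtr : IsRegular ωtr) (s₀ : ScalarTest) :
    IsExp (chargeDensity ω₀ ωtr s₀) (gaugeGroup ω₀ ωtr s₀) := by
  have h := (isUnitaryGroup_twistedWeyl (ωtr := ωtr) hreg₀ (lap s₀, 0)).reverse.isExp_add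
    (isUnitaryGroup_transverseWeyl (ω₀ := ω₀) hregtr (0, grad s₀))
    fun t _ => twistedWeyl_comm_transverseWeyl _ _
  rw [stoneGenerator_neg fun t : ℝ => twistedWeyl ω₀ ωtr (t • (lap s₀, 0))] at h
  rw [chargeDensity_eq]
  exact h

theorem chargeDensity_le (hreg₀ : IsRegular ω₀) (hregtr : IsRegular ωtr) (s₀ : ScalarTest) :
    chargeDensity ω₀ ωtr s₀ ≤ stoneGenerator (gaugeGroup ω₀ ωtr s₀) := by
  rw [(isExp_chargeDensity hreg₀ hregtr s₀).2]
  exact LinearPMap.le_closure _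

/-- The transverse factor commutes with ψ(w), and the twisted factor multiplies w by e^{itσ⋆Δs₀} =
e^{-its₀}. -/
theorem gaugeGroup_dirac (hreg₀ : IsRegular ω₀) (hregtr : IsRegular ωtr) (s₀ : ScalarTest) (t : ℝ)
    (w : Spinor) : gaugeGroup ω₀ ωtr s₀ t * dirac ω₀ ωtr w * gaugeGroup ω₀ ωtr s₀ (-t) =
      dirac ω₀ ωtr (phaseMul (fun x => -(t * s₀ x))
        (continuous_const.mul s₀.continuous).neg.aestronglyMeasurable w) := by
  have hU := (isExp_chargeDensity (ω₀ := ω₀) (ωtr := ωtr) hreg₀ hregtr s₀).1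
  have h1 : gaugeGroup ω₀ ωtr s₀ t * gaugeGroup ω₀ ωtr s₀ (-t) = 1 := by
    rw [← hU.add, add_neg_cancel, hU.zero]
  have h2 : gaugeGroup ω₀ ωtr s₀ t * dirac ω₀ ωtr w = dirac ω₀ ωtr
      (phaseMul (fun x => -(t * s₀ x))
        (continuous_const.mul s₀.continuous).neg.aestronglyMeasurable w) *
          gaugeGroup ω₀ ωtr s₀ t := by
    rw [gaugeGroup, mul_assoc, transverseWeyl_comm_dirac, ← mul_assoc, twistedWeyl_dirac,
      mul_assoc]
    congr 2
    refine DFunLike.congr_fun (phaseMul_congr ?_ _ _) w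
    ext x
    have : coulombConv (-t • (lap s₀, (0 : ScalarTest))).1 x = -t * coulombConv (lap s₀) x :=
      coulombConv_smul (-t) (lap s₀) x
    rw [this, coulombConv_lap]; ring
  rw [h2, mul_assoc, h1, mul_one]

theorem transverseWeyl_grad_comm (s₀ : ScalarTest) (t : ℝ) (g : VectorTest × VectorTest) :
    transverseWeyl ω₀ ωtr (t • (0, grad s₀)) * transverseWeyl ω₀ ωtr g =
      transverseWeyl ω₀ ωtr g * transverseWeyl ω₀ ωtr (t • (0, grad s₀)) :=
  transverseWeyl_comm (by
    rw [isSymplectic_transverseForm.smul_left, transverseForm_grad_right, mul_zero])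

theorem gaugeGroup_comm_transverseWeyl (s₀ : ScalarTest) (t : ℝ) (g : VectorTest × VectorTest) :
    gaugeGroup ω₀ ωtr s₀ t * transverseWeyl ω₀ ωtr g =
      transverseWeyl ω₀ ωtr g * gaugeGroup ω₀ ωtr s₀ t := by
  rw [gaugeGroup, mul_assoc, transverseWeyl_grad_comm, ← mul_assoc,
    twistedWeyl_comm_transverseWeyl, mul_assoc]

theorem chargeDensity_comm_vectorPotential (hreg₀ : IsRegular ω₀) (hregtr : IsRegular ωtr)
    (s₀ : ScalarTest) (f : VectorTest) :
    HasScalarCommutator (chargeDensity ω₀ ωtr s₀) (vectorPotential ω₀ ωtr f) 0 :=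
  (isUnitaryGroup_transverseWeyl hregtr (f, 0)).hasScalarCommutator_zero
    (fun _ _ => gaugeGroup_comm_transverseWeyl s₀ _ _) (chargeDensity_le hreg₀ hregtr s₀)

theorem vectorPotentialDot_grad_comm (hregtr : IsRegular ωtr) (s₀ : ScalarTest) (f : VectorTest) :
    HasScalarCommutator (vectorPotentialDot ω₀ ωtr (grad s₀)) (vectorPotential ω₀ ωtr f) 0 :=
  (isUnitaryGroup_transverseWeyl hregtr (f, 0)).hasScalarCommutator_zero
    (V := fun t : ℝ => transverseWeyl ω₀ ωtr (t • (0, grad s₀)))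
    (fun t _ => transverseWeyl_grad_comm s₀ t _) le_rfl

theorem IsTransverseFock.transverseWeyl_eq_one (hF : IsTransverseFock ωtr) (hω : IsState ωtr)
    {f : VectorTest × VectorTest} (h1 : ∀ x, transverse f.1 x = 0) (h2 : ∀ x, transverse f.2 x = 0)
    (h : ∀ g, transverseForm f g = 0) (t : ℝ) : transverseWeyl ω₀ ωtr (t • f) = 1 := by
  rw [transverseWeyl, hF.gns_eq_one hω, tensorOp_one]
  · intro x
    change transverse (t • f.1) x = 0
    rw [transverse_smul, h1, smul_zero]
  · intro x
    change transverse (t • f.2) x = 0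
    rw [transverse_smul, h2, smul_zero]
  · intro g
    rw [isSymplectic_transverseForm.smul_left, h, mul_zero]

/-- Both gradient directions lie in the radical of η_tr and have zero transverse norm, so their
unitary groups are constantly 1 and have generator 0. -/
theorem IsTransverseFock.coulomb_condition (hF : IsTransverseFock ωtr) (hω : IsState ωtr)
    (s₀ : ScalarTest) :
    vectorPotential ω₀ ωtr (grad s₀) = 0 ∧ vectorPotentialDot ω₀ ωtr (grad s₀) = 0 := by
  constructor
  · rw [vectorPotential, ← stoneGenerator_one]
    exact congrArg stoneGenerator (funext fun t => hF.transverseWeyl_eq_one hω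
      (transverse_grad s₀) transverse_zero (transverseForm_grad_left s₀) t)
  · rw [vectorPotentialDot, ← stoneGenerator_one]
    exact congrArg stoneGenerator (funext fun t => hF.transverseWeyl_eq_one hω
      transverse_zero (transverse_grad s₀) (transverseForm_grad_right s₀) t)

end TensorOperators

end CoulombGauge

end

/-! ### The theorem -/

open CoulombGauge MeasureTheory in
theorem mainTheorem3
    (ω₀ : WeylFunctional scalarForm) (hω₀ : IsState ω₀) (hreg₀ : IsRegular ω₀)
    (ωtr : WeylFunctional transverseForm) (hωtr : IsState ωtr) :
    -- arbitrary regular states `ω₀`, `ω_tr`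
    (IsRegular ωtr →
      -- `E^λ(f)` is essentially self-adjoint
      (∀ f : VectorTest, ∃ U, IsExp (electricField ω₀ ωtr f) U) ∧
      -- `[E^λ(f), ψ(w)] = [φ^λ(div f), ψ(w)] = -ψ((σ ⋆ div f) w)`
      (∀ (f : VectorTest) (w : Spinor),
        ∃ h : MemLp (fun x => (coulombConv (divergence f) x : ℂ) • w x) 2 volume,
          HasCommutator (electricField ω₀ ωtr f) (dirac ω₀ ωtr w) (-dirac ω₀ ωtr h.toLp) ∧
          HasCommutator (phiField ω₀ ωtr (divergence f)) (dirac ω₀ ωtr w)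
            (-dirac ω₀ ωtr h.toLp)) ∧
      -- the kernel of `-(σ ⋆ div f)(y)` as a functional of `f` is `∂ₕσ(x - y)`
      (∀ (f : VectorTest) (y : Space),
        Integrable (fun x => inner ℝ (f x) (gradient coulomb (x - y))) volume ∧
        -coulombConv (divergence f) y = ∫ x, inner ℝ (f x) (gradient coulomb (x - y))) ∧
      -- `div E^λ(s₀) = -φ^λ(Δ s₀) + Ȧ(∇ s₀)`
      (∀ s₀ : ScalarTest, chargeDensity ω₀ ωtr s₀ =
        -phiField ω₀ ωtr (lap s₀) + vectorPotentialDot ω₀ ωtr (grad s₀)) ∧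
      -- `[div E^λ(s₀), ψ(w)] = -[φ^λ(Δ s₀), ψ(w)] = -ψ(s₀ w)`
      (∀ (s₀ : ScalarTest) (w : Spinor),
        ∃ h : MemLp (fun x => (s₀ x : ℂ) • w x) 2 volume,
          HasCommutator (chargeDensity ω₀ ωtr s₀) (dirac ω₀ ωtr w) (-dirac ω₀ ωtr h.toLp) ∧
          HasCommutator (-phiField ω₀ ωtr (lap s₀)) (dirac ω₀ ωtr w) (-dirac ω₀ ωtr h.toLp)) ∧
      -- `exp(it div E^λ(s₀)) ψ(w) exp(-it div E^λ(s₀)) = ψ(exp(-it s₀) w)`, and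
      -- `exp(it div E^λ(s₀))` commutes with `exp(ir A(f)) = W_tr(r f, 0)`
      (∀ s₀ : ScalarTest, ∃ U, IsExp (chargeDensity ω₀ ωtr s₀) U ∧
        (∀ (t : ℝ) (w : Spinor), U t * dirac ω₀ ωtr w * U (-t) =
          dirac ω₀ ωtr (phaseMul (fun x => -(t * s₀ x))
            (continuous_const.mul s₀.continuous).neg.aestronglyMeasurable w)) ∧
        (∀ (t : ℝ) (f : VectorTest) (r : ℝ),
          U t * transverseWeyl ω₀ ωtr (r • (f, 0)) =
            transverseWeyl ω₀ ωtr (r • (f, 0)) * U t)) ∧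
      -- `[div E^λ(s₀), A(f)] = [Ȧ(∇ s₀), A(f)] = -i ∫ ∇s₀ · P_tr f = 0`
      (∀ (s₀ : ScalarTest) (f : VectorTest),
        ∫ x, inner ℝ (grad s₀ x) (transverse f x) = 0 ∧
        HasScalarCommutator (chargeDensity ω₀ ωtr s₀) (vectorPotential ω₀ ωtr f) 0 ∧
        HasScalarCommutator (vectorPotentialDot ω₀ ωtr (grad s₀)) (vectorPotential ω₀ ωtr f)
          (-Complex.I * ((∫ x, inner ℝ (grad s₀ x) (transverse f x) : ℝ) : ℂ)))) ∧
    -- the transverse Fock state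
    (IsTransverseFock ωtr →
      IsRegular ωtr ∧
      ∀ s₀ : ScalarTest,
        vectorPotential ω₀ ωtr (grad s₀) = 0 ∧
        vectorPotentialDot ω₀ ωtr (grad s₀) = 0 ∧
        chargeDensity ω₀ ωtr s₀ = -phiField ω₀ ωtr (lap s₀)) := by
  refine ⟨fun hregtr => ⟨isExp_electricField hreg₀ hregtr, fun f w => ?_, coulombConv_divergence,
    chargeDensity_eq, hasCommutator_chargeDensity hreg₀ hregtr, fun s₀ => ?_, fun s₀ f => ?_⟩,
    fun hF => ⟨hF.isRegular hωtr, fun s₀ => ?_⟩⟩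
  · exact ⟨memLp_coulombConv_smul _ w, hasCommutator_electricField hreg₀ hregtr f w _,
      hasCommutator_phiField hreg₀ _ w _⟩
  · exact ⟨gaugeGroup ω₀ ωtr s₀, isExp_chargeDensity hreg₀ hregtr s₀,
      gaugeGroup_dirac hreg₀ hregtr s₀, fun t f r => gaugeGroup_comm_transverseWeyl s₀ t _⟩
  · refine ⟨integral_grad_transverse s₀ f, chargeDensity_comm_vectorPotential hreg₀ hregtr s₀ f, ?_⟩
    -- The canonical commutator value is zero by orthogonality, so commutation of the two groups is
    -- all that remains.
    rw [integral_grad_transverse, Complex.ofReal_zero, mul_zero]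
    exact vectorPotentialDot_grad_comm hregtr s₀ f
  · obtain ⟨h1, h2⟩ := hF.coulomb_condition (ω₀ := ω₀) hωtr s₀
    exact ⟨h1, h2, by rw [chargeDensity_eq, h2, add_zero]⟩
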